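/- Let $c\in(0,1]$ be a constant. For $\mu\in(-1,1)^n$ let $D_\mu$ be the product distribution on $\{-1,1\}^n$ with $\mathbf E_{x\sim D_\mu}[x_i]=\mu_i$ for all $i$; it is called $c$-bounded if $\mu\in[-1+c,1-c]^n$. There is a randomized membership-query algorithm $\mathcal A$ that efficiently PAC learns DNF expressions over all $c$-bounded product distributions, in the following sense. There are a polynomial $p$ and a deterministic hypothesis evaluator (all of $\mathcal A$, the evaluator and $p$ depending only on $c$) such that the following holds for all $n,s\in\mathbb N$, every real $\epsilon>0$, every $c$-bounded $\mu\in(-1,1)^n$ and every $f:\{-1,1\}^n\to\{-1,1\}$ that is computed by a DNF expression with at most $s$ terms (the value $1$ standing for true). The algorithm is given $n$, $s$ and $\lceil 1/\epsilon\rceil$ (but not $\mu$), can toss fair coins, can request independent random examples $(x,f(x))$ with $x\sim D_\mu$, and can query the value of $f$ at any point. It always halts within $p(n+s+\lceil 1/\epsilon\rceil)$ steps and outputs a description of a hypothesis $h$, which the evaluator evaluates at any given point of $\{-1,1\}^n$ within $p(n+s+\lceil 1/\epsilon\rceil)$ steps; and with probability at least $1/2$ over the examples and the coin tosses, $\Pr_{x\sim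 D_\mu}[h(x)=f(x)]\ge 1-\epsilon$. Here algorithms are programs with bounded loops over booleans, integers, pairs and lists, in which every operation takes one step, except that multiplications and divisions of integers are charged additionally the number of bits of their operands, and a query or a request for an example takes $1+n$ steps. -/

import Mathlib

namespace DNFLearn

/-! ## The cube, product distributions, DNF expressions -/

/-- The cube `{-1,1}^n`. -/
abbrev Cube (n : ℕ) : Type := Fin n → ℤˣ

/-- The probability that a `{-1,1}`-valued variable of expectation `m` equals `b`,
namely `(1 + m * b) / 2`; in particular it is `1` with probability `(1 + m) / 2`. -/
noncomputable def bitWeight (m : ℝ) (b : ℤˣ) : ENNReal :=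
  ENNReal.ofReal ((1 + m * ((b : ℤ) : ℝ)) / 2)

theorem sum_bitWeight (m : Set.Ioo (-1 : ℝ) 1) : ∑ b : ℤˣ, bitWeight m b = 1 := by
  obtain ⟨m, h1, h2⟩ := m
  have hu : (Finset.univ : Finset ℤˣ) = {1, -1} := by decide
  rw [hu, Finset.sum_pair (by decide)]
  unfold bitWeight
  rw [← ENNReal.ofReal_add]
  · simp only [Units.val_one, Units.val_neg, Int.cast_one, Int.cast_neg]
    rw [show (1 + m * 1) / 2 + (1 + m * -1) / 2 = 1 by ring, ENNReal.ofReal_one]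
  · simp only [Units.val_one, Int.cast_one]
    linarith
  · simp only [Units.val_one, Units.val_neg, Int.cast_one, Int.cast_neg]
    linarith

/-- The product distribution `D_μ` on `{-1,1}^n`, for `μ ∈ (-1,1)^n`: the coordinates are
independent and the `i`-th one has expectation `μ i`. -/
noncomputable def productDist {n : ℕ} (μ : Fin n → Set.Ioo (-1 : ℝ) 1) : PMF (Cube n) :=
  PMF.ofFintype (fun x => ∏ i, bitWeight (μ i) (x i)) (by
    rw [← Fintype.piFinset_univ, ← Finset.prod_univ_sum]
    exact Finset.prod_eq_one fun i _ => sum_bitWeight (μ i))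

/-- `D_μ` is `c`-bounded: `μ ∈ [-1+c, 1-c]^n`. -/
def IsBoundedBy {n : ℕ} (c : ℝ) (μ : Fin n → Set.Ioo (-1 : ℝ) 1) : Prop :=
  ∀ i, (μ i : ℝ) ∈ Set.Icc (-1 + c) (1 - c)

/-- The `c`-bounded product distributions on `{-1,1}^n`. -/
def boundedProductDists (c : ℝ) (n : ℕ) : Set (PMF (Cube n)) :=
  {D | ∃ μ : Fin n → Set.Ioo (-1 : ℝ) 1, IsBoundedBy c μ ∧ D = productDist μ}

/-- A literal: `(i, 1)` is the variable `x_i`, and `(i, -1)` is its negation. -/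
abbrev Literal (n : ℕ) : Type := Fin n × ℤˣ

/-- A term is a conjunction of literals. -/
abbrev Term (n : ℕ) : Type := Finset (Literal n)

/-- A DNF expression is a disjunction of terms; its size is the number of terms. -/
abbrev DNF (n : ℕ) : Type := List (Term n)

def Term.Holds {n : ℕ} (t : Term n) (x : Cube n) : Prop := ∀ l ∈ t, x l.1 = l.2

open Classical in
/-- The boolean function that a DNF computes, where `1` stands for true and `-1` for false. -/
noncomputable def DNF.value {n : ℕ} (φ : DNF n) (x : Cube n) : ℤˣ :=
  if ∃ t ∈ φ, Term.Holds t x then 1 else -1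

/-- `f` is an `s`-term DNF: it is computed by a DNF expression with at most `s` terms. -/
def IsDNFOfSize {n : ℕ} (f : Cube n → ℤˣ) (s : ℕ) : Prop :=
  ∃ φ : DNF n, φ.length ≤ s ∧ ∀ x, f x = DNF.value φ x

/-! ## Deterministic programs and their running time -/

/-- Data types of the programming language. -/
inductive Ty : Type
  | bool : Ty
  | int : Ty
  | prod : Ty → Ty → Ty
  | list : Ty → Ty

/-- The data of a type. -/
@[reducible] def Ty.Val : Ty → Type
  | .bool => Bool
  | .int => ℤ
  | .prod a b => a.Val × b.Val
  | .list a => List a.Val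

/-- Deterministic first-order programs taking a datum of the first type to a datum of the second.
All loops are bounded, so all programs terminate. -/
inductive Fn : Ty → Ty → Type
  /-- return the input -/
  | id {α : Ty} : Fn α α
  /-- run `f`, then run `g` on the result -/
  | comp {α β γ : Ty} (g : Fn β γ) (f : Fn α β) : Fn α γ
  | pair {α β γ : Ty} (f : Fn α β) (g : Fn α γ) : Fn α (.prod β γ)
  | fst {α β : Ty} : Fn (.prod α β) α
  | snd {α β : Ty} : Fn (.prod α β) β
  /-- boolean constants -/
  | boolConst {α : Ty} (b : Bool) : Fn α .bool
  | ite {α β : Ty} (c : Fn α .bool) (f g : Fn α β) : Fn α β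
  /-- integer constants -/
  | intConst {α : Ty} (k : ℤ) : Fn α .int
  | add {α : Ty} (f g : Fn α .int) : Fn α .int
  | sub {α : Ty} (f g : Fn α .int) : Fn α .int
  | mul {α : Ty} (f g : Fn α .int) : Fn α .int
  /-- integer quotient -/
  | div {α : Ty} (f g : Fn α .int) : Fn α .int
  /-- remainder -/
  | mod {α : Ty} (f g : Fn α .int) : Fn α .int
  | le {α : Ty} (f g : Fn α .int) : Fn α .bool
  | nil {α β : Ty} : Fn α (.list β)
  | cons {α β : Ty} (f : Fn α β) (l : Fn α (.list β)) : Fn α (.list β)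
  /-- case distinction on a list; in the second case head and tail are added to the input -/
  | caseList {α β γ : Ty} (l : Fn α (.list β)) (onNil : Fn α γ)
      (onCons : Fn (.prod (.prod α β) (.list β)) γ) : Fn α γ
  /-- run through a list from the left, updating a state -/
  | foldl {α β γ : Ty} (l : Fn α (.list β)) (init : Fn α γ)
      (body : Fn (.prod (.prod α γ) β) γ) : Fn α γ
  /-- update a state a given number of times (no times if the number is negative) -/
  | loop {α γ : Ty} (k : Fn α .int) (init : Fn α γ) (body : Fn (.prod α γ) γ) : Fn α γ

/-- The result of a program. -/
def Fn.eval : {α β : Ty} → Fn α β → α.Val → β.Val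
  | _, _, .id, e => e
  | _, _, .comp g f, e => g.eval (f.eval e)
  | _, _, .pair f g, e => (f.eval e, g.eval e)
  | _, _, .fst, e => e.1
  | _, _, .snd, e => e.2
  | _, _, .boolConst b, _ => b
  | _, _, .ite c f g, e => bif c.eval e then f.eval e else g.eval e
  | _, _, .intConst k, _ => k
  | _, _, .add f g, e => (f.eval e : ℤ) + (g.eval e : ℤ)
  | _, _, .sub f g, e => (f.eval e : ℤ) - (g.eval e : ℤ)
  | _, _, .mul f g, e => (f.eval e : ℤ) * (g.eval e : ℤ)
  | _, _, .div f g, e => (f.eval e : ℤ) / (g.eval e : ℤ)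
  | _, _, .mod f g, e => (f.eval e : ℤ) % (g.eval e : ℤ)
  | _, _, .le f g, e => decide ((f.eval e : ℤ) ≤ (g.eval e : ℤ))
  | _, _, .nil, _ => []
  | _, _, .cons f l, e => f.eval e :: l.eval e
  | _, _, .caseList l a b, e =>
      match l.eval e with
      | [] => a.eval e
      | y :: ys => b.eval ((e, y), ys)
  | _, _, .foldl l a b, e => (l.eval e).foldl (fun s y => b.eval ((e, s), y)) (a.eval e)
  | _, _, .loop k a b, e => (fun s => b.eval (e, s))^[Int.toNat (k.eval e)] (a.eval e)

/-- The time of running through a list with the update `step`, when one update of the state `s`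
with the entry `y` takes time `time s y`; there is an overhead of `1` per entry. -/
def foldTime {σ τ : Type} (step : σ → τ → σ) (time : σ → τ → ℕ) : σ → List τ → ℕ
  | _, [] => 0
  | s, y :: ys => 1 + time s y + foldTime step time (step s y) ys

/-- The time of a multiplication or division of `a` and `b`: one plus the lengths of their binary expansions. -/
def arithTime (a b : ℤ) : ℕ := 1 + a.natAbs.size + b.natAbs.size

/-- The running time of a program: every operation takes one unit of time, except that
multiplications and divisions are charged the number of bits of their operands. So the number of
bits of an integer exceeds that of the integers of the input and of the program by at most the time
spent, the length of a list likewise, and time in this sense is polynomially related to the time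
of a Turing machine. -/
def Fn.time : {α β : Ty} → Fn α β → α.Val → ℕ
  | _, _, .id, _ => 1
  | _, _, .comp g f, e => 1 + f.time e + g.time (f.eval e)
  | _, _, .pair f g, e => 1 + f.time e + g.time e
  | _, _, .fst, _ => 1
  | _, _, .snd, _ => 1
  | _, _, .boolConst _, _ => 1
  | _, _, .ite c f g, e => 1 + c.time e + bif c.eval e then f.time e else g.time e
  | _, _, .intConst _, _ => 1
  | _, _, .add f g, e => 1 + f.time e + g.time e
  | _, _, .sub f g, e => 1 + f.time e + g.time e
  | _, _, .mul f g, e => arithTime (f.eval e) (g.eval e) + f.time e + g.time e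
  | _, _, .div f g, e => arithTime (f.eval e) (g.eval e) + f.time e + g.time e
  | _, _, .mod f g, e => arithTime (f.eval e) (g.eval e) + f.time e + g.time e
  | _, _, .le f g, e => 1 + f.time e + g.time e
  | _, _, .nil, _ => 1
  | _, _, .cons f l, e => 1 + f.time e + l.time e
  | _, _, .caseList l a b, e =>
      1 + l.time e +
        match l.eval e with
        | [] => a.time e
        | y :: ys => b.time ((e, y), ys)
  | _, _, .foldl l a b, e =>
      1 + l.time e + a.time e +
        foldTime (fun s y => b.eval ((e, s), y)) (fun s y => b.time ((e, s), y))
          (a.eval e) (l.eval e)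
  | _, _, .loop k a b, e =>
      1 + k.time e + a.time e +
        ∑ i ∈ Finset.range (Int.toNat (k.eval e)),
          (1 + b.time (e, (fun s => b.eval (e, s))^[i] (a.eval e)))

/-! ## Randomized algorithms with membership queries and random examples -/

/-- A point of the cube, written as the list of its coordinates. -/
def encodePoint {n : ℕ} (x : Cube n) : List ℤ := List.ofFn fun i => ((x i : ℤˣ) : ℤ)

/-- The point that a list of integers denotes (entries other than `-1`, or missing, read as `1`). -/
def decodePoint (n : ℕ) (l : List ℤ) : Cube n :=
  fun i => if l.getD i 1 = -1 then -1 else 1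

theorem decodePoint_encodePoint {n : ℕ} (x : Cube n) : decodePoint n (encodePoint x) = x := by
  funext i
  rcases Int.units_eq_one_or (x i) with h | h <;> simp [decodePoint, encodePoint, h]

/-- Randomized algorithms with access to the oracles of the target function. -/
inductive Alg : Ty → Ty → Type
  /-- run a deterministic program -/
  | det {α β : Ty} (f : Fn α β) : Alg α β
  /-- toss a fair coin -/
  | flip {α : Ty} : Alg α .bool
  /-- request a random example `(x, f x)` -/
  | sample {α : Ty} : Alg α (.prod (.list .int) .int)
  /-- ask for the value of the target function at a point -/
  | query {α : Ty} (x : Fn α (.list .int)) : Alg α .int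
  /-- run `a`, then run `b` on the result -/
  | comp {α β γ : Ty} (b : Alg β γ) (a : Alg α β) : Alg α γ
  /-- run `a`, then run `b` on the input and the result -/
  | bind {α β γ : Ty} (a : Alg α β) (b : Alg (.prod α β) γ) : Alg α γ
  | ite {α β : Ty} (c : Fn α .bool) (a b : Alg α β) : Alg α β
  /-- update a state a given number of times (no times if the number is negative) -/
  | loop {α γ : Ty} (k : Fn α .int) (init : Fn α γ) (body : Alg (.prod α γ) γ) : Alg α γ

/-- Given a randomized step that takes a state to a new state and a running time, the distribution
of state and total time after `k` steps, starting in `s` at time `t`, with independent randomness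
in the steps and an overhead of `1` per step. -/
noncomputable def iterateStep {σ : Type} (step : σ → PMF (σ × ℕ)) (s : σ) (t : ℕ) :
    ℕ → PMF (σ × ℕ)
  | 0 => PMF.pure (s, t)
  | k + 1 => (iterateStep step s t k).bind fun r =>
      (step r.1).map fun q => (q.1, r.2 + 1 + q.2)

/-- The joint distribution of the output and the running time of an algorithm, with target function
`f` and random examples that are drawn independently from `D`. An oracle call takes time `1 + n`. -/
noncomputable def Alg.run {n : ℕ} (f : Cube n → ℤˣ) (D : PMF (Cube n)) :
    {α β : Ty} → Alg α β → α.Val → PMF (β.Val × ℕ)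
  | _, _, .det g, e => PMF.pure (g.eval e, g.time e)
  | _, _, .flip, _ => (PMF.uniformOfFintype Bool).map fun b => (b, 1)
  | _, _, .sample, _ => D.map fun x => ((encodePoint x, ((f x : ℤˣ) : ℤ)), 1 + n)
  | _, _, .query x, e =>
      PMF.pure (((f (decodePoint n (x.eval e)) : ℤˣ) : ℤ), 1 + n + x.time e)
  | _, _, .comp b a, e =>
      (Alg.run f D a e).bind fun r =>
        (Alg.run f D b r.1).map fun q => (q.1, 1 + r.2 + q.2)
  | _, _, .bind a b, e =>
      (Alg.run f D a e).bind fun r =>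
        (Alg.run f D b (e, r.1)).map fun q => (q.1, 1 + r.2 + q.2)
  | _, _, .ite c a b, e =>
      (bif c.eval e then Alg.run f D a e else Alg.run f D b e).map fun q =>
        (q.1, 1 + c.time e + q.2)
  | _, _, .loop k a b, e =>
      iterateStep (fun s => Alg.run f D b (e, s)) (a.eval e)
        (1 + k.time e + a.time e) (Int.toNat (k.eval e))

/-! ## Learning -/

/-- `g` is `ε`-close to `f` relative to `D`. Here `g` is integer valued, and a value other than
`-1` and `1` is an error. -/
def IsClose {n : ℕ} (D : PMF (Cube n)) (ε : ℝ) (f : Cube n → ℤˣ) (g : Cube n → ℤ) : Prop :=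
  ENNReal.ofReal (1 - ε) ≤ D.toOuterMeasure {x | g x = ((f x : ℤˣ) : ℤ)}

/-- The input `(n, s, ⌈1/ε⌉)` of a learning algorithm. -/
noncomputable def learnerInput (n s : ℕ) (ε : ℝ) :
    (Ty.prod .int (.prod .int .int)).Val :=
  ((n : ℤ), ((s : ℤ), ((⌈1 / ε⌉₊ : ℕ) : ℤ)))

/-- The membership query algorithm `A` efficiently PAC learns DNF expressions over all the
distributions in `𝒟`, with hypotheses that are data of type `H`, the datum `h` describing the
function computed by the deterministic program `E` on `h` and a point. The algorithm knows `n`, the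
bound `s` on the number of terms, and the accuracy, but not the distribution. With one polynomial
`p` for all targets and distributions, every run of `A` and every evaluation of a hypothesis that
`A` outputs takes time at most `p (n + s + ⌈1/ε⌉)`, and with probability at least `1/2` the
hypothesis is `ε`-close to the target. -/
def EfficientlyLearnsDNF {H : Ty} (A : Alg (.prod .int (.prod .int .int)) H)
    (E : Fn (.prod H (.list .int)) .int) (𝒟 : (n : ℕ) → Set (PMF (Cube n))) : Prop :=
  ∃ p : Polynomial ℕ, ∀ (n s : ℕ) (ε : ℝ), 0 < ε → ∀ D ∈ 𝒟 n,
    ∀ f : Cube n → ℤˣ, IsDNFOfSize f s →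
      (∀ r ∈ (A.run f D (learnerInput n s ε)).support,
        r.2 ≤ p.eval (n + s + ⌈1 / ε⌉₊) ∧
        ∀ x : Cube n, E.time (r.1, encodePoint x) ≤ p.eval (n + s + ⌈1 / ε⌉₊)) ∧
      1 / 2 ≤ (A.run f D (learnerInput n s ε)).toOuterMeasure
        {r | IsClose D ε f fun x => E.eval (r.1, encodePoint x)}

end DNFLearn

/-! The algorithm is a gradient descent in function space. It keeps a list of weighted terms whose
truncated running sum, divided by `K`, is a prediction `g` with values in `[-1,1]`. Each round adds,
with a small weight, a term that tends to be correlated with the difference `u = f - g` (`gap`). The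
hypothesis is the sign of the sum of all the predictions made on the way.

If `E|u|` is large, then `u` correlates with a term of the DNF or with the empty term, since `|u| ≤
2 ∑ u t - u` (`loss_lt`). Expanding that conjunction around the probabilities `p i` of its literals
gives a set `R` of variables for which the covariance `E[u ∏ (1[x i = a i] - p i)]`, the product
over `R`, is large (`exists_large_covariance`). The loss is polynomial, because under a `c`-bounded
distribution a long conjunction is almost never true and so has no large correlation.

The `p i` are unknown, but a second example `z` replaces them: `p i` is the mean of `1[z i = a i]`.
The resulting product `contrast` has two properties. Exchanging `x i` and `z i` for one `i ∈ R`
changes its sign; averaging over random exchanges shows that the function `r ↦ u (mix x z r)` on the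
uniform cube has, in the mean over `x` and `z`, a large Walsh coefficient at `R`
(`abs_covariance_le_coefficient`). And for fixed `z` it is, up to a sign, the indicator of the
conjunction of the literals `x i = -z i` for `i ∈ R`; so the conjunction over `R` with signs
opposite to a fresh example is correlated with `u` in the mean (`abs_covariance_le_correlation`).

So only `R` has to be found, and this is a Goldreich-Levin problem over the uniform distribution
(`le_doublingMean_votesFor`). From `k + 1` random points one forms `2 ^ k` pairwise independent
ones. The values of the character of `R` on them, up to a common sign, are determined by `k + 1`
signs, which are guessed by coin tosses. If the guess is right, the sign of a correlation decides
for each `i` whether `i ∈ R`. As `k` is logarithmic, success has inverse polynomial probability, and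
the mean squared correlation of the new term is at least some inverse polynomial `κ`
(`le_lmean_candidateDist`).

Success is never tested. The weight is estimated from one further example, so its mean is nearly
proportional to the correlation, and a useless term does harm only to second order: a round lowers
the expected squared error by `2/M` times the squared correlation, up to `13/M ^ 2`
(`mean_potential_extend_le`). Hence the errors `E|u|` of the `N` rounds have a small sum with
probability at least one half (`half_le_lossSum_lt`). Where the sign of the sum of the predictions
is wrong, the sum of the `u` is at least `N` in absolute value, so this happens rarely
(`isClose_of_lossSum_lt`).

The programs are tied to these distributions by `Alg.Runs`, which records the law of the output
together with a worst-case time bound. -/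

namespace DNFLearn

/-! ## Basic programs -/

namespace Fn

theorem eval_ite {α β : Ty} (c : Fn α .bool) (f g : Fn α β) (e : α.Val) :
    (ite c f g).eval e = if c.eval e = true then f.eval e else g.eval e := by
  simp only [Fn.eval]
  cases c.eval e <;> rfl

theorem eval_ite_of_iff {α β : Ty} {c : Fn α .bool} {f g : Fn α β} {e : α.Val} {P : Prop}
    [Decidable P] (h : c.eval e = true ↔ P) :
    (ite c f g).eval e = if P then f.eval e else g.eval e := by
  rw [eval_ite]
  exact if_congr h rfl rfl

theorem time_ite_le {α β : Ty} (c : Fn α .bool) (f g : Fn α β) (e : α.Val) :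
    (ite c f g).time e ≤ 1 + c.time e + max (f.time e) (g.time e) := by
  simp only [Fn.time]
  cases c.eval e
  · exact Nat.add_le_add_left (le_max_right _ _) _
  · exact Nat.add_le_add_left (le_max_left _ _) _

theorem eval_comp {α β γ : Ty} (g : Fn β γ) (f : Fn α β) (e : α.Val) :
    (comp g f).eval e = g.eval (f.eval e) := rfl

theorem eval_pair {α β γ : Ty} (f : Fn α β) (g : Fn α γ) (e : α.Val) :
    (pair f g).eval e = (f.eval e, g.eval e) := rfl

@[simp] theorem time_fst {α β : Ty} (e : (Ty.prod α β).Val) :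
    (fst : Fn (.prod α β) α).time e = 1 := rfl

@[simp] theorem time_snd {α β : Ty} (e : (Ty.prod α β).Val) :
    (snd : Fn (.prod α β) β).time e = 1 := rfl

@[simp] theorem time_id {α : Ty} (e : α.Val) : (id : Fn α α).time e = 1 := rfl

@[simp] theorem time_intConst {α : Ty} (k : ℤ) (e : α.Val) : (intConst k).time e = 1 := rfl

@[simp] theorem time_boolConst {α : Ty} (k : Bool) (e : α.Val) :
    (boolConst k : Fn α .bool).time e = 1 := rfl

@[simp] theorem time_nil {α β : Ty} (e : α.Val) : (nil : Fn α (.list β)).time e = 1 := rfl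

@[simp] theorem time_comp {α β γ : Ty} (g : Fn β γ) (f : Fn α β) (e : α.Val) :
    (comp g f).time e = 1 + f.time e + g.time (f.eval e) := rfl

@[simp] theorem time_pair {α β γ : Ty} (f : Fn α β) (g : Fn α γ) (e : α.Val) :
    (pair f g).time e = 1 + f.time e + g.time e := rfl

@[simp] theorem time_cons {α β : Ty} (f : Fn α β) (g : Fn α (.list β)) (e : α.Val) :
    (cons f g).time e = 1 + f.time e + g.time e := rfl

@[simp] theorem time_add {α : Ty} (f g : Fn α .int) (e : α.Val) :
    (add f g).time e = 1 + f.time e + g.time e := rfl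

@[simp] theorem time_sub {α : Ty} (f g : Fn α .int) (e : α.Val) :
    (sub f g).time e = 1 + f.time e + g.time e := rfl

@[simp] theorem time_le {α : Ty} (f g : Fn α .int) (e : α.Val) :
    (le f g).time e = 1 + f.time e + g.time e := rfl

theorem eval_le_iff {α : Ty} (f g : Fn α .int) (e : α.Val) :
    (le f g).eval e = true ↔ (f.eval e : ℤ) ≤ g.eval e :=
  decide_eq_true_iff

/-- The invariant is indexed by the number of updates made so far. `time_loop_le` takes the same
kind of invariant, because the body need be fast only on states that are reached. -/
theorem eval_loop_invariant {α γ : Ty} (k : Fn α .int) (a : Fn α γ) (b : Fn (.prod α γ) γ)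
    (e : α.Val) (I : ℕ → γ.Val → Prop) (h0 : I 0 (a.eval e))
    (hs : ∀ j s, j < Int.toNat (k.eval e) → I j s → I (j + 1) (b.eval (e, s))) :
    I (Int.toNat (k.eval e)) ((loop k a b).eval e) := by
  have key : ∀ j, j ≤ Int.toNat (k.eval e) → I j ((fun s => b.eval (e, s))^[j] (a.eval e)) := by
    intro j
    induction j with
    | zero => intro _; exact h0
    | succ j ih =>
      intro hj
      rw [Function.iterate_succ_apply']
      exact hs j _ hj (ih (by omega))
  exact key _ le_rfl

theorem time_loop_le {α γ : Ty} (k : Fn α .int) (a : Fn α γ) (b : Fn (.prod α γ) γ)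
    (e : α.Val) (I : ℕ → γ.Val → Prop) (h0 : I 0 (a.eval e))
    (hs : ∀ j s, j < Int.toNat (k.eval e) → I j s → I (j + 1) (b.eval (e, s))) (T : ℕ)
    (hT : ∀ j s, j < Int.toNat (k.eval e) → I j s → b.time (e, s) ≤ T) :
    (loop k a b).time e ≤ 1 + k.time e + a.time e + Int.toNat (k.eval e) * (1 + T) := by
  have key : ∀ j, j ≤ Int.toNat (k.eval e) → I j ((fun s => b.eval (e, s))^[j] (a.eval e)) := by
    intro j
    induction j with
    | zero => intro _; exact h0
    | succ j ih =>
      intro hj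
      rw [Function.iterate_succ_apply']
      exact hs j _ hj (ih (by omega))
  have h : ∑ i ∈ Finset.range (Int.toNat (k.eval e)),
      (1 + b.time (e, (fun s => b.eval (e, s))^[i] (a.eval e))) ≤
      ∑ i ∈ Finset.range (Int.toNat (k.eval e)), (1 + T) := by
    refine Finset.sum_le_sum fun i hi => ?_
    rw [Finset.mem_range] at hi
    exact Nat.add_le_add_left (hT i _ hi (key i hi.le)) 1
  rw [Finset.sum_const, Finset.card_range, smul_eq_mul] at h
  simp only [Fn.time]
  exact Nat.add_le_add_left h _

theorem time_loop_le_of_forall {α γ : Ty} (k : Fn α .int) (a : Fn α γ) (b : Fn (.prod α γ) γ)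
    (e : α.Val) (T : ℕ) (hT : ∀ s, b.time (e, s) ≤ T) :
    (loop k a b).time e ≤ 1 + k.time e + a.time e + Int.toNat (k.eval e) * (1 + T) :=
  time_loop_le k a b e (fun _ _ => True) trivial (fun _ _ _ _ => trivial) T fun _ s _ _ => hT s

theorem _root_.DNFLearn.foldTime_le {σ τ : Type} (step : σ → τ → σ) (time : σ → τ → ℕ) (T : ℕ)
    (l : List τ) : (∀ s, ∀ y ∈ l, time s y ≤ T) → ∀ s, foldTime step time s l ≤ l.length * (1 + T) := by
  induction l with
  | nil => intro _ s; simp [foldTime]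
  | cons y ys ih =>
    intro hT s
    have h1 := ih (fun s y hy => hT s y (List.mem_cons_of_mem _ hy)) (step s y)
    have h2 := hT s y List.mem_cons_self
    simp only [foldTime, List.length_cons]
    linarith

theorem time_foldl_le {α β γ : Ty} (l : Fn α (.list β)) (a : Fn α γ)
    (b : Fn (.prod (.prod α γ) β) γ) (e : α.Val) (T : ℕ)
    (hT : ∀ s, ∀ y ∈ l.eval e, b.time ((e, s), y) ≤ T) :
    (foldl l a b).time e ≤ 1 + l.time e + a.time e + (l.eval e).length * (1 + T) := by
  simp only [Fn.time]
  exact Nat.add_le_add_left (foldTime_le _ _ T _ hT _) _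

/-- The tail of a list. -/
def tail {β : Ty} : Fn (.list β) (.list β) := .caseList .id .nil .snd

@[simp] theorem eval_tail {β : Ty} (l : List β.Val) : (tail (β := β)).eval l = l.tail := by
  cases l <;> rfl

theorem time_tail_le {β : Ty} (l : List β.Val) : (tail (β := β)).time l ≤ 3 := by
  cases l <;> simp [tail, Fn.time, Fn.eval]

/-- The head of a list, and the value of `d` for the empty list. -/
def head {β : Ty} (d : Fn (.list β) β) : Fn (.list β) β :=
  .caseList .id d (.comp .snd .fst)

theorem time_head_le {β : Ty} (d : Fn (.list β) β) (l : List β.Val) :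
    (head d).time l ≤ 5 + d.time l := by
  cases l <;> simp [head, Fn.time, Fn.eval]

/-- The entry of a list at a given position, and `1` beyond the end of the list. -/
def nth : Fn (.prod (.list .int) .int) .int :=
  .comp (.head (.intConst 1)) (.loop .snd .fst (.comp tail .snd))

/-- Iterated tails drop an initial segment. The default `1` agrees with the one in `decodePoint`. -/
theorem eval_nth (l : List ℤ) (i : ℤ) : nth.eval (l, i) = l.getD i.toNat 1 := by
  have key : ∀ (k : ℕ) (l : List ℤ), List.tail^[k] l = l.drop k := by
    intro k
    induction k with
    | zero => intro l; rfl
    | succ k ih =>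
      intro l
      rw [Function.iterate_succ_apply, ih, List.drop_tail]
  have h2 : nth.eval (l, i) = (Fn.head (.intConst 1)).eval (l.drop i.toNat) := by
    rw [← key]
    simp only [nth, Fn.eval, eval_tail]
  rw [h2, List.getD_eq_getElem?_getD, ← List.head?_drop]
  cases l.drop i.toNat <;> rfl

theorem time_nth_le (p : List ℤ × ℤ) : nth.time p ≤ 7 * p.2.toNat + 12 := by
  have h := time_loop_le_of_forall (α := .prod (.list .int) .int) .snd .fst (.comp tail .snd) p 5
    (fun s => by
      have := time_tail_le (β := .int) s
      simp only [Fn.time, Fn.eval]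
      omega)
  have h2 := time_head_le (β := .int) (.intConst 1)
    ((Fn.loop (α := .prod (.list .int) .int) .snd .fst (.comp tail .snd)).eval p)
  simp only [nth, Fn.time, Fn.eval] at h h2 ⊢
  omega

/-- The list of the values of a program at `0, …, n - 1`. -/
def tabulate {α : Ty} (n : Fn α .int) (b : Fn (.prod α .int) .int) : Fn α (.list .int) :=
  .comp .snd (.loop n (.pair n .nil)
    (.pair (.sub (.comp .fst .snd) (.intConst 1))
      (.cons (.comp b (.pair .fst (.sub (.comp .fst .snd) (.intConst 1)))) (.comp .snd .snd))))

/-- The loop counts down from `n` and prepends, so after `j` steps the list consists of the last `j`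
entries, already in the right order. -/
theorem eval_tabulate {α : Ty} (nn : Fn α .int) (b : Fn (.prod α .int) .int) (e : α.Val) (n : ℕ)
    (hn : nn.eval e = (n : ℤ)) :
    (tabulate nn b).eval e = List.ofFn fun i : Fin n => b.eval (e, ((i : ℕ) : ℤ)) := by
  have h := eval_loop_invariant nn (.pair nn .nil)
    (.pair (.sub (.comp .fst .snd) (.intConst 1))
      (.cons (.comp b (.pair .fst (.sub (.comp .fst .snd) (.intConst 1)))) (.comp .snd .snd))) e
    (fun j s => s.1 = (n : ℤ) - j ∧
      s.2 = ((List.ofFn fun i : Fin n => b.eval (e, ((i : ℕ) : ℤ))).drop (n - j)))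
    ⟨by simp [Fn.eval, hn], by simp [Fn.eval]⟩
    (fun j s hj ⟨h1, h2⟩ => by
      rw [hn, Int.toNat_natCast] at hj
      refine ⟨by simp only [Fn.eval, h1]; push_cast; ring, ?_⟩
      have hlt : n - (j + 1) < n := by omega
      simp only [Fn.eval, h1, h2]
      rw [List.drop_eq_getElem_cons (i := n - (j + 1)) (by simpa using hlt)]
      congr 1
      · simp only [List.getElem_ofFn]
        congr 2
        exact (show (n : ℤ) - j - 1 = ((n - (j + 1) : ℕ) : ℤ) by omega)
      · congr 1
        omega)
  rw [hn, Int.toNat_natCast, Nat.sub_self] at h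
  exact h.2

theorem time_tabulate_le {α : Ty} (nn : Fn α .int) (b : Fn (.prod α .int) .int) (e : α.Val) (n : ℕ)
    (hn : nn.eval e = (n : ℤ)) (T : ℕ) (hT : ∀ i : ℕ, i < n → b.time (e, (i : ℤ)) ≤ T) :
    (tabulate nn b).time e ≤ 5 + 2 * nn.time e + n * (T + 20) := by
  have h := time_loop_le nn (.pair nn .nil)
    (.pair (.sub (.comp .fst .snd) (.intConst 1))
      (.cons (.comp b (.pair .fst (.sub (.comp .fst .snd) (.intConst 1)))) (.comp .snd .snd))) e
    (fun j s => s.1 = (n : ℤ) - j) (by simp [Fn.eval, hn])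
    (fun j s hj h1 => by simp only [Fn.eval, h1]; push_cast; ring) (T + 19)
    (fun j s hj h1 => by
      rw [hn, Int.toNat_natCast] at hj
      have hb := hT (n - (j + 1)) (by omega)
      have : (((n - (j + 1) : ℕ) : ℤ)) = n - j - 1 := by omega
      rw [this] at hb
      simp only [Fn.eval, Fn.time, h1]
      omega)
  rw [hn, Int.toNat_natCast] at h
  have h2 : (tabulate nn b).time e = 1 + _ + _ := rfl
  simp only [tabulate, Fn.time] at h ⊢
  linarith

/-- Whether a program returns `true` at all of `0, …, n - 1`. -/
def allBelow {α : Ty} (n : Fn α .int) (b : Fn (.prod α .int) .bool) : Fn α .bool :=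
  .comp .snd (.loop n (.pair (.intConst 0) (.boolConst true))
    (.pair (.add (.comp .fst .snd) (.intConst 1))
      (.ite (.comp b (.pair .fst (.comp .fst .snd))) (.comp .snd .snd) (.boolConst false))))

theorem eval_allBelow {α : Ty} (nn : Fn α .int) (b : Fn (.prod α .int) .bool) (e : α.Val) (n : ℕ)
    (hn : nn.eval e = (n : ℤ)) :
    (allBelow nn b).eval e = decide (∀ i < n, b.eval (e, ((i : ℕ) : ℤ)) = true) := by
  have h := eval_loop_invariant nn (.pair (.intConst 0) (.boolConst true))
    (.pair (.add (.comp .fst .snd) (.intConst 1))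
      (.ite (.comp b (.pair .fst (.comp .fst .snd))) (.comp .snd .snd) (.boolConst false))) e
    (fun j s => s.1 = (j : ℤ) ∧
      s.2 = decide (∀ i < j, b.eval (e, ((i : ℕ) : ℤ)) = true))
    ⟨by simp [Fn.eval], by simp [Fn.eval]⟩
    (fun j s hj ⟨h1, h2⟩ => by
      refine ⟨by simp only [Fn.eval, h1]; push_cast; ring, ?_⟩
      simp only [Fn.eval, h1, h2, Nat.forall_lt_succ_right]
      cases b.eval (e, ((j : ℕ) : ℤ)) <;> simp)
  rw [hn, Int.toNat_natCast] at h
  exact h.2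

theorem time_allBelow_le {α : Ty} (nn : Fn α .int) (b : Fn (.prod α .int) .bool) (e : α.Val)
    (n : ℕ) (hn : nn.eval e = (n : ℤ)) (T : ℕ)
    (hT : ∀ i : ℕ, i < n → b.time (e, (i : ℤ)) ≤ T) :
    (allBelow nn b).time e ≤ 6 + nn.time e + n * (T + 20) := by
  have h := time_loop_le nn (.pair (.intConst 0) (.boolConst true))
    (.pair (.add (.comp .fst .snd) (.intConst 1))
      (.ite (.comp b (.pair .fst (.comp .fst .snd))) (.comp .snd .snd) (.boolConst false))) e
    (fun j s => s.1 = (j : ℤ)) (by simp [Fn.eval])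
    (fun j s hj h1 => by simp only [Fn.eval, h1]; push_cast; ring) (T + 19)
    (fun j s hj h1 => by
      rw [hn, Int.toNat_natCast] at hj
      have hb := hT j hj
      simp only [Fn.eval, Fn.time, h1]
      cases b.eval (e, (j : ℤ)) <;> simp <;> omega)
  rw [hn, Int.toNat_natCast] at h
  simp only [allBelow, Fn.time] at h ⊢
  linarith

/-- Whether two integers are equal. -/
def eq {α : Ty} (a b : Fn α .int) : Fn α .bool := .ite (.le a b) (.le b a) (.boolConst false)

theorem eval_eq_iff {α : Ty} (a b : Fn α .int) (e : α.Val) :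
    (eq a b).eval e = true ↔ (a.eval e : ℤ) = b.eval e := by
  rw [eq, eval_ite]
  split_ifs with h <;> rw [eval_le_iff] at h
  · rw [eval_le_iff]
    exact ⟨fun h' => le_antisymm h h', fun h' => h'.symm.le⟩
  · exact ⟨fun h' => absurd h' (by simp [Fn.eval]), fun h' => absurd h'.le h⟩

theorem time_eq_le {α : Ty} (a b : Fn α .int) (e : α.Val) :
    (eq a b).time e ≤ 3 + 2 * a.time e + 2 * b.time e := by
  have h := time_ite_le (.le a b) (.le b a) (.boolConst false) e
  simp only [time_le, time_boolConst] at h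
  rw [eq]
  omega

/-- The reversal of a list. -/
def reverse {β : Ty} : Fn (.list β) (.list β) := .foldl .id .nil (.cons .snd (.comp .snd .fst))

@[simp] theorem eval_reverse {β : Ty} (l : List β.Val) :
    (reverse (β := β)).eval l = l.reverse := by
  simp only [reverse, Fn.eval]
  have : ∀ (l acc : List β.Val), l.foldl (fun s y => y :: s) acc = l.reverse ++ acc := by
    intro l
    induction l with
    | nil => intro acc; rfl
    | cons y ys ih => intro acc; simp [ih]
  simp [this l []]

theorem time_reverse_le {β : Ty} (l : List β.Val) :
    (reverse (β := β)).time l ≤ 3 + l.length * 6 := by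
  have h := time_foldl_le (α := .list β) (β := β) .id .nil (.cons .snd (.comp .snd .fst)) l 5
    (fun s y _ => by simp [Fn.time])
  simpa [reverse, Fn.time, Fn.eval] using h

/-- The length of a list. -/
def length {β : Ty} : Fn (.list β) .int :=
  .foldl .id (.intConst 0) (.add (.comp .snd .fst) (.intConst 1))

@[simp] theorem eval_length {β : Ty} (l : List β.Val) :
    (length (β := β)).eval l = (l.length : ℤ) := by
  simp only [length, Fn.eval]
  have : ∀ (l : List β.Val) (k : ℤ), l.foldl (fun s _ => s + 1) k = k + l.length := by
    intro l
    induction l with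
    | nil => intro k; simp
    | cons y ys ih => intro k; simp [ih]; ring
  simpa using this l 0

theorem time_length_le {β : Ty} (l : List β.Val) :
    (length (β := β)).time l ≤ 3 + l.length * 6 := by
  have h := time_foldl_le (α := .list β) (β := β) .id (.intConst 0)
    (.add (.comp .snd .fst) (.intConst 1)) l 5 (fun s y _ => by simp [Fn.time])
  simpa [length, Fn.time, Fn.eval] using h

/-- The power of an integer, with a fixed exponent. -/
def pow {α : Ty} (a : Fn α .int) : ℕ → Fn α .int
  | 0 => .intConst 1
  | k + 1 => .mul (pow a k) a

@[simp] theorem eval_pow {α : Ty} (a : Fn α .int) (k : ℕ) (e : α.Val) :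
    (pow a k).eval e = (a.eval e : ℤ) ^ k := by
  induction k with
  | zero => simp [pow, Fn.eval]
  | succ k ih => simp only [pow, Fn.eval, ih, pow_succ]

/-- Bounding the number of bits by the value is wasteful but sufficient: all operands that occur
have polynomially bounded values. -/
theorem _root_.DNFLearn.arithTime_le (a b : ℤ) : arithTime a b ≤ 1 + a.natAbs + b.natAbs := by
  have h : ∀ n : ℕ, n.size ≤ n := fun n => Nat.size_le.2 Nat.lt_two_pow_self
  have := h a.natAbs
  have := h b.natAbs
  unfold arithTime
  omega

theorem time_pow_le {α : Ty} (a : Fn α .int) (k : ℕ) (e : α.Val) (q : ℕ) (hq : 1 ≤ q)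
    (ha : a.eval e = (q : ℤ)) :
    (pow a k).time e ≤ 1 + k * (1 + q ^ k + q + a.time e) := by
  induction k with
  | zero => simp [pow]
  | succ k ih =>
    have h1 := arithTime_le ((pow a k).eval e) (a.eval e)
    simp only [eval_pow, ha] at h1
    rw [← Nat.cast_pow, Int.natAbs_natCast, Int.natAbs_natCast] at h1
    simp only [pow, Fn.time, eval_pow, ha]
    rw [← Nat.cast_pow]
    have h2 : q ^ k ≤ q ^ (k + 1) := Nat.pow_le_pow_right hq (Nat.le_succ k)
    have h3 : k * (1 + q ^ k + q + a.time e) ≤ k * (1 + q ^ (k + 1) + q + a.time e) := by gcongr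
    have h4 : (k + 1) * (1 + q ^ (k + 1) + q + a.time e) =
      k * (1 + q ^ (k + 1) + q + a.time e) + (1 + q ^ (k + 1) + q + a.time e) := by ring
    omega

end Fn

/-! ## Hypotheses and their evaluation -/

/-- The term that is written as a list of integers, one for each variable, `0` standing for the
absence of the variable, holds at `x`. -/
def CodeHolds {n : ℕ} (t : List ℤ) (x : Cube n) : Prop :=
  ∀ i : Fin n, t.getD i 1 = 0 ∨ t.getD i 1 = ((x i : ℤˣ) : ℤ)

instance {n : ℕ} (t : List ℤ) (x : Cube n) : Decidable (CodeHolds t x) := by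
  unfold CodeHolds; infer_instance

/-- The value of a list of weighted terms, added up from the end with truncation to `[-K, K]`. -/
def predict {n : ℕ} (K : ℤ) : List (ℤ × List ℤ) → Cube n → ℤ
  | [], _ => 0
  | p :: h, x => max (-K) (min (predict K h x + if CodeHolds p.2 x then p.1 else 0) K)

/-- The sum of the values of all proper final segments of a list of weighted terms. -/
def total {n : ℕ} (K : ℤ) : List (ℤ × List ℤ) → Cube n → ℤ
  | [], _ => 0
  | _ :: h, x => total K h x + predict K h x

theorem getD_encodePoint {n : ℕ} (x : Cube n) (i : Fin n) :
    (encodePoint x).getD i 1 = ((x i : ℤˣ) : ℤ) := by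
  simp [encodePoint]

/-- The type of points. -/
abbrev Ty.pt : Ty := .list .int

/-- The type of lists of weighted terms. -/
abbrev Ty.hyp : Ty := .list (.prod .int .pt)

namespace Fn

/-- The first component of the result. -/
def left {α β γ : Ty} (f : Fn α (.prod β γ)) : Fn α β := .comp .fst f

/-- The second component of the result. -/
def right {α β γ : Ty} (f : Fn α (.prod β γ)) : Fn α γ := .comp .snd f

@[simp] theorem eval_left {α β γ : Ty} (f : Fn α (.prod β γ)) (e : α.Val) :
    f.left.eval e = (f.eval e).1 := rfl

@[simp] theorem eval_right {α β γ : Ty} (f : Fn α (.prod β γ)) (e : α.Val) :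
    f.right.eval e = (f.eval e).2 := rfl

@[simp] theorem time_left {α β γ : Ty} (f : Fn α (.prod β γ)) (e : α.Val) :
    f.left.time e = f.time e + 2 := by
  simp only [left, Fn.time]; omega

@[simp] theorem time_right {α β γ : Ty} (f : Fn α (.prod β γ)) (e : α.Val) :
    f.right.time e = f.time e + 2 := by
  simp only [right, Fn.time]; omega

/-- The entry of a list at a position. -/
def at' {α : Ty} (l : Fn α .pt) (i : Fn α .int) : Fn α .int := .comp nth (.pair l i)

@[simp] theorem eval_at {α : Ty} (l : Fn α .pt) (i : Fn α .int) (e : α.Val) :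
    (at' l i).eval e = (l.eval e).getD (Int.toNat (i.eval e)) 1 :=
  eval_nth _ _

theorem time_at_le {α : Ty} (l : Fn α .pt) (i : Fn α .int) (e : α.Val) :
    (at' l i).time e ≤ 7 * Int.toNat (i.eval e) + 14 + l.time e + i.time e := by
  have := time_nth_le ((pair l i).eval e)
  simp only [at', Fn.time, Fn.eval] at this ⊢
  omega

/-- Input `((n, (t, x)), i)`: whether the entry `i` of the term `t` admits `x`. -/
def entryHolds : Fn (.prod (.prod .int (.prod .pt .pt)) .int) .bool :=
  .ite (eq (at' Fn.fst.right.left .snd) (.intConst 0)) (.boolConst true)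
    (eq (at' Fn.fst.right.left .snd) (at' Fn.fst.right.right .snd))

theorem eval_entryHolds_iff (p : (Ty.prod (Ty.prod .int (.prod .pt .pt)) .int).Val) :
    entryHolds.eval p = true ↔ p.1.2.1.getD (Int.toNat p.2) 1 = 0 ∨
      p.1.2.1.getD (Int.toNat p.2) 1 = p.1.2.2.getD (Int.toNat p.2) 1 := by
  rw [entryHolds, eval_ite]
  split_ifs with h
  · rw [eval_eq_iff, eval_at] at h
    exact ⟨fun _ => Or.inl h, fun _ => rfl⟩
  · rw [eval_eq_iff, eval_at] at h
    rw [eval_eq_iff, eval_at, eval_at]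
    exact ⟨fun h' => Or.inr h', fun h' => h'.resolve_left h⟩

theorem time_entryHolds_le (p : (Ty.prod (Ty.prod .int (.prod .pt .pt)) .int).Val) :
    entryHolds.time p ≤ 42 * Int.toNat p.2 + 140 := by
  have h1 := time_eq_le (at' Fn.fst.right.left .snd) (.intConst 0) p
  have h2 := time_eq_le (at' Fn.fst.right.left .snd) (at' Fn.fst.right.right .snd) p
  have h3 := time_at_le Fn.fst.right.left .snd p
  have h4 := time_at_le Fn.fst.right.right .snd p
  have h5 := time_ite_le (eq (at' Fn.fst.right.left .snd) (.intConst 0)) (.boolConst true)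
    (eq (at' Fn.fst.right.left .snd) (at' Fn.fst.right.right .snd)) p
  simp only [time_fst, time_snd, time_intConst, time_boolConst, Fn.eval, time_left,
    time_right] at h1 h2 h3 h4 h5
  rw [entryHolds]
  omega

/-- Input `(n, (t, x))`: whether the term `t` holds at `x`. -/
def codeHolds : Fn (.prod .int (.prod .pt .pt)) .bool := allBelow .fst entryHolds

theorem eval_codeHolds_iff {n : ℕ} (t : List ℤ) (x : Cube n) :
    codeHolds.eval ((n : ℤ), (t, encodePoint x)) = true ↔ CodeHolds t x := by
  rw [codeHolds, eval_allBelow _ _ _ n rfl, decide_eq_true_iff]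
  constructor
  · intro h i
    rw [← getD_encodePoint]
    exact (eval_entryHolds_iff _).1 (h i i.2)
  · intro h i hi
    refine (eval_entryHolds_iff _).2 ?_
    have h2 := h ⟨i, hi⟩
    rw [← getD_encodePoint] at h2
    exact h2

theorem time_codeHolds_le (n : ℕ) (p : List ℤ × List ℤ) :
    codeHolds.time ((n : ℤ), p) ≤ 200 * (n + 1) ^ 2 := by
  have h := time_allBelow_le (α := .prod .int (.prod .pt .pt)) .fst entryHolds ((n : ℤ), p) n rfl
    (42 * n + 140) (fun i hi => (time_entryHolds_le _).trans (by
      rw [Int.toNat_natCast]; omega))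
  simp only [Fn.time] at h
  rw [codeHolds]
  nlinarith

/-- Input `(v, K)`: the truncation of `v` to `[-K, K]`. -/
def clamp : Fn (.prod .int .int) .int :=
  .ite (.le .fst .snd) (.ite (.le (.sub (.intConst 0) .snd) .fst) .fst (.sub (.intConst 0) .snd)) .snd

theorem eval_clamp (v : ℤ) (K : ℕ) : clamp.eval (v, (K : ℤ)) = max (-(K : ℤ)) (min v K) := by
  rw [clamp, eval_ite_of_iff (eval_le_iff _ _ _), eval_ite_of_iff (eval_le_iff _ _ _)]
  change (if v ≤ K then if (0 : ℤ) - K ≤ v then v else 0 - K else K) = _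
  split_ifs <;> omega

theorem time_clamp_le (p : (Ty.prod .int .int).Val) : clamp.time p ≤ 20 := by
  have h1 := time_ite_le (.le (.sub (.intConst 0) .snd) .fst) .fst (.sub (.intConst 0) .snd) p
  have h2 := time_ite_le (.le .fst .snd)
    (.ite (.le (.sub (.intConst 0) .snd) .fst) .fst (.sub (.intConst 0) .snd)) .snd p
  simp only [time_fst, time_snd, time_intConst, time_le, time_sub] at h1 h2
  rw [clamp]
  omega

/-- Input `((((( n, K), h), x), (g, s)), (w, t))`: the update of the values `g` of `predict` and `s`
of `total` on adding `(w, t)` to the list of weighted terms. -/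
def predictStep : Fn (.prod (.prod (.prod (.prod (.prod .int .int) .hyp) .pt) (.prod .int .int))
    (.prod .int .pt)) (.prod .int .int) :=
  .pair
    (.comp clamp (.pair (.add Fn.fst.right.left
      (.ite (.comp codeHolds
          (.pair Fn.fst.left.left.left.left (.pair Fn.snd.right Fn.fst.left.right)))
            Fn.snd.left (.intConst 0))) Fn.fst.left.left.left.right))
    (.add Fn.fst.right.right Fn.fst.right.left)

theorem eval_predictStep {n : ℕ} (K : ℕ) (h : List (ℤ × List ℤ)) (x : Cube n) (s : ℤ × ℤ)
    (y : ℤ × List ℤ) :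
    predictStep.eval ((((((n : ℤ), (K : ℤ)), h), encodePoint x), s), y) =
      (max (-(K : ℤ)) (min (s.1 + if CodeHolds y.2 x then y.1 else 0) K), s.2 + s.1) := by
  simp only [predictStep, Fn.eval, eval_left, eval_right]
  refine Prod.ext ?_ rfl
  refine (eval_clamp _ K).trans ?_
  have h1 := eval_codeHolds_iff y.2 x
  by_cases h2 : CodeHolds y.2 x
  · rw [h1.2 h2, if_pos h2]; rfl
  · rw [if_neg h2, Bool.eq_false_iff.2 (mt h1.1 h2)]; rfl

theorem time_predictStep_le (n : ℕ)
    (p : (Ty.prod (.prod (.prod (.prod (.prod .int .int) .hyp) .pt) (.prod .int .int))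
      (.prod .int .pt)).Val) (hn : p.1.1.1.1.1 = (n : ℤ)) :
    predictStep.time p ≤ 200 * (n + 1) ^ 2 + 100 := by
  have h1 := time_codeHolds_le n (p.2.2, p.1.1.2)
  have h2 := time_ite_le (.comp codeHolds
    (.pair Fn.fst.left.left.left.left (.pair Fn.snd.right Fn.fst.left.right)))
    Fn.snd.left (.intConst 0) p
  have h3 : (Fn.comp codeHolds (Fn.pair Fn.fst.left.left.left.left (.pair Fn.snd.right
    Fn.fst.left.right))).time p =
    20 + codeHolds.time (p.1.1.1.1.1, (p.2.2, p.1.1.2)) := rfl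
  rw [hn] at h3
  simp only [time_snd, time_left, time_intConst] at h2
  simp only [predictStep, time_pair, time_comp clamp, time_add, time_left, time_right, time_fst]
  have h4 := time_clamp_le ((Fn.pair (.add Fn.fst.right.left
      (.ite (.comp codeHolds
          (.pair Fn.fst.left.left.left.left (.pair Fn.snd.right Fn.fst.left.right)))
            Fn.snd.left (.intConst 0))) Fn.fst.left.left.left.right).eval p)
  omega

/-- Input `(((n, K), h), x)`: the values of `predict` and `total`. -/
def predictTotal : Fn (.prod (.prod (.prod .int .int) .hyp) .pt) (.prod .int .int) :=
  .foldl (.comp reverse Fn.fst.right) (.pair (.intConst 0) (.intConst 0)) predictStep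

/-- The head of the list is the newest term, so the recursion of `predict` starts at the end; the
reversal turns the left fold into a right fold. The second component is updated with the old
prediction, which is why `total` involves proper final segments only. -/
theorem eval_predictTotal {n : ℕ} (K : ℕ) (h : List (ℤ × List ℤ)) (x : Cube n) :
    predictTotal.eval ((((n : ℤ), (K : ℤ)), h), encodePoint x) =
      (predict K h x, total K h x) := by
  simp only [predictTotal, Fn.eval, eval_reverse, eval_right, List.foldl_reverse]
  have : ∀ l : List (ℤ × List ℤ), l.foldr (fun y s => predictStep.eval
      ((((((n : ℤ), (K : ℤ)), h), encodePoint x), s), y)) ((0 : ℤ), (0 : ℤ)) =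
      (predict K l x, total K l x) := by
    intro l
    induction l with
    | nil => rfl
    | cons p l ih =>
      rw [List.foldr_cons, ih, eval_predictStep]
      rfl
  exact this h

theorem time_predictTotal_le (n : ℕ) (p : (Ty.prod (.prod (.prod .int .int) .hyp) .pt).Val)
    (hn : p.1.1.1 = (n : ℤ)) :
    predictTotal.time p ≤ (p.1.2.length + 1) * (400 * (n + 1) ^ 2) := by
  have h1 := time_foldl_le (.comp reverse Fn.fst.right) (.pair (.intConst 0) (.intConst 0))
    predictStep p (200 * (n + 1) ^ 2 + 100) (fun s y _ => time_predictStep_le n _ hn)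
  have h2 := time_reverse_le (β := .prod .int .pt) p.1.2
  have h4 : ((Fn.comp reverse Fn.fst.right).eval p).length = p.1.2.length := by
    simp only [Fn.eval, eval_right, eval_reverse, List.length_reverse]
  have h5 : (Fn.comp reverse Fn.fst.right).time p =
    1 + 3 + (reverse (β := .prod .int .pt)).time p.1.2 := rfl
  rw [h4, h5] at h1
  rw [predictTotal]
  refine h1.trans ?_
  simp only [time_pair, time_intConst]
  have h3 : 1 ≤ (n + 1) ^ 2 := Nat.one_le_pow _ _ (by omega)
  nlinarith

/-- Input `((((n, K), h), x), b)`: the difference of `K * b` and the value of `predict` at `x`,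
for `b` equal to `-1` or `1`. -/
def margin : Fn (.prod (.prod (.prod (.prod .int .int) .hyp) .pt) .int) .int :=
  .sub (.ite (.le .snd (.intConst 0)) (.sub (.intConst 0) Fn.fst.left.left.right)
    Fn.fst.left.left.right) (.comp .fst (.comp predictTotal .fst))

/-- With `b` the answer of an oracle at `x`, this is the scaled residual there. -/
theorem eval_margin {n : ℕ} (K : ℕ) (h : List (ℤ × List ℤ)) (x : Cube n) (b : ℤˣ) :
    margin.eval (((((n : ℤ), (K : ℤ)), h), encodePoint x), (b : ℤ)) =
      (K : ℤ) * b - predict K h x := by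
  have h1 : (predictTotal.eval ((((n : ℤ), (K : ℤ)), h), encodePoint x)).1 = predict K h x :=
    congrArg Prod.fst (eval_predictTotal K h x)
  rw [margin, Fn.eval, eval_ite_of_iff (eval_le_iff _ _ _)]
  change (if (b : ℤ) ≤ 0 then (0 : ℤ) - K else K) -
    (predictTotal.eval ((((n : ℤ), (K : ℤ)), h), encodePoint x)).1 = _
  rw [h1]
  rcases Int.units_eq_one_or b with rfl | rfl <;> simp

theorem time_margin_le (n : ℕ)
    (p : (Ty.prod (.prod (.prod (.prod .int .int) .hyp) .pt) .int).Val)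
    (hn : p.1.1.1.1 = (n : ℤ)) :
    margin.time p ≤ (p.1.1.2.length + 1) * (500 * (n + 1) ^ 2) := by
  have h1 := time_predictTotal_le n p.1 hn
  have h3 : 1 ≤ (n + 1) ^ 2 := Nat.one_le_pow _ _ (by omega)
  have h2 := time_ite_le (.le .snd (.intConst 0)) (.sub (.intConst 0) Fn.fst.left.left.right)
    Fn.fst.left.left.right p
  simp only [time_snd, time_left, time_right, time_fst, time_intConst, time_le, time_sub] at h2
  have h4 : (p.1.1.2.length + 1) * (400 * (n + 1) ^ 2) + 100 ≤
      (p.1.1.2.length + 1) * (500 * (n + 1) ^ 2) := by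
    nlinarith
  refine le_trans ?_ h4
  refine le_trans ?_ (Nat.add_le_add_right h1 100)
  change 1 + _ + (1 + (1 + 1 + predictTotal.time p.1) + 1) ≤ _
  omega

end Fn

/-- The point that agrees with `x` where `r` is `1` and with `z` elsewhere. -/
def mix {n : ℕ} (x z r : Cube n) : Cube n := fun i => if r i = 1 then x i else z i

/-- The point with the coordinate `i` equal to `-1` and all others equal to `1`. -/
def signAt {n : ℕ} (i : Fin n) : Cube n := Pi.mulSingle i (-1)

/-! ### Query points in the subcube spanned by two examples -/

namespace Fn

/-- Input `(((n, i), (v, (x, z))), j)`: the coordinate `j` of `mix x z (v * signAt i)`. -/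
def mixedEntry : Fn (.prod (.prod (.prod .int .int) (.prod .pt (.prod .pt .pt))) .int) .int :=
  .ite (eq .snd Fn.fst.left.right)
    (.ite (.le (at' Fn.fst.right.left .snd) (.intConst 0))
      (at' Fn.fst.right.right.left .snd) (at' Fn.fst.right.right.right .snd))
    (.ite (.le (at' Fn.fst.right.left .snd) (.intConst 0))
      (at' Fn.fst.right.right.right .snd) (at' Fn.fst.right.right.left .snd))

/-- Multiplication by `signAt i` just exchanges the roles of `x` and `z` at the coordinate `i`,
hence the two mirrored branches. -/
theorem eval_mixedEntry {n : ℕ} (i j : Fin n) (v x z : Cube n) :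
    mixedEntry.eval ((((n : ℤ), ((i : ℕ) : ℤ)), (encodePoint v, (encodePoint x, encodePoint z))),
      ((j : ℕ) : ℤ)) = ((mix x z (v * signAt i) j : ℤˣ) : ℤ) := by
  have h : ∀ y : Cube n, (encodePoint y).getD (Int.toNat ((j : ℕ) : ℤ)) 1 = ((y j : ℤˣ) : ℤ) :=
    fun y => by rw [Int.toNat_natCast, getD_encodePoint]
  rw [mixedEntry, eval_ite_of_iff (eval_eq_iff _ _ _), eval_ite_of_iff (eval_le_iff _ _ _),
    eval_ite_of_iff (eval_le_iff _ _ _)]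
  simp only [eval_at]
  change (if ((j : ℕ) : ℤ) = ((i : ℕ) : ℤ) then
      if (encodePoint v).getD (Int.toNat ((j : ℕ) : ℤ)) 1 ≤ 0 then
        (encodePoint x).getD (Int.toNat ((j : ℕ) : ℤ)) 1
      else (encodePoint z).getD (Int.toNat ((j : ℕ) : ℤ)) 1
    else if (encodePoint v).getD (Int.toNat ((j : ℕ) : ℤ)) 1 ≤ 0 then
        (encodePoint z).getD (Int.toNat ((j : ℕ) : ℤ)) 1
      else (encodePoint x).getD (Int.toNat ((j : ℕ) : ℤ)) 1) = _
  simp only [h, mix, signAt, Pi.mul_apply, Nat.cast_inj, ← Fin.ext_iff]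
  by_cases hj : j = i
  · subst hj
    rcases Int.units_eq_one_or (v j) with hv | hv <;> simp [hv]
  · rcases Int.units_eq_one_or (v j) with hv | hv <;> simp [hv, hj]

theorem time_mixedEntry_le
    (p : (Ty.prod (.prod (.prod .int .int) (.prod .pt (.prod .pt .pt))) .int).Val) :
    mixedEntry.time p ≤ 14 * Int.toNat p.2 + 100 := by
  have h1 := time_eq_le .snd Fn.fst.left.right p
  have h2 := time_at_le Fn.fst.right.left .snd p
  have h3 := time_at_le Fn.fst.right.right.left .snd p
  have h4 := time_at_le Fn.fst.right.right.right .snd p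
  have h5 := time_ite_le (.le (at' Fn.fst.right.left .snd) (.intConst 0))
    (at' Fn.fst.right.right.left .snd) (at' Fn.fst.right.right.right .snd) p
  have h6 := time_ite_le (.le (at' Fn.fst.right.left .snd) (.intConst 0))
    (at' Fn.fst.right.right.right .snd) (at' Fn.fst.right.right.left .snd) p
  have h7 := time_ite_le (eq .snd Fn.fst.left.right)
    (.ite (.le (at' Fn.fst.right.left .snd) (.intConst 0))
      (at' Fn.fst.right.right.left .snd) (at' Fn.fst.right.right.right .snd))
    (.ite (.le (at' Fn.fst.right.left .snd) (.intConst 0))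
      (at' Fn.fst.right.right.right .snd) (at' Fn.fst.right.right.left .snd)) p
  simp only [Fn.eval, time_left, time_right, time_fst, time_snd, time_le, time_intConst]
    at h1 h2 h3 h4 h5 h6 h7
  rw [mixedEntry]
  omega

/-- Input `((n, i), (v, (x, z)))`: the code of `mix x z (v * signAt i)`. -/
def mixedPoint : Fn (.prod (.prod .int .int) (.prod .pt (.prod .pt .pt))) .pt :=
  tabulate Fn.fst.left mixedEntry

theorem eval_mixedPoint {n : ℕ} (i : Fin n) (v x z : Cube n) :
    mixedPoint.eval (((n : ℤ), ((i : ℕ) : ℤ)), (encodePoint v, (encodePoint x, encodePoint z))) =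
      encodePoint (mix x z (v * signAt i)) := by
  rw [mixedPoint, eval_tabulate _ _ _ n rfl, encodePoint]
  exact congrArg List.ofFn (funext fun j => eval_mixedEntry i j v x z)

theorem time_mixedPoint_le (n : ℕ) (i : ℤ) (p : List ℤ × List ℤ × List ℤ) :
    mixedPoint.time (((n : ℤ), i), p) ≤ 200 * (n + 1) ^ 2 := by
  have h := time_tabulate_le (α := .prod (.prod .int .int) (.prod .pt (.prod .pt .pt)))
    Fn.fst.left mixedEntry (((n : ℤ), i), p) n rfl (14 * n + 100)
    (fun j hj => (time_mixedEntry_le _).trans (by rw [Int.toNat_natCast]; omega))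
  simp only [Fn.time, time_left] at h
  rw [mixedPoint]
  nlinarith

end Fn

open scoped ENNReal

/-! ## Output distributions and running times of randomized algorithms -/

theorem PMF.bind_congr_support {α β : Type*} {μ : PMF α} {ν ν' : α → PMF β}
    (h : ∀ a ∈ μ.support, ν a = ν' a) : μ.bind ν = μ.bind ν' := by
  ext b
  rw [PMF.bind_apply, PMF.bind_apply]
  refine tsum_congr fun a => ?_
  by_cases ha : μ a = 0
  · rw [ha, zero_mul, zero_mul]
  · rw [h a ((PMF.mem_support_iff _ _).2 ha)]

/-- The distribution of the state of a Markov chain after a number of steps. -/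
noncomputable def iterateBind {σ : Type*} (ν : σ → PMF σ) (s : σ) : ℕ → PMF σ
  | 0 => PMF.pure s
  | k + 1 => (iterateBind ν s k).bind ν

namespace Alg

variable {n : ℕ} {f : Cube n → ℤˣ} {D : PMF (Cube n)}

/-- The output of `A` has the distribution `μ`, and `A` takes time at most `T`. -/
def Runs (f : Cube n → ℤˣ) (D : PMF (Cube n)) {α β : Ty} (A : Alg α β) (e : α.Val)
    (μ : PMF β.Val) (T : ℕ) : Prop :=
  (A.run f D e).map Prod.fst = μ ∧ ∀ r ∈ (A.run f D e).support, r.2 ≤ T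

theorem Runs.mono {α β : Ty} {A : Alg α β} {e : α.Val} {μ : PMF β.Val} {T T' : ℕ}
    (h : Runs f D A e μ T) (hT : T ≤ T') : Runs f D A e μ T' :=
  ⟨h.1, fun r hr => (h.2 r hr).trans hT⟩

theorem runs_det {α β : Ty} (g : Fn α β) (e : α.Val) {v : β.Val} (hv : g.eval e = v) {T : ℕ}
    (hT : g.time e ≤ T) : Runs f D (.det g) e (PMF.pure v) T := by
  subst hv
  simp only [Runs, Alg.run, PMF.pure_map, PMF.support_pure, Set.mem_singleton_iff, forall_eq]
  exact ⟨trivial, hT⟩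

theorem runs_flip {α : Ty} (e : α.Val) :
    Runs f D (.flip : Alg α .bool) e (PMF.uniformOfFintype Bool) 1 := by
  refine ⟨?_, ?_⟩
  · simp only [Alg.run, PMF.map_comp]
    exact PMF.map_id _
  · intro r hr
    simp only [Alg.run, PMF.support_map] at hr
    obtain ⟨b, -, rfl⟩ := hr
    exact le_rfl

theorem runs_sample {α : Ty} (e : α.Val) :
    Runs f D (.sample : Alg α _) e (D.map fun x => (encodePoint x, ((f x : ℤˣ) : ℤ))) (1 + n) := by
  refine ⟨?_, ?_⟩
  · simp only [Alg.run, PMF.map_comp]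
    rfl
  · intro r hr
    simp only [Alg.run, PMF.support_map] at hr
    obtain ⟨b, -, rfl⟩ := hr
    exact le_rfl

theorem runs_query {α : Ty} (g : Fn α .pt) (e : α.Val) (x : Cube n)
    (hx : g.eval e = encodePoint x) {T : ℕ} (hT : g.time e ≤ T) :
    Runs f D (.query g) e (PMF.pure ((f x : ℤˣ) : ℤ)) (1 + n + T) := by
  simp only [Runs, Alg.run, PMF.pure_map, PMF.support_pure, Set.mem_singleton_iff, forall_eq]
  refine ⟨?_, by omega⟩
  congr 3
  rw [hx, decodePoint_encodePoint]

/-- The intermediate law is given on mathematical objects `σ` and transported by an encoding `φ`.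
The second program then needs to be analysed only at codes of objects in the support, where facts
such as the length of a list are available. -/
theorem Runs.comp {α β γ : Ty} {σ : Type*} {a : Alg α β} {b : Alg β γ} {e : α.Val} {μ : PMF σ}
    {φ : σ → β.Val} {ν : σ → PMF γ.Val} {T S : ℕ} (ha : Runs f D a e (μ.map φ) T)
    (hb : ∀ s ∈ μ.support, Runs f D b (φ s) (ν s) S) :
    Runs f D (.comp b a) e (μ.bind ν) (1 + T + S) := by
  obtain ⟨ha1, ha2⟩ := ha
  refine ⟨?_, ?_⟩
  · simp only [Alg.run, PMF.map_bind, PMF.map_comp]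
    have : ((Alg.run f D a e).bind fun r => (Alg.run f D b r.1).map
        (Prod.fst ∘ fun q => (q.1, 1 + r.2 + q.2))) =
        ((Alg.run f D a e).map Prod.fst).bind fun v => (Alg.run f D b v).map Prod.fst := by
      rw [PMF.bind_map]
      rfl
    rw [this, ha1, PMF.bind_map]
    exact PMF.bind_congr_support fun s hs => (hb s hs).1
  · intro r hr
    simp only [Alg.run, PMF.mem_support_bind_iff, PMF.support_map, Set.mem_image] at hr
    obtain ⟨q, hq, q', hq', rfl⟩ := hr
    have h1 : q.1 ∈ (μ.map φ).support := by
      rw [← ha1, PMF.support_map]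
      exact ⟨q, hq, rfl⟩
    rw [PMF.support_map] at h1
    obtain ⟨s, hs, hs'⟩ := h1
    have h2 := (hb s hs).2 q' (by rw [hs']; exact hq')
    have h3 := ha2 q hq
    simp only
    omega

theorem Runs.bind {α β γ : Ty} {σ : Type*} {a : Alg α β} {b : Alg (.prod α β) γ} {e : α.Val}
    {μ : PMF σ} {φ : σ → β.Val} {ν : σ → PMF γ.Val} {T S : ℕ} (ha : Runs f D a e (μ.map φ) T)
    (hb : ∀ s ∈ μ.support, Runs f D b (e, φ s) (ν s) S) :
    Runs f D (.bind a b) e (μ.bind ν) (1 + T + S) := by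
  obtain ⟨ha1, ha2⟩ := ha
  refine ⟨?_, ?_⟩
  · simp only [Alg.run, PMF.map_bind, PMF.map_comp]
    have : ((Alg.run f D a e).bind fun r => (Alg.run f D b (e, r.1)).map
        (Prod.fst ∘ fun q => (q.1, 1 + r.2 + q.2))) =
        ((Alg.run f D a e).map Prod.fst).bind fun v => (Alg.run f D b (e, v)).map Prod.fst := by
      rw [PMF.bind_map]
      rfl
    rw [this, ha1, PMF.bind_map]
    exact PMF.bind_congr_support fun s hs => (hb s hs).1
  · intro r hr
    simp only [Alg.run, PMF.mem_support_bind_iff, PMF.support_map, Set.mem_image] at hr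
    obtain ⟨q, hq, q', hq', rfl⟩ := hr
    have h1 : q.1 ∈ (μ.map φ).support := by
      rw [← ha1, PMF.support_map]
      exact ⟨q, hq, rfl⟩
    rw [PMF.support_map] at h1
    obtain ⟨s, hs, hs'⟩ := h1
    have h2 := (hb s hs).2 q' (by rw [hs']; exact hq')
    have h3 := ha2 q hq
    simp only
    omega

theorem Runs.comp_pure {α β γ : Ty} {a : Alg α β} {b : Alg β γ} {e : α.Val} {v : β.Val}
    {ν : PMF γ.Val} {T S : ℕ} (ha : Runs f D a e (PMF.pure v) T) (hb : Runs f D b v ν S) :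
    Runs f D (.comp b a) e ν (1 + T + S) := by
  have h := Runs.comp (μ := PMF.pure v) (φ := fun w => w) (ν := fun _ => ν)
    (by rw [PMF.pure_map]; exact ha)
    (fun s hs => by rw [PMF.support_pure, Set.mem_singleton_iff] at hs; subst hs; exact hb)
  rwa [PMF.pure_bind] at h

theorem Runs.bind_pure {α β γ : Ty} {a : Alg α β} {b : Alg (.prod α β) γ} {e : α.Val} {v : β.Val}
    {ν : PMF γ.Val} {T S : ℕ} (ha : Runs f D a e (PMF.pure v) T) (hb : Runs f D b (e, v) ν S) :
    Runs f D (.bind a b) e ν (1 + T + S) := by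
  have h := Runs.bind (μ := PMF.pure v) (φ := fun w => w) (ν := fun _ => ν)
    (by rw [PMF.pure_map]; exact ha)
    (fun s hs => by rw [PMF.support_pure, Set.mem_singleton_iff] at hs; subst hs; exact hb)
  rwa [PMF.pure_bind] at h

/-- The loop simulates a Markov chain on the encoded objects. The invariant holds on the support of
the chain and makes a common time bound `S` possible although the states grow. -/
theorem runs_loop {α γ : Ty} {σ : Type*} (k : Fn α .int) (init : Fn α γ)
    (body : Alg (.prod α γ) γ) (e : α.Val) (φ : σ → γ.Val) (ν : σ → PMF σ) (s₀ : σ)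
    (I : ℕ → σ → Prop) (K S T : ℕ) (hK : Int.toNat (k.eval e) = K) (h0 : init.eval e = φ s₀)
    (hI0 : I 0 s₀) (hT : k.time e + init.time e ≤ T)
    (step : ∀ j s, j < K → I j s → Runs f D body (e, φ s) ((ν s).map φ) S ∧
      ∀ s' ∈ (ν s).support, I (j + 1) s') :
    Runs f D (.loop k init body) e ((iterateBind ν s₀ K).map φ) (1 + T + K * (1 + S)) ∧
      ∀ s ∈ (iterateBind ν s₀ K).support, I K s := by
  set st : γ.Val → PMF (γ.Val × ℕ) := fun s => Alg.run f D body (e, s) with hst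
  set t₀ := 1 + k.time e + init.time e with ht₀
  have key : ∀ j ≤ K, (iterateStep st (φ s₀) t₀ j).map Prod.fst = (iterateBind ν s₀ j).map φ ∧
      (∀ r ∈ (iterateStep st (φ s₀) t₀ j).support, r.2 ≤ t₀ + j * (1 + S)) ∧
      ∀ s ∈ (iterateBind ν s₀ j).support, I j s := by
    intro j
    induction j with
    | zero =>
      intro _
      simp [iterateStep, iterateBind, PMF.pure_map, hI0]
    | succ j ih =>
      intro hj
      obtain ⟨h1, h2, h3⟩ := ih (by omega)
      refine ⟨?_, ?_, ?_⟩
      · simp only [iterateStep, iterateBind, PMF.map_bind, PMF.map_comp]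
        have : ((iterateStep st (φ s₀) t₀ j).bind fun r => (st r.1).map
            (Prod.fst ∘ fun q => (q.1, r.2 + 1 + q.2))) =
            ((iterateStep st (φ s₀) t₀ j).map Prod.fst).bind fun v => (st v).map Prod.fst := by
          rw [PMF.bind_map]
          rfl
        rw [this, h1, PMF.bind_map]
        exact PMF.bind_congr_support fun s hs => (step j s (by omega) (h3 s hs)).1.1
      · intro r hr
        simp only [iterateStep, PMF.mem_support_bind_iff, PMF.support_map, Set.mem_image] at hr
        obtain ⟨q, hq, q', hq', rfl⟩ := hr
        have h4 : q.1 ∈ ((iterateBind ν s₀ j).map φ).support := by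
          rw [← h1, PMF.support_map]
          exact ⟨q, hq, rfl⟩
        rw [PMF.support_map] at h4
        obtain ⟨s, hs, hs'⟩ := h4
        have h5 := (step j s (by omega) (h3 s hs)).1.2 q' (by rw [hs']; exact hq')
        have h6 := h2 q hq
        simp only
        linarith
      · intro s' hs'
        simp only [iterateBind, PMF.mem_support_bind_iff] at hs'
        obtain ⟨s, hs, hs'⟩ := hs'
        exact (step j s (by omega) (h3 s hs)).2 s' hs'
  obtain ⟨h1, h2, h3⟩ := key K le_rfl
  have hrun : Alg.run f D (.loop k init body) e = iterateStep st (φ s₀) t₀ K := by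
    simp only [Alg.run, hK, h0]
    rfl
  refine ⟨⟨by rw [hrun]; exact h1, fun r hr => ?_⟩, h3⟩
  rw [hrun] at hr
  have := h2 r hr
  omega

/-- For loops whose body makes queries but no random choices: the chain moves deterministically
through the step numbers. -/
theorem runs_loop_pure {α γ : Ty} (k : Fn α .int) (init : Fn α γ)
    (body : Alg (.prod α γ) γ) (e : α.Val) (g : ℕ → γ.Val) (K S T : ℕ)
    (hK : Int.toNat (k.eval e) = K) (h0 : init.eval e = g 0) (hT : k.time e + init.time e ≤ T)
    (step : ∀ j < K, Runs f D body (e, g j) (PMF.pure (g (j + 1))) S) :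
    Runs f D (.loop k init body) e (PMF.pure (g K)) (1 + T + K * (1 + S)) := by
  have h := (runs_loop (f := f) (D := D) k init body e g (fun j => PMF.pure (j + 1)) 0
    (fun j s => s = j) K S T hK h0 rfl hT (fun j s hj hs => by
      subst hs
      rw [PMF.pure_map]
      exact ⟨step s hj, fun s' hs' => by simpa using hs'⟩)).1
  have h2 : ∀ j, iterateBind (fun j => PMF.pure (j + 1)) 0 j = PMF.pure j := by
    intro j
    induction j with
    | zero => rfl
    | succ j ih => rw [iterateBind, ih, PMF.pure_bind]
  rwa [h2, PMF.pure_map] at h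

end Alg

/-! ## Uniformly random points -/

theorem PMF.uniformOfFintype_bind_map_equiv {α β γ : Type} [Fintype α] [Fintype β] [Fintype γ]
    [Nonempty α] [Nonempty β] [Nonempty γ] (e : α × β ≃ γ) :
    ((PMF.uniformOfFintype α).bind fun a => (PMF.uniformOfFintype β).map fun b => e (a, b)) =
      PMF.uniformOfFintype γ := by
  classical
  ext c
  rw [PMF.bind_apply, tsum_fintype]
  simp only [PMF.map_apply, tsum_fintype, PMF.uniformOfFintype_apply]
  rw [← Fintype.card_congr e, Fintype.card_prod]
  simp only [Finset.mul_sum, mul_ite, mul_zero]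
  rw [← Fintype.sum_prod_type' (f := fun a b => if c = e (a, b) then
    ((Fintype.card α : ℝ≥0∞))⁻¹ * ((Fintype.card β : ℝ≥0∞))⁻¹ else 0)]
  have : ∀ p : α × β, (c = e (p.1, p.2)) ↔ p = e.symm c := fun p => by
    rw [Equiv.eq_symm_apply]
    exact eq_comm
  simp only [this, Finset.sum_ite_eq', Finset.mem_univ, if_true]
  rw [Nat.cast_mul, ENNReal.mul_inv] <;> simp

/-- The sign that stands for a coin toss. -/
def signOf (b : Bool) : ℤˣ := if b then 1 else -1

theorem map_signOf_uniform :
    (PMF.uniformOfFintype Bool).map signOf = PMF.uniformOfFintype ℤˣ := by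
  ext c
  rw [PMF.map_apply, tsum_fintype]
  rcases Int.units_eq_one_or c with rfl | rfl <;> simp [signOf]

/-- A fair sign in front of a uniform point of dimension `n` is a uniform point of dimension `n +
1`, by `Fin.consEquiv`. -/
theorem iterateBind_cons_signOf (n : ℕ) :
    iterateBind (fun l : List ℤˣ => (PMF.uniformOfFintype Bool).map fun b => signOf b :: l) [] n =
      (PMF.uniformOfFintype (Cube n)).map List.ofFn := by
  induction n with
  | zero =>
    rw [iterateBind]
    ext l
    rw [PMF.map_apply, tsum_fintype]
    simp [PMF.pure_apply]
  | succ n ih =>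
    rw [iterateBind, ih, PMF.bind_map, ← PMF.uniformOfFintype_bind_map_equiv
      ((Equiv.prodComm (Cube n) ℤˣ).trans (Fin.consEquiv fun _ : Fin (n + 1) => ℤˣ)), PMF.map_bind,
      ← map_signOf_uniform]
    congr 1
    funext x
    simp only [Function.comp_apply, PMF.map_comp]
    congr 1
    funext b
    simp [Fin.consEquiv, List.ofFn_succ]

namespace Fn

/-- The integer that stands for a boolean. -/
def sign {α : Ty} (b : Fn α .bool) : Fn α .int := .ite b (.intConst 1) (.intConst (-1))

theorem eval_sign {α : Ty} (b : Fn α .bool) (e : α.Val) :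
    (sign b).eval e = ((signOf (b.eval e) : ℤˣ) : ℤ) := by
  rw [sign, eval_ite, signOf]
  split_ifs <;> rfl

theorem time_sign_le {α : Ty} (b : Fn α .bool) (e : α.Val) :
    (sign b).time e ≤ b.time e + 2 := by
  have h := time_ite_le b (.intConst 1) (.intConst (-1)) e
  simp only [time_intConst] at h
  rw [sign]
  omega

end Fn

/-- A uniformly random point. -/
def randomPoint : Alg .int .pt :=
  .loop .id .nil (.bind .flip (.det (.cons (.sign .snd) Fn.fst.right)))

section

variable {n : ℕ} {f : Cube n → ℤˣ} {D : PMF (Cube n)}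

theorem runs_randomPoint :
    Alg.Runs f D randomPoint (n : ℤ) ((PMF.uniformOfFintype (Cube n)).map encodePoint)
      (20 * (n + 1)) := by
  have h := (Alg.runs_loop (f := f) (D := D) (α := .int) (γ := .pt) .id .nil
    (.bind .flip (.det (.cons (.sign .snd) Fn.fst.right))) (n : ℤ)
    (List.map fun u : ℤˣ => (u : ℤ))
    (fun l => (PMF.uniformOfFintype Bool).map fun b => signOf b :: l) []
    (fun _ _ => True) n 12 2 rfl rfl trivial le_rfl (fun j s _ _ => by
      refine ⟨?_, fun _ _ => trivial⟩
      have h1 := Alg.Runs.bind (f := f) (D := D) (a := .flip)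
        (b := .det (.cons (.sign .snd) Fn.fst.right)) (e := ((n : ℤ), s.map fun u : ℤˣ => (u : ℤ)))
        (μ := PMF.uniformOfFintype Bool) (φ := fun b => b)
        (ν := fun b => PMF.pure ((signOf b : ℤ) :: s.map fun u : ℤˣ => (u : ℤ))) (T := 1) (S := 10)
        (by
          have := Alg.runs_flip (f := f) (D := D) (α := .prod .int .pt)
            ((n : ℤ), s.map fun u : ℤˣ => (u : ℤ))
          rwa [← PMF.map_id (PMF.uniformOfFintype Bool)] at this)
        (fun b _ => by
          refine Alg.runs_det _ _ ?_ ?_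
          · exact congrArg (· :: s.map fun u : ℤˣ => (u : ℤ)) (Fn.eval_sign (α :=
              .prod (.prod .int .pt) .bool) .snd (((n : ℤ), s.map fun u : ℤˣ => (u : ℤ)), b))
          · have := Fn.time_sign_le (α := .prod (.prod .int .pt) .bool) .snd
              (((n : ℤ), s.map fun u : ℤˣ => (u : ℤ)), b)
            simp only [Fn.time_snd, Fn.time_cons, Fn.time_right, Fn.time_fst] at this ⊢
            omega)
      rw [PMF.map_comp]
      exact h1)).1
  rw [iterateBind_cons_signOf, PMF.map_comp] at h
  have h2 : ((List.map fun u : ℤˣ => (u : ℤ)) ∘ List.ofFn : Cube n → List ℤ) = encodePoint := by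
    funext x
    simp [encodePoint, List.map_ofFn, Function.comp_def]
  rw [h2] at h
  exact h.mono (by omega)

end

/-! ## Pairwise independent labelled points -/

/-- Points of the cube together with a sign. -/
abbrev Labelled (n : ℕ) : Type := Cube n × ℤˣ

/-- The code of a labelled point. -/
def encodeLabelled {n : ℕ} (p : Labelled n) : List ℤ × ℤ := (encodePoint p.1, (p.2 : ℤ))

/-- A list of elements of a group, extended by its translate by `q`. -/
def double {G : Type*} [Mul G] (L : List G) (q : G) : List G :=
  L.foldl (fun acc p => p * q :: acc) L

theorem length_double {G : Type*} [Mul G] (L : List G) (q : G) :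
    (double L q).length = 2 * L.length := by
  have : ∀ (L acc : List G),
      (L.foldl (fun acc p => p * q :: acc) acc).length = L.length + acc.length := by
    intro L
    induction L with
    | nil => intro acc; simp
    | cons p L ih => intro acc; rw [List.foldl_cons, ih]; simp only [List.length_cons]; omega
  rw [double, this]
  omega

/-- The distribution of `2 ^ k` pairwise independent uniformly random labelled points. -/
noncomputable def pairwisePoints (n k : ℕ) : PMF (List (Labelled n)) :=
  (PMF.uniformOfFintype (Labelled n)).bind fun p =>
    iterateBind (fun L => (PMF.uniformOfFintype (Labelled n)).map (double L)) [p] k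

/-- A uniformly random labelled point. -/
def randomLabelled : Alg .int (.prod .pt .int) :=
  .bind randomPoint (.bind .flip (.det (.pair Fn.fst.right (.sign .snd))))

section

variable {n : ℕ} {f : Cube n → ℤˣ} {D : PMF (Cube n)}

theorem runs_randomLabelled :
    Alg.Runs f D randomLabelled (n : ℤ) ((PMF.uniformOfFintype (Labelled n)).map encodeLabelled)
      (40 * (n + 1)) := by
  have h := Alg.Runs.bind (f := f) (D := D) (b := .bind .flip (.det (.pair Fn.fst.right (.sign .snd))))
    (ν := fun x => (PMF.uniformOfFintype Bool).bind fun b => PMF.pure (encodePoint x, (signOf b : ℤ)))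
    (S := 12) (runs_randomPoint (f := f) (D := D) (n := n)) (fun x _ => by
      refine Alg.Runs.bind (T := 1) (S := 10) (φ := fun b => b) ?_ (fun b _ => ?_)
      · have := Alg.runs_flip (f := f) (D := D) (α := .prod .int .pt) ((n : ℤ), encodePoint x)
        rwa [← PMF.map_id (PMF.uniformOfFintype Bool)] at this
      · refine Alg.runs_det _ _ ?_ ?_
        · exact congrArg (Prod.mk (encodePoint x)) (Fn.eval_sign (α :=
              .prod (.prod .int .pt) .bool) .snd (((n : ℤ), encodePoint x), b))
        · have := Fn.time_sign_le (α := .prod (.prod .int .pt) .bool) .snd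
            (((n : ℤ), encodePoint x), b)
          simp only [Fn.time_snd, Fn.time_pair, Fn.time_right, Fn.time_fst] at this ⊢
          omega)
  have h2 : (PMF.uniformOfFintype (Labelled n)).map encodeLabelled =
      (PMF.uniformOfFintype (Cube n)).bind fun x => (PMF.uniformOfFintype Bool).bind fun b =>
        PMF.pure (encodePoint x, (signOf b : ℤ)) := by
    rw [← PMF.uniformOfFintype_bind_map_equiv (Equiv.refl (Cube n × ℤˣ)), PMF.map_bind]
    congr 1
    funext x
    rw [← map_signOf_uniform, PMF.map_comp, PMF.map_comp]
    rfl
  rw [h2]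
  exact h.mono (by omega)

end

/-! ### Translating lists of labelled points -/

namespace Fn

/-- The second integer multiplied by the first one, which is `-1` or `1`. -/
def signMul {α : Ty} (u v : Fn α .int) : Fn α .int :=
  .ite (.le u (.intConst 0)) (.sub (.intConst 0) v) v

theorem eval_signMul {α : Ty} (u v : Fn α .int) (e : α.Val) (b : ℤˣ) (hb : u.eval e = (b : ℤ)) :
    (signMul u v).eval e = (b : ℤ) * (v.eval e : ℤ) := by
  rw [signMul, eval_ite_of_iff (eval_le_iff _ _ _), hb]
  change (if (b : ℤ) ≤ 0 then 0 - (v.eval e : ℤ) else (v.eval e : ℤ)) = _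
  rcases Int.units_eq_one_or b with rfl | rfl <;> simp

theorem time_signMul_le {α : Ty} (u v : Fn α .int) (e : α.Val) :
    (signMul u v).time e ≤ 5 + u.time e + v.time e := by
  have h := time_ite_le (.le u (.intConst 0)) (.sub (.intConst 0) v) v e
  simp only [time_le, time_sub, time_intConst] at h
  rw [signMul]
  omega

/-- Input `((n, q), y)`: the product of the labelled points `y` and `q`. -/
def mulLabelled : Fn (.prod (.prod .int (.prod .pt .int)) (.prod .pt .int)) (.prod .pt .int) :=
  .pair
    (tabulate Fn.fst.left (signMul (at' Fn.fst.right.left .snd) (at' Fn.fst.left.right.left .snd)))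
    (signMul Fn.snd.right Fn.fst.right.right)

theorem eval_mulLabelled {n : ℕ} (p q : Labelled n) :
    mulLabelled.eval (((n : ℤ), encodeLabelled q), encodeLabelled p) = encodeLabelled (p * q) := by
  refine Prod.ext ?_ ?_
  · refine (eval_tabulate _ _ _ n rfl).trans ?_
    refine congrArg List.ofFn (funext fun j => ?_)
    refine (eval_signMul _ _ _ (p.1 j) ?_).trans ?_
    · exact (eval_at _ _ _).trans (getD_encodePoint p.1 j)
    · rw [eval_at]
      refine (congrArg (fun a : ℤ => (p.1 j : ℤ) * a) (getD_encodePoint q.1 j)).trans ?_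
      rw [Prod.fst_mul, Pi.mul_apply, Units.val_mul]
  · refine (eval_signMul _ _ _ p.2 rfl).trans ?_
    change (p.2 : ℤ) * (q.2 : ℤ) = ((p * q).2 : ℤ)
    rw [Prod.snd_mul, Units.val_mul]

theorem time_mulLabelled_le (n : ℕ)
    (p : (Ty.prod (.prod .int (.prod .pt .int)) (.prod .pt .int)).Val) (hn : p.1.1 = (n : ℤ)) :
    mulLabelled.time p ≤ 120 * (n + 1) ^ 2 := by
  have h := time_tabulate_le Fn.fst.left
    (signMul (at' Fn.fst.right.left .snd) (at' Fn.fst.left.right.left .snd)) p n hn (14 * n + 60)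
    (fun j hj => by
      have h1 := time_signMul_le (at' Fn.fst.right.left .snd)
        (at' Fn.fst.left.right.left .snd) (p, ((j : ℕ) : ℤ))
      have h2 := time_at_le Fn.fst.right.left .snd (p, ((j : ℕ) : ℤ))
      have h3 := time_at_le Fn.fst.left.right.left .snd (p, ((j : ℕ) : ℤ))
      simp only [time_left, time_right, time_fst, time_snd, eval, Int.toNat_natCast] at h1 h2 h3
      omega)
  have h1 := time_signMul_le Fn.snd.right Fn.fst.right.right p
  simp only [time_left, time_right, time_fst, time_snd] at h h1
  simp only [mulLabelled, time_pair]
  nlinarith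

/-- Input `((n, L), q)`: the list `L` of labelled points, extended by its translate by `q`. -/
def doubleList : Fn (.prod (.prod .int (.list (.prod .pt .int))) (.prod .pt .int))
    (.list (.prod .pt .int)) :=
  .foldl Fn.fst.right Fn.fst.right
    (.cons (.comp mulLabelled (.pair (.pair Fn.fst.left.left.left Fn.fst.left.right) .snd))
      Fn.fst.right)

theorem eval_doubleList {n : ℕ} (L : List (Labelled n)) (q : Labelled n) :
    doubleList.eval (((n : ℤ), L.map encodeLabelled), encodeLabelled q) =
      (double L q).map encodeLabelled := by
  have : ∀ (L acc : List (Labelled n)),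
      (L.map encodeLabelled).foldl
        (fun s y => mulLabelled.eval (((n : ℤ), encodeLabelled q), y) :: s)
        (acc.map encodeLabelled) =
      (L.foldl (fun acc p => p * q :: acc) acc).map encodeLabelled := by
    intro L
    induction L with
    | nil => intro acc; rfl
    | cons p L ih =>
      intro acc
      rw [List.map_cons, List.foldl_cons, List.foldl_cons, ← ih, eval_mulLabelled]
      rfl
  exact this L L

theorem time_doubleList_le (n : ℕ)
    (p : (Ty.prod (.prod .int (.list (.prod .pt .int))) (.prod .pt .int)).Val)
    (hn : p.1.1 = (n : ℤ)) :
    doubleList.time p ≤ (p.1.2.length + 1) * (160 * (n + 1) ^ 2) := by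
  have h := time_foldl_le Fn.fst.right Fn.fst.right
    (.cons (.comp mulLabelled (.pair (.pair Fn.fst.left.left.left Fn.fst.left.right) .snd))
      Fn.fst.right) p (120 * (n + 1) ^ 2 + 30) (fun s y _ => by
        have h1 := time_mulLabelled_le n ((p.1.1, p.2), y) hn
        simp only [time_cons, time_comp, time_pair, time_left, time_right, time_fst, time_snd]
        change 1 + (1 + _ + mulLabelled.time ((p.1.1, p.2), y)) + _ ≤ _
        omega)
  simp only [time_right, time_fst] at h
  rw [doubleList]
  refine h.trans ?_
  have h3 : 1 ≤ (n + 1) ^ 2 := Nat.one_le_pow _ _ (by omega)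
  change 1 + (1 + 2) + (1 + 2) + p.1.2.length * (1 + (120 * (n + 1) ^ 2 + 30)) ≤ _
  nlinarith

end Fn

/-- Input `((((n, k), p), L), q)`: the list `L`, extended by its translate by `q`. -/
def doublingFn : Fn (.prod (.prod (.prod (.prod .int .int) (.prod .pt .int))
    (.list (.prod .pt .int))) (.prod .pt .int)) (.list (.prod .pt .int)) :=
  .comp Fn.doubleList (.pair (.pair Fn.fst.left.left.left Fn.fst.right) .snd)

/-- Input `(((n, k), p), L)`: the list `L`, extended by a random translate. -/
def doublingStep : Alg (.prod (.prod (.prod .int .int) (.prod .pt .int)) (.list (.prod .pt .int)))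
    (.list (.prod .pt .int)) :=
  .bind (.comp randomLabelled (.det Fn.fst.left.left)) (.det doublingFn)

/-- Input `(n, k)`: a list of `2 ^ k` pairwise independent labelled points. -/
def samplePoints : Alg (.prod .int .int) (.list (.prod .pt .int)) :=
  .bind (.comp randomLabelled (.det .fst))
    (.loop Fn.fst.right (.cons .snd .nil) doublingStep)

section

variable {n : ℕ} {f : Cube n → ℤˣ} {D : PMF (Cube n)}

theorem runs_doublingStep (k : ℤ) (p : List ℤ × ℤ) (L : List (Labelled n)) (w : ℕ)
    (hL : L.length ≤ w) :
    Alg.Runs f D doublingStep ((((n : ℤ), k), p), L.map encodeLabelled)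
      ((PMF.uniformOfFintype (Labelled n)).map fun q => (double L q).map encodeLabelled)
      (40 * (n + 1) + 50 + (w + 1) * (160 * (n + 1) ^ 2)) := by
  have h0 : Alg.Runs f D (.comp randomLabelled
        (.det (Fn.fst.left.left : Fn (.prod (.prod (.prod .int .int) (.prod .pt .int))
          (.list (.prod .pt .int))) .int)))
      ((((n : ℤ), k), p), L.map encodeLabelled)
      ((PMF.uniformOfFintype (Labelled n)).map encodeLabelled) (1 + 5 + 40 * (n + 1)) :=
    Alg.Runs.comp_pure (Alg.runs_det _ _ rfl (by simp)) runs_randomLabelled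
  have h1 : ∀ q : Labelled n, Alg.Runs f D (.det doublingFn)
      (((((n : ℤ), k), p), L.map encodeLabelled), encodeLabelled q)
      (PMF.pure ((double L q).map encodeLabelled)) (20 + (w + 1) * (160 * (n + 1) ^ 2)) := by
    intro q
    refine Alg.runs_det _ _ ((Fn.eval_comp _ _ _).trans (Fn.eval_doubleList L q)) ?_
    have h2 := Fn.time_doubleList_le n (((n : ℤ), L.map encodeLabelled), encodeLabelled q) rfl
    have h4 : (L.length + 1) * (160 * (n + 1) ^ 2) ≤ (w + 1) * (160 * (n + 1) ^ 2) := by gcongr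
    simp only [List.length_map] at h2
    rw [Fn.time_comp]
    change 1 + 13 + Fn.doubleList.time
      (((n : ℤ), L.map encodeLabelled), encodeLabelled q) ≤ _
    omega
  have h2 := h0.bind (fun q _ => h1 q)
  exact h2.mono (by omega)

theorem runs_samplePoints (k : ℕ) :
    Alg.Runs f D samplePoints ((n : ℤ), (k : ℤ)) ((pairwisePoints n k).map
      (List.map encodeLabelled)) (1000 * 4 ^ k * (n + 1) ^ 2) ∧
    ∀ L ∈ (pairwisePoints n k).support, L.length = 2 ^ k := by
  have hk : k < 2 ^ k := Nat.lt_two_pow_self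
  have hloop : ∀ p : Labelled n, Alg.Runs f D
      (.loop Fn.fst.right (.cons .snd .nil) doublingStep)
      (((n : ℤ), (k : ℤ)), encodeLabelled p)
      ((iterateBind (fun L => (PMF.uniformOfFintype (Labelled n)).map (double L)) [p] k).map
        (List.map encodeLabelled))
      (1 + 6 + k * (1 + (40 * (n + 1) + 50 + (2 ^ k + 1) * (160 * (n + 1) ^ 2)))) ∧
      ∀ L ∈ (iterateBind (fun L => (PMF.uniformOfFintype (Labelled n)).map (double L))
        [p] k).support, L.length = 2 ^ k := by
    intro p
    refine Alg.runs_loop (γ := .list (.prod .pt .int)) _ _ _ _ (List.map encodeLabelled) _ [p]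
      (fun j L => L.length = 2 ^ j) k _ 6 ?_ ?_ rfl ?_ (fun j L hj hL => ⟨?_, ?_⟩)
    · rfl
    · rfl
    · simp
    · rw [PMF.map_comp]
      exact runs_doublingStep _ _ L _ (hL.trans_le (Nat.pow_le_pow_right two_pos hj.le))
    · intro L' hL'
      rw [PMF.support_map] at hL'
      obtain ⟨q, -, rfl⟩ := hL'
      rw [length_double, hL, pow_succ, mul_comm]
  refine ⟨?_, ?_⟩
  · rw [pairwisePoints, PMF.map_bind]
    have h0 : Alg.Runs f D (.comp randomLabelled (.det (.fst : Fn (.prod .int .int) .int)))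
        ((n : ℤ), (k : ℤ))
        ((PMF.uniformOfFintype (Labelled n)).map encodeLabelled) (1 + 1 + 40 * (n + 1)) :=
      Alg.Runs.comp_pure (Alg.runs_det _ _ rfl (by simp)) runs_randomLabelled
    refine (h0.bind (fun p _ => (hloop p).1)).mono ?_
    -- The loop makes `k` steps, each bounded by the cost of doubling a list of length `2 ^ k`; `k <
    -- 2 ^ k` turns this into `4 ^ k`.
    have h4 : 4 ^ k = 2 ^ k * 2 ^ k := by rw [← mul_pow]; norm_num
    rw [h4]
    have h5 : k * (1 + (40 * (n + 1) + 50 + (2 ^ k + 1) * (160 * (n + 1) ^ 2))) ≤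
      2 ^ k * (1 + (40 * (n + 1) + 50 + (2 ^ k + 1) * (160 * (n + 1) ^ 2))) := by gcongr
    have h6 : n + 1 ≤ (n + 1) ^ 2 := by nlinarith
    have h7 : 1 ≤ 2 ^ k := Nat.one_le_two_pow
    generalize 2 ^ k = w at *
    generalize (n + 1) ^ 2 = m at *
    nlinarith [Nat.mul_le_mul h7 h7, Nat.mul_le_mul h7 h6, Nat.mul_le_mul (Nat.mul_le_mul h7 h7) h6,
      Nat.mul_le_mul h7 (Nat.zero_le m)]
  · intro L hL
    rw [pairwisePoints, PMF.mem_support_bind_iff] at hL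
    obtain ⟨p, -, hL⟩ := hL
    exact (hloop p).2 L hL

end

/-! ## One round of the learning algorithm -/

/-- The difference of the target and the current prediction, scaled by `K`. -/
def residual {n : ℕ} (f : Cube n → ℤˣ) (K : ℕ) (h : List (ℤ × List ℤ)) (y : Cube n) : ℤ :=
  (K : ℤ) * f y - predict K h y

/-- The correlation of the signs of the labelled points in `L` with the residual at their translates
by `signAt i`, in the subcube spanned by `x` and `z`. -/
def vote {n : ℕ} (f : Cube n → ℤˣ) (K : ℕ) (h : List (ℤ × List ℤ)) (x z : Cube n)
    (L : List (Labelled n)) (i : Fin n) : ℤ :=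
  (L.map fun p => (p.2 : ℤ) * residual f K h (mix x z (p.1 * signAt i))).sum

/-- The term that consists of the variables with negative vote, with the signs opposite to `z'`. -/
def candidate {n : ℕ} (f : Cube n → ℤˣ) (K : ℕ) (h : List (ℤ × List ℤ)) (x z : Cube n)
    (L : List (Labelled n)) (z' : Cube n) : List ℤ :=
  List.ofFn fun i => if 0 ≤ vote f K h x z L i then 0 else 0 - (z' i : ℤ)

/-- The weight of a new term `t`, determined from the example `y`. -/
def newWeight {n : ℕ} (f : Cube n → ℤˣ) (K M : ℕ) (h : List (ℤ × List ℤ)) (t : List ℤ)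
    (y : Cube n) : ℤ :=
  if CodeHolds t y then residual f K h y / M else 0

/-- The type of the data `(((n, K), h), ((x, z), L))` that determine the votes. -/
abbrev Ty.ctx : Ty :=
  .prod (.prod (.prod .int .int) .hyp) (.prod (.prod .pt .pt) (.list (.prod .pt .int)))

/-- The data that determine the votes. -/
def encodeCtx {n : ℕ} (K : ℕ) (h : List (ℤ × List ℤ)) (x z : Cube n) (L : List (Labelled n)) :
    Ty.ctx.Val :=
  ((((n : ℤ), (K : ℤ)), h), ((encodePoint x, encodePoint z), L.map encodeLabelled))

/-- The type of the state of the computation of a vote. -/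
abbrev Ty.voteState : Ty := .prod (.prod .ctx .int) (.prod (.list (.prod .pt .int)) .int)

/-! ### Computing a vote -/

namespace Fn

/-- The first labelled point of a list. -/
def headLabelled : Fn (.list (.prod .pt .int)) (.prod .pt .int) := .head (.pair .nil (.intConst 0))

theorem time_headLabelled_le (l : (Ty.list (.prod .pt .int)).Val) : headLabelled.time l ≤ 8 := by
  have h := time_head_le (β := .prod .pt .int) (.pair .nil (.intConst 0)) l
  simp only [time_pair, time_nil, time_intConst] at h
  rw [headLabelled]
  omega

/-- The point at which the target is queried for the next summand of a vote. -/
def votePoint : Fn .voteState .pt :=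
  .comp mixedPoint (.pair (.pair Fn.fst.left.left.left.left Fn.fst.right)
    (.pair (Fn.comp headLabelled Fn.snd.left).left Fn.fst.left.right.left))

theorem eval_votePoint {n : ℕ} (K : ℕ) (h : List (ℤ × List ℤ)) (x z : Cube n)
    (L : List (Labelled n)) (i : Fin n) (p : Labelled n) (rest : List (Labelled n)) (s : ℤ) :
    votePoint.eval ((encodeCtx K h x z L, ((i : ℕ) : ℤ)),
      ((p :: rest).map encodeLabelled, s)) = encodePoint (mix x z (p.1 * signAt i)) :=
  (eval_comp _ _ _).trans (eval_mixedPoint i p.1 x z)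

theorem time_votePoint_le (n : ℕ) (p : Ty.voteState.Val) (hn : p.1.1.1.1.1 = (n : ℤ)) :
    votePoint.time p ≤ 60 + 200 * (n + 1) ^ 2 := by
  have h := time_mixedPoint_le n p.1.2
    (((Fn.comp headLabelled (Fn.snd.left : Fn .voteState _)).left.eval p), p.1.1.2.1)
  have h2 := time_headLabelled_le p.2.1
  simp only [votePoint, time_comp, time_pair, time_left, time_right, time_fst, time_snd]
  rw [← hn] at h
  change 1 + (1 + _ + (1 + (1 + _ + headLabelled.time p.2.1 + 2) + _)) +
    mixedPoint.time ((p.1.1.1.1.1, p.1.2),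
      (((Fn.comp headLabelled (Fn.snd.left : Fn .voteState _)).left.eval p), p.1.1.2.1)) ≤ _
  omega

/-- The update of the state after a query has been answered. -/
def voteUpdate : Fn (.prod .voteState .int) (.prod (.list (.prod .pt .int)) .int) :=
  .pair (.comp .tail Fn.fst.right.left)
    (.add Fn.fst.right.right
      (signMul (Fn.comp headLabelled Fn.fst.right.left).right
        (.comp margin (.pair (.pair Fn.fst.left.left.left (.comp votePoint .fst)) .snd))))

theorem eval_voteUpdate {n : ℕ} (f : Cube n → ℤˣ) (K : ℕ) (h : List (ℤ × List ℤ)) (x z : Cube n)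
    (L : List (Labelled n)) (i : Fin n) (p : Labelled n) (rest : List (Labelled n)) (s : ℤ) :
    voteUpdate.eval (((encodeCtx K h x z L, ((i : ℕ) : ℤ)),
      ((p :: rest).map encodeLabelled, s)), (f (mix x z (p.1 * signAt i)) : ℤ)) =
      (rest.map encodeLabelled,
        s + (p.2 : ℤ) * residual f K h (mix x z (p.1 * signAt i))) := by
  refine Prod.ext ?_ ?_
  · exact (eval_comp _ _ _).trans (eval_tail _)
  · refine congrArg (s + ·) ?_
    refine (eval_signMul _ _ _ p.2 rfl).trans ?_
    refine congrArg ((p.2 : ℤ) * ·) ?_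
    refine (eval_comp _ _ _).trans ?_
    rw [eval_pair, eval_pair, eval_comp votePoint]
    refine Eq.trans ?_ (eval_margin K h (mix x z (p.1 * signAt i)) _)
    rw [← eval_votePoint K h x z L i p rest s]
    rfl

theorem time_voteUpdate_le (n : ℕ) (p : (Ty.prod .voteState .int).Val)
    (hn : p.1.1.1.1.1.1 = (n : ℤ)) :
    voteUpdate.time p ≤ 200 + (p.1.1.1.1.2.length + 1) * (700 * (n + 1) ^ 2) := by
  have h1 := time_votePoint_le n p.1 hn
  have h2 := time_margin_le n ((p.1.1.1.1, votePoint.eval p.1), p.2) hn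
  have h3 := time_signMul_le (Fn.comp headLabelled Fn.fst.right.left).right
    (.comp margin (.pair (.pair Fn.fst.left.left.left (.comp votePoint .fst)) .snd)) p
  have h4 := time_headLabelled_le p.1.2.1
  have h5 := time_tail_le (β := .prod .pt .int) p.1.2.1
  have h6 : (Fn.comp headLabelled
      (Fn.fst.right.left : Fn (.prod .voteState .int) _)).time p =
      1 + 5 + headLabelled.time p.1.2.1 := rfl
  have h7 : (Fn.comp margin (.pair (.pair Fn.fst.left.left.left (.comp votePoint .fst)) .snd)).time
      p = 1 + (1 + (1 + 7 + (1 + 1 + votePoint.time p.1)) + 1) +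
        margin.time ((p.1.1.1.1, votePoint.eval p.1), p.2) := rfl
  have h8 : (Fn.comp tail (Fn.fst.right.left : Fn (.prod .voteState .int) _)).time p =
      1 + 5 + (tail (β := .prod .pt .int)).time p.1.2.1 := rfl
  rw [time_right, h6, h7] at h3
  simp only [voteUpdate, time_pair, time_add, time_right, time_fst, h8]
  have h9 : (p.1.1.1.1.2.length + 1) * (700 * (n + 1) ^ 2) =
    (p.1.1.1.1.2.length + 1) * (500 * (n + 1) ^ 2) + p.1.1.1.1.2.length * (200 * (n + 1) ^ 2) +
      200 * (n + 1) ^ 2 := by ring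
  rw [h9]
  change margin.time ((p.1.1.1.1, votePoint.eval p.1), p.2) ≤
    (p.1.1.1.1.2.length + 1) * (500 * (n + 1) ^ 2) at h2
  omega

end Fn

/-- The addition of a summand of a vote. -/
def voteStep : Alg .voteState (.prod (.list (.prod .pt .int)) .int) :=
  .bind (.query Fn.votePoint) (.det Fn.voteUpdate)

/-- Input `(c, i)`: the vote on the variable `i`. -/
def voteAlg : Alg (.prod .ctx .int) .int :=
  .comp (.det .snd)
    (.loop (.comp Fn.length Fn.fst.right.right) (.pair Fn.fst.right.right (.intConst 0)) voteStep)

section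

variable {n : ℕ} {f : Cube n → ℤˣ} {D : PMF (Cube n)}

theorem runs_voteStep (K : ℕ) (h : List (ℤ × List ℤ)) (x z : Cube n)
    (L : List (Labelled n)) (i : Fin n) (p : Labelled n) (rest : List (Labelled n)) (s : ℤ) :
    Alg.Runs f D voteStep ((encodeCtx K h x z L, ((i : ℕ) : ℤ)),
      ((p :: rest).map encodeLabelled, s))
      (PMF.pure (rest.map encodeLabelled,
        s + (p.2 : ℤ) * residual f K h (mix x z (p.1 * signAt i))))
      (300 + n + (h.length + 1) * (900 * (n + 1) ^ 2)) := by
  have h1 := Alg.runs_query (f := f) (D := D) Fn.votePoint _ _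
    (Fn.eval_votePoint K h x z L i p rest s) (Fn.time_votePoint_le n _ rfl)
  have h2 := Alg.runs_det (f := f) (D := D) Fn.voteUpdate _
    (Fn.eval_voteUpdate f K h x z L i p rest s) (Fn.time_voteUpdate_le n _ rfl)
  refine (h1.bind_pure h2).mono ?_
  have h9 : (h.length + 1) * (900 * (n + 1) ^ 2) =
    (h.length + 1) * (700 * (n + 1) ^ 2) + h.length * (200 * (n + 1) ^ 2) +
      200 * (n + 1) ^ 2 := by ring
  rw [h9]
  change 1 + (1 + n + (60 + 200 * (n + 1) ^ 2)) +
    (200 + (h.length + 1) * (700 * (n + 1) ^ 2)) ≤ _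
  omega

/-- After `j` steps the state consists of the labelled points not yet used and the sum over the
first `j` ones. Each summand costs one query and one evaluation of the current prediction. -/
theorem runs_voteAlg (K : ℕ) (h : List (ℤ × List ℤ)) (x z : Cube n)
    (L : List (Labelled n)) (i : Fin n) :
    Alg.Runs f D voteAlg (encodeCtx K h x z L, ((i : ℕ) : ℤ))
      (PMF.pure (vote f K h x z L i))
      ((L.length + 1) * ((h.length + 1) * (1500 * (n + 1) ^ 2))) := by
  set F : Labelled n → ℤ := fun p => (p.2 : ℤ) * residual f K h (mix x z (p.1 * signAt i)) with hF
  have h1 := Alg.runs_loop_pure (f := f) (D := D) (α := .prod .ctx .int)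
    (γ := .prod (.list (.prod .pt .int)) .int) (.comp Fn.length Fn.fst.right.right)
    (.pair Fn.fst.right.right (.intConst 0)) voteStep (encodeCtx K h x z L, ((i : ℕ) : ℤ))
    (fun j => (((L.drop j).map encodeLabelled : List (List ℤ × ℤ)), ((L.take j).map F).sum)) L.length
    (300 + n + (h.length + 1) * (900 * (n + 1) ^ 2)) (20 + L.length * 6)
    (by
      rw [Fn.eval_comp, Fn.eval_length]
      change Int.toNat ((L.map encodeLabelled).length : ℤ) = _
      simp)
    (by rfl)
    (by
      have h2 := Fn.time_length_le (β := .prod .pt .int) (L.map encodeLabelled)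
      simp only [List.length_map] at h2
      change 1 + 5 + (Fn.length (β := .prod .pt .int)).time (L.map encodeLabelled) + (1 + 5 + 1) ≤ _
      omega)
    (fun j hj => by
      have h3 : L.drop j = L[j] :: L.drop (j + 1) := List.drop_eq_getElem_cons hj
      have h4 : ((L.take (j + 1)).map F).sum = ((L.take j).map F).sum + F L[j] := by
        rw [List.take_succ_eq_append_getElem hj, List.map_append, List.sum_append]
        simp
      rw [h3, h4]
      exact runs_voteStep K h x z L i L[j] (L.drop (j + 1)) _)
  rw [List.take_length] at h1
  refine (h1.comp_pure (Alg.runs_det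
    (.snd : Fn (.prod (.list (.prod .pt .int)) .int) .int) _ (v := vote f K h x z L i) rfl le_rfl)).mono ?_
  change 1 + _ + 1 ≤ _
  have h5 : 1 ≤ (n + 1) ^ 2 := Nat.one_le_pow _ _ (by omega)
  have h6 : n + 1 ≤ (n + 1) ^ 2 := by nlinarith
  generalize (n + 1) ^ 2 = m at *
  generalize L.length = l at *
  generalize h.length = r at *
  have h7 : 0 ≤ r * m := Nat.zero_le _
  have h8 : 300 + n + (r + 1) * (900 * m) ≤ (r + 1) * (1210 * m) := by nlinarith
  have h9 : 1 ≤ (r + 1) * m := by nlinarith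
  nlinarith [Nat.mul_le_mul_left l h8, Nat.mul_le_mul_left l h9]

end

/-! ### Computing the new term -/

namespace Fn

/-- The update of the state `(j, t)` when the entries of the new term `t` from `j` on are known,
and the vote on the variable `j - 1`. -/
def candidateUpdate : Fn (.prod (.prod (.prod .ctx .pt) (.prod .int .pt)) .int) (.prod .int .pt) :=
  .pair (.sub Fn.fst.right.left (.intConst 1))
    (.cons (.ite (.le (.intConst 0) .snd) (.intConst 0)
      (.sub (.intConst 0) (at' Fn.fst.left.right (.sub Fn.fst.right.left (.intConst 1)))))
      Fn.fst.right.right)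

theorem eval_candidateUpdate (c : Ty.ctx.Val) (z' t : List ℤ) (j v : ℤ) :
    candidateUpdate.eval (((c, z'), (j, t)), v) =
      (j - 1, (if 0 ≤ v then 0 else 0 - z'.getD (Int.toNat (j - 1)) 1) :: t) := by
  refine Prod.ext rfl ?_
  refine congrArg (· :: t) ?_
  refine (eval_ite_of_iff (eval_le_iff _ _ _)).trans ?_
  change (if (0 : ℤ) ≤ v then (0 : ℤ) else 0 - (Fn.eval (at' _ _) _ : ℤ)) = _
  rw [eval_at]
  rfl

theorem time_candidateUpdate_le
    (p : (Ty.prod (.prod (.prod .ctx .pt) (.prod .int .pt)) .int).Val) (n : ℕ)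
    (hj : p.1.2.1 ≤ (n : ℤ)) : candidateUpdate.time p ≤ 7 * n + 100 := by
  have h1 := time_ite_le (.le (.intConst 0) .snd) (.intConst 0)
      (.sub (.intConst 0) (at' Fn.fst.left.right (.sub Fn.fst.right.left (.intConst 1)))) p
  have h2 := time_at_le Fn.fst.left.right (.sub Fn.fst.right.left (.intConst 1)) p
  have h3 : Int.toNat ((Fn.sub (Fn.fst.right.left :
      Fn (.prod (.prod (.prod .ctx .pt) (.prod .int .pt)) .int) _) (.intConst 1)).eval p) ≤ n := by
    exact Int.toNat_le.2 ((Int.sub_le_self _ zero_le_one).trans hj)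
  simp only [time_le, time_sub, time_intConst, time_left, time_right, time_fst, time_snd] at h1 h2
  simp only [candidateUpdate, time_pair, time_cons, time_sub, time_intConst, time_left, time_right,
    time_fst]
  omega

end Fn

/-- One more entry of the new term. -/
def candidateStep : Alg (.prod (.prod .ctx .pt) (.prod .int .pt)) (.prod .int .pt) :=
  .bind (.comp voteAlg (.det (.pair Fn.fst.left (.sub Fn.snd.left (.intConst 1)))))
    (.det Fn.candidateUpdate)

/-- Input `(c, z')`: the new term. -/
def candidateAlg : Alg (.prod .ctx .pt) .pt :=
  .comp (.det .snd)
    (.loop Fn.fst.left.left.left (.pair Fn.fst.left.left.left .nil) candidateStep)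

section

variable {n : ℕ} {f : Cube n → ℤˣ} {D : PMF (Cube n)}

theorem runs_candidateStep (K : ℕ) (h : List (ℤ × List ℤ)) (x z : Cube n)
    (L : List (Labelled n)) (z' : Cube n) (i : Fin n) (t : List ℤ) :
    Alg.Runs f D candidateStep ((encodeCtx K h x z L, encodePoint z'), (((i : ℕ) : ℤ) + 1, t))
      (PMF.pure (((i : ℕ) : ℤ), (if 0 ≤ vote f K h x z L i then 0 else 0 - (z' i : ℤ)) :: t))
      ((L.length + 1) * ((h.length + 1) * (1700 * (n + 1) ^ 2))) := by
  have h1 := Alg.runs_det (f := f) (D := D)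
    (.pair Fn.fst.left (.sub Fn.snd.left (.intConst 1)) :
      Fn (.prod (.prod .ctx .pt) (.prod .int .pt)) (.prod .ctx .int))
    ((encodeCtx K h x z L, encodePoint z'), (((i : ℕ) : ℤ) + 1, t))
    (v := (encodeCtx K h x z L, ((i : ℕ) : ℤ))) (T := 9)
    (Prod.ext rfl (by change ((i : ℕ) : ℤ) + 1 - 1 = _; ring)) (by rfl)
  have h2 := (h1.comp_pure (runs_voteAlg K h x z L i)).bind_pure (Alg.runs_det Fn.candidateUpdate _
    (Fn.eval_candidateUpdate _ _ _ _ _)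
    (Fn.time_candidateUpdate_le _ n (by change ((i : ℕ) : ℤ) + 1 ≤ n; have := i.2; omega)))
  rw [show ((i : ℕ) : ℤ) + 1 - 1 = ((i : ℕ) : ℤ) by ring, Int.toNat_natCast,
    getD_encodePoint] at h2
  refine h2.mono ?_
  have h5 : n + 1 ≤ (n + 1) ^ 2 := by nlinarith
  generalize (n + 1) ^ 2 = m at *
  generalize L.length = l at *
  generalize h.length = r at *
  have h6 : m ≤ (l + 1) * ((r + 1) * m) := by
    nlinarith [Nat.zero_le (r * m), Nat.zero_le (l * m), Nat.zero_le (l * (r * m))]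
  have h7 : (l + 1) * ((r + 1) * (1700 * m)) = (l + 1) * ((r + 1) * (1500 * m)) +
    200 * ((l + 1) * ((r + 1) * m)) := by ring
  rw [h7]
  omega

/-- The loop counts down as in `tabulate`, which itself cannot be used here because the entries
depend on queries. -/
theorem runs_candidateAlg (K : ℕ) (h : List (ℤ × List ℤ)) (x z : Cube n)
    (L : List (Labelled n)) (z' : Cube n) :
    Alg.Runs f D candidateAlg (encodeCtx K h x z L, encodePoint z')
      (PMF.pure (candidate f K h x z L z'))
      ((L.length + 1) * ((h.length + 1) * (1800 * (n + 1) ^ 3))) := by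
  have h1 := Alg.runs_loop_pure (f := f) (D := D) (α := .prod .ctx .pt) (γ := .prod .int .pt)
    Fn.fst.left.left.left
    (.pair Fn.fst.left.left.left .nil) candidateStep (encodeCtx K h x z L, encodePoint z')
    (fun j => ((n : ℤ) - (j : ℤ), (candidate f K h x z L z').drop (n - j))) n
    ((L.length + 1) * ((h.length + 1) * (1700 * (n + 1) ^ 2))) 20
    (by exact Int.toNat_natCast n)
    (by
      have : (candidate f K h x z L z').drop (n - 0) = [] := by
        rw [Nat.sub_zero, List.drop_eq_nil_iff, candidate, List.length_ofFn]
      rw [this]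
      refine Prod.ext ?_ rfl
      change (n : ℤ) = n - ((0 : ℕ) : ℤ)
      simp)
    (by simp)
    (fun j hj => by
      have hi : n - (j + 1) < n := by omega
      have h3 : (candidate f K h x z L z').drop (n - (j + 1)) =
          (if 0 ≤ vote f K h x z L ⟨n - (j + 1), hi⟩ then 0
            else 0 - (z' ⟨n - (j + 1), hi⟩ : ℤ)) :: (candidate f K h x z L z').drop (n - j) := by
        rw [List.drop_eq_getElem_cons (i := n - (j + 1)) (by simpa [candidate] using hi)]
        congr 1
        · simp [candidate]
        · congr 1
          omega
      have h4 := runs_candidateStep (f := f) (D := D) K h x z L z' ⟨n - (j + 1), hi⟩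
        ((candidate f K h x z L z').drop (n - j))
      rw [h3]
      rw [show ((n - (j + 1) : ℕ) : ℤ) = (n : ℤ) - ((j + 1 : ℕ) : ℤ) by omega,
        show (n : ℤ) - ((j + 1 : ℕ) : ℤ) + 1 = (n : ℤ) - (j : ℤ) by omega] at h4
      exact h4)
  rw [Nat.sub_self, List.drop_zero] at h1
  refine (h1.comp_pure (Alg.runs_det (.snd : Fn (.prod .int .pt) .pt) _
    (v := candidate f K h x z L z') rfl le_rfl)).mono ?_
  change 1 + _ + 1 ≤ _
  have h5 : 1 ≤ (n + 1) ^ 2 := Nat.one_le_pow _ _ (by omega)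
  have h6 : (n + 1) ^ 3 = (n + 1) * (n + 1) ^ 2 := by ring
  rw [h6]
  generalize (n + 1) ^ 2 = m at *
  generalize L.length = l at *
  generalize h.length = r at *
  have h7 : (l + 1) * ((r + 1) * (1800 * ((n + 1) * m))) =
    1800 * ((n + 1) * ((l + 1) * ((r + 1) * m))) := by ring
  have h8 : (l + 1) * ((r + 1) * (1700 * m)) = 1700 * ((l + 1) * ((r + 1) * m)) := by ring
  have h9 : 1 ≤ (l + 1) * ((r + 1) * m) :=
    Nat.mul_pos (Nat.succ_pos l) (Nat.mul_pos (Nat.succ_pos r) h5)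
  rw [h7, h8]
  generalize (l + 1) * ((r + 1) * m) = w at *
  nlinarith

end

/-- The type of the parameters `((n, K), (k, M))`. -/
abbrev Ty.params : Ty := .prod (.prod .int .int) (.prod .int .int)

/-- The type of examples. -/
abbrev Ty.ex : Ty := .prod .pt .int

/-- The parameters of the algorithm. -/
def encodeParams (n K k M : ℕ) : Ty.params.Val := (((n : ℤ), (K : ℤ)), ((k : ℤ), (M : ℤ)))

/-- An example, as it is returned by the oracle. -/
def encodeExample {n : ℕ} (f : Cube n → ℤˣ) (x : Cube n) : Ty.ex.Val :=
  (encodePoint x, ((f x : ℤˣ) : ℤ))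

/-- The list of weighted terms after one more term `t`, with a weight determined from the example
`y`. -/
def extend {n : ℕ} (f : Cube n → ℤˣ) (K M : ℕ) (h : List (ℤ × List ℤ)) (t : List ℤ)
    (y : Cube n) : List (ℤ × List ℤ) :=
  (newWeight f K M h t y, t) :: h

/-- The distribution of new terms. -/
noncomputable def candidateDist {n : ℕ} (f : Cube n → ℤˣ) (D : PMF (Cube n)) (K k : ℕ)
    (h : List (ℤ × List ℤ)) : PMF (List ℤ) :=
  D.bind fun x => D.bind fun z => (pairwisePoints n k).bind fun L =>
    D.map fun z' => candidate f K h x z L z'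

/-- The distribution of the result of a round. -/
noncomputable def roundDist {n : ℕ} (f : Cube n → ℤˣ) (D : PMF (Cube n)) (K k M : ℕ)
    (h : List (ℤ × List ℤ)) : PMF (List (ℤ × List ℤ)) :=
  (candidateDist f D K k h).bind fun t => D.map fun y => extend f K M h t y

/-! ### Adding a weighted term to the list -/

namespace Fn

@[simp] theorem time_div {α : Ty} (f g : Fn α .int) (e : α.Val) :
    (div f g).time e = arithTime (f.eval e) (g.eval e) + f.time e + g.time e := rfl

/-- Input `((((n, K), (k, M)), h), (t, y))`: whether the new term `t` holds at the example `y`. -/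
def extendHolds : Fn (.prod (.prod .params .hyp) (.prod .pt .ex)) .bool :=
  .comp codeHolds (.pair Fn.fst.left.left.left (.pair Fn.snd.left Fn.snd.right.left))

/-- Input `((((n, K), (k, M)), h), (t, y))`: the residual at the example `y`. -/
def extendMargin : Fn (.prod (.prod .params .hyp) (.prod .pt .ex)) .int :=
  .comp margin (.pair (.pair (.pair Fn.fst.left.left Fn.fst.right)
    Fn.snd.right.left) Fn.snd.right.right)

/-- Input `((((n, K), (k, M)), h), (t, y))`: the extended list of weighted terms. -/
def extendFn : Fn (.prod (.prod .params .hyp) (.prod .pt .ex)) .hyp :=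
  .cons (.pair (.ite extendHolds (.div extendMargin Fn.fst.left.right.right) (.intConst 0))
    Fn.snd.left) Fn.fst.right

theorem eval_extendHolds_iff {n : ℕ} (f : Cube n → ℤˣ) (K k M : ℕ) (h : List (ℤ × List ℤ))
    (t : List ℤ) (y : Cube n) :
    extendHolds.eval ((encodeParams n K k M, h), (t, encodeExample f y)) = true ↔
      CodeHolds t y := by
  rw [extendHolds, eval_comp]
  exact eval_codeHolds_iff t y

theorem eval_extendMargin {n : ℕ} (f : Cube n → ℤˣ) (K k M : ℕ) (h : List (ℤ × List ℤ))
    (t : List ℤ) (y : Cube n) :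
    extendMargin.eval ((encodeParams n K k M, h), (t, encodeExample f y)) = residual f K h y :=
  (eval_comp _ _ _).trans (eval_margin K h y (f y))

theorem eval_extendFn {n : ℕ} (f : Cube n → ℤˣ) (K k M : ℕ) (h : List (ℤ × List ℤ)) (t : List ℤ)
    (y : Cube n) :
    extendFn.eval ((encodeParams n K k M, h), (t, encodeExample f y)) = extend f K M h t y := by
  refine congrArg (· :: h) ?_
  refine Prod.ext ?_ rfl
  refine (eval_ite_of_iff (eval_extendHolds_iff f K k M h t y)).trans ?_
  rw [newWeight]
  refine if_congr Iff.rfl ?_ rfl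
  exact congrArg (fun a : ℤ => a / (M : ℤ)) (eval_extendMargin f K k M h t y)

theorem time_extendHolds_le {n : ℕ} (f : Cube n → ℤˣ) (K k M : ℕ) (h : List (ℤ × List ℤ))
    (t : List ℤ) (y : Cube n) :
    extendHolds.time ((encodeParams n K k M, h), (t, encodeExample f y)) ≤
      30 + 200 * (n + 1) ^ 2 := by
  have h2 := time_codeHolds_le n (t, encodePoint y)
  rw [extendHolds, time_comp]
  simp only [time_pair, time_left, time_right, time_fst, time_snd]
  change _ + codeHolds.time ((n : ℤ), (t, encodePoint y)) ≤ _
  omega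

theorem time_extendMargin_le {n : ℕ} (f : Cube n → ℤˣ) (K k M : ℕ) (h : List (ℤ × List ℤ))
    (t : List ℤ) (y : Cube n) :
    extendMargin.time ((encodeParams n K k M, h), (t, encodeExample f y)) ≤
      30 + (h.length + 1) * (500 * (n + 1) ^ 2) := by
  have h4 := time_margin_le n (((((n : ℤ), (K : ℤ)), h), encodePoint y), (f y : ℤ)) rfl
  rw [extendMargin, time_comp]
  simp only [time_pair, time_left, time_right, time_fst, time_snd]
  change _ + margin.time (((((n : ℤ), (K : ℤ)), h), encodePoint y), (f y : ℤ)) ≤ _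
  change _ ≤ (h.length + 1) * (500 * (n + 1) ^ 2) at h4
  omega

theorem time_extendFn_le {n : ℕ} (f : Cube n → ℤˣ) (K k M : ℕ) (h : List (ℤ × List ℤ))
    (t : List ℤ) (y : Cube n) :
    extendFn.time ((encodeParams n K k M, h), (t, encodeExample f y)) ≤
      200 + (residual f K h y).natAbs + M + (h.length + 1) * (700 * (n + 1) ^ 2) := by
  have h2 := time_extendHolds_le f K k M h t y
  have h4 := time_extendMargin_le f K k M h t y
  have h5 := eval_extendMargin f K k M h t y
  have h7 := arithTime_le (residual f K h y) M
  rw [Int.natAbs_natCast] at h7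
  have h8 : (Fn.div extendMargin Fn.fst.left.right.right).time
      ((encodeParams n K k M, h), (t, encodeExample f y)) =
      arithTime (residual f K h y) M +
        extendMargin.time ((encodeParams n K k M, h), (t, encodeExample f y)) + 7 := by
    rw [time_div, h5]
    rfl
  have h9 := time_ite_le extendHolds (.div extendMargin Fn.fst.left.right.right) (.intConst 0)
    ((encodeParams n K k M, h), (t, encodeExample f y))
  rw [h8, time_intConst] at h9
  have h12 : (h.length + 1) * (700 * (n + 1) ^ 2) =
    (h.length + 1) * (500 * (n + 1) ^ 2) + h.length * (200 * (n + 1) ^ 2) +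
      200 * (n + 1) ^ 2 := by ring
  rw [h12, extendFn]
  simp only [time_cons, time_pair, time_left, time_right, time_fst, time_snd]
  omega

/-- Input `((p, h), x)`: the parameters `(n, k)` in `p`. -/
def sampleArgs : Fn (.prod (.prod (.prod .params .hyp) .ex) .ex) (.prod .int .int) :=
  .pair Fn.fst.left.left.left.left Fn.fst.left.left.right.left

/-- The data from which the new term is computed, from the data collected so far. -/
def candidateArgs : Fn (.prod (.prod (.prod (.prod (.prod .params .hyp) .ex) .ex)
    (.list (.prod .pt .int))) .ex) (.prod .ctx .pt) :=
  .pair (.pair (.pair Fn.fst.left.left.left.left.left Fn.fst.left.left.left.right)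
    (.pair (.pair Fn.fst.left.left.right.left Fn.fst.left.right.left) Fn.fst.right)) Fn.snd.left

/-- The extended list of weighted terms, from the data collected so far. -/
def roundEnd : Fn (.prod (.prod (.prod (.prod (.prod (.prod (.prod .params .hyp) .ex) .ex)
    (.list (.prod .pt .int))) .ex) .pt) .ex) .hyp :=
  .comp extendFn (.pair Fn.fst.left.left.left.left.left (.pair Fn.fst.right .snd))

end Fn

/-- Input `(p, h)`: a new term is found and added to `h`. -/
def roundAlg : Alg (.prod .params .hyp) .hyp :=
  .bind .sample (.bind .sample (.bind (.comp samplePoints (.det Fn.sampleArgs))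
    (.bind .sample (.bind (.comp candidateAlg (.det Fn.candidateArgs))
      (.bind .sample (.det Fn.roundEnd))))))

/-- For a nonempty list the outermost operation is the truncation. -/
theorem abs_predict_le {n : ℕ} (K : ℕ) (h : List (ℤ × List ℤ)) (x : Cube n) :
    |predict K h x| ≤ K := by
  cases h with
  | nil => simp [predict]
  | cons p h => rw [predict, abs_le]; omega

theorem natAbs_residual_le {n : ℕ} (f : Cube n → ℤˣ) (K : ℕ) (h : List (ℤ × List ℤ)) (x : Cube n) :
    (residual f K h x).natAbs ≤ 2 * K := by
  have h1 := abs_predict_le K h x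
  rw [abs_le] at h1
  rw [residual]
  rcases Int.units_eq_one_or (f x) with hf | hf <;> rw [hf] <;> push_cast <;> omega

section

variable {n : ℕ} {f : Cube n → ℤˣ} {D : PMF (Cube n)}

/-- The four independent examples have different roles: `x` and `z` span the subcube in which `R` is
sought, `z'` provides the signs of the new term and `y` its weight. Only the label of `y` is used.
-/
theorem runs_roundAlg (K k M : ℕ) (h : List (ℤ × List ℤ)) :
    Alg.Runs f D roundAlg (encodeParams n K k M, h) (roundDist f D K k M h)
      ((h.length + 1) * (9000 * 4 ^ k * (n + 1) ^ 3) + 2 * K + M) := by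
  set T1 := 300 + 2 * K + M + (h.length + 1) * (700 * (n + 1) ^ 2) with hT1
  set T2 := (2 ^ k + 1) * ((h.length + 1) * (1800 * (n + 1) ^ 3)) with hT2
  set T3 := 1000 * 4 ^ k * (n + 1) ^ 2 with hT3
  have hex : ∀ {α : Ty} (e : α.Val), Alg.Runs f D (.sample : Alg α .ex) e
      (D.map (encodeExample f)) (1 + n) := fun e => Alg.runs_sample e
  have h6 : ∀ (x z : Cube n) (L : List (Labelled n)) (z' : Cube n) t y, Alg.Runs f D (.det Fn.roundEnd)
      (((((((encodeParams n K k M, h), encodeExample f x), encodeExample f z),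
        L.map encodeLabelled), encodeExample f z'), t), encodeExample f y)
      (PMF.pure (extend f K M h t y)) T1 := by
    intro x z L z' t y
    refine Alg.runs_det _ _ ((Fn.eval_comp _ _ _).trans (Fn.eval_extendFn f K k M h t y)) ?_
    have h1 := Fn.time_extendFn_le f K k M h t y
    have h2 := natAbs_residual_le f K h y
    rw [Fn.time_comp]
    change 1 + 17 + Fn.extendFn.time ((encodeParams n K k M, h), (t, encodeExample f y)) ≤ _
    omega
  have h5 : ∀ (x z : Cube n) (L : List (Labelled n)) (z' : Cube n) t, Alg.Runs f D (.bind .sample (.det Fn.roundEnd))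
      ((((((encodeParams n K k M, h), encodeExample f x), encodeExample f z),
        L.map encodeLabelled), encodeExample f z'), t)
      (D.bind fun y => PMF.pure (extend f K M h t y)) (1 + (1 + n) + T1) :=
    fun x z L z' t => (hex _).bind fun y _ => h6 x z L z' t y
  have h4 : ∀ (x z z' : Cube n), ∀ L ∈ (pairwisePoints n k).support,
      Alg.Runs f D (.bind (.comp candidateAlg (.det Fn.candidateArgs))
        (.bind .sample (.det Fn.roundEnd)))
      (((((encodeParams n K k M, h), encodeExample f x), encodeExample f z),
        L.map encodeLabelled), encodeExample f z')
      (D.bind fun y => PMF.pure (extend f K M h (candidate f K h x z L z') y))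
      (1 + (1 + 60 + T2) + (1 + (1 + n) + T1)) := by
    intro x z z' L hL
    have h7 := (runs_samplePoints (f := f) (D := D) k).2 L hL
    have h8 := runs_candidateAlg (f := f) (D := D) K h x z L z'
    rw [h7] at h8
    refine Alg.Runs.bind_pure (Alg.Runs.comp_pure (Alg.runs_det Fn.candidateArgs _ ?_ ?_) h8)
      (h5 x z L z' _)
    · rfl
    · simp [Fn.candidateArgs]
  have h3 : ∀ x z : Cube n, ∀ L ∈ (pairwisePoints n k).support,
      Alg.Runs f D (.bind .sample (.bind (.comp candidateAlg (.det Fn.candidateArgs))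
        (.bind .sample (.det Fn.roundEnd))))
      ((((encodeParams n K k M, h), encodeExample f x), encodeExample f z),
        L.map encodeLabelled)
      (D.bind fun z' => D.bind fun y => PMF.pure (extend f K M h (candidate f K h x z L z') y))
      (1 + (1 + n) + (1 + (1 + 60 + T2) + (1 + (1 + n) + T1))) :=
    fun x z L hL => (hex _).bind fun z' _ => h4 x z z' L hL
  have h2 : ∀ x z : Cube n,
      Alg.Runs f D (.bind (.comp samplePoints (.det Fn.sampleArgs))
        (.bind .sample (.bind (.comp candidateAlg (.det Fn.candidateArgs))
        (.bind .sample (.det Fn.roundEnd)))))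
      (((encodeParams n K k M, h), encodeExample f x), encodeExample f z)
      ((pairwisePoints n k).bind fun L => D.bind fun z' => D.bind fun y =>
        PMF.pure (extend f K M h (candidate f K h x z L z') y))
      (1 + (1 + 60 + T3) + (1 + (1 + n) + (1 + (1 + 60 + T2) + (1 + (1 + n) + T1)))) := by
    intro x z
    refine Alg.Runs.bind (Alg.Runs.comp_pure (Alg.runs_det Fn.sampleArgs _ ?_ ?_)
      (runs_samplePoints k).1) (h3 x z)
    · rfl
    · simp [Fn.sampleArgs]
  have h1 : ∀ x : Cube n, Alg.Runs f D (.bind .sample (.bind (.comp samplePoints (.det Fn.sampleArgs))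
        (.bind .sample (.bind (.comp candidateAlg (.det Fn.candidateArgs))
        (.bind .sample (.det Fn.roundEnd))))))
      ((encodeParams n K k M, h), encodeExample f x)
      (D.bind fun z => (pairwisePoints n k).bind fun L => D.bind fun z' => D.bind fun y =>
        PMF.pure (extend f K M h (candidate f K h x z L z') y))
      (1 + (1 + n) + (1 + (1 + 60 + T3) + (1 + (1 + n) + (1 + (1 + 60 + T2) +
        (1 + (1 + n) + T1))))) :=
    fun x => (hex _).bind fun z _ => h2 x z
  have h0 : Alg.Runs f D roundAlg (encodeParams n K k M, h)
      (D.bind fun x => D.bind fun z => (pairwisePoints n k).bind fun L => D.bind fun z' =>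
        D.bind fun y => PMF.pure (extend f K M h (candidate f K h x z L z') y))
      (1 + (1 + n) + (1 + (1 + n) + (1 + (1 + 60 + T3) + (1 + (1 + n) + (1 + (1 + 60 + T2) +
        (1 + (1 + n) + T1)))))) :=
    (hex _).bind fun x _ => h1 x
  have hd : roundDist f D K k M h =
      (D.bind fun x => D.bind fun z => (pairwisePoints n k).bind fun L => D.bind fun z' =>
        D.bind fun y => PMF.pure (extend f K M h (candidate f K h x z L z') y)) := by
    simp only [roundDist, candidateDist, PMF.bind_bind, PMF.bind_map]
    rfl
  rw [hd]
  refine h0.mono ?_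
  rw [hT1, hT2, hT3]
  have e1 : 4 ^ k = 2 ^ k * 2 ^ k := by rw [← mul_pow]; norm_num
  have e2 : 1 ≤ 2 ^ k := Nat.one_le_two_pow
  have e3 : 2 ^ k ≤ 4 ^ k := by rw [e1]; exact Nat.le_mul_of_pos_left _ e2
  have e4 : (n + 1) ^ 2 ≤ (n + 1) ^ 3 := Nat.pow_le_pow_right (by omega) (by omega)
  have e5 : n + 1 ≤ (n + 1) ^ 2 := by nlinarith
  set w := 4 ^ k
  set v := 2 ^ k
  set m := (n + 1) ^ 3
  set m2 := (n + 1) ^ 2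
  set r := h.length
  have f1 : m ≤ (r + 1) * (w * m) := by
    calc m = 1 * (1 * m) := by ring
      _ ≤ (r + 1) * (w * m) := by gcongr <;> omega
  have f2 : w * m ≤ (r + 1) * (w * m) := Nat.le_mul_of_pos_left _ (by omega)
  have f3 : w * m2 ≤ w * m := by gcongr
  have f4 : (v + 1) * ((r + 1) * (1800 * m)) ≤ 3600 * ((r + 1) * (w * m)) := by
    calc (v + 1) * ((r + 1) * (1800 * m)) ≤ (2 * w) * ((r + 1) * (1800 * m)) := by
          gcongr; omega
      _ = _ := by ring
  have f5 : (r + 1) * m2 ≤ (r + 1) * (w * m) := by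
    calc (r + 1) * m2 ≤ (r + 1) * (1 * m) := by gcongr; omega
      _ ≤ _ := by gcongr; omega
  have f6 : (r + 1) * (9000 * w * m) = 9000 * ((r + 1) * (w * m)) := by ring
  have f7 : (r + 1) * (700 * m2) = 700 * ((r + 1) * m2) := by ring
  have f8 : 1000 * w * m2 = 1000 * (w * m2) := by ring
  have f9 : 1 ≤ m := Nat.one_le_pow _ _ (by omega)
  rw [f6, f7, f8]
  omega

end

/-- The type of the input `(n, s, a)` of the learning algorithm. -/
abbrev Ty.input : Ty := .prod .int (.prod .int .int)

/-! ### Computing the parameters from the input -/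

namespace Fn

/-- The number `n + s + a + 8`. -/
def inputSize : Fn .input .int := .add (.add .fst (.add Fn.snd.left Fn.snd.right)) (.intConst 8)

/-- Passage from `(l, 2 ^ l)` to `(l + 1, 2 ^ (l + 1))` unless `2 ^ l` is large enough. -/
def levelStep : Fn (.prod .input (.prod .int .int)) (.prod .int .int) :=
  .ite (.le (.comp inputSize .fst) Fn.snd.right) .snd
    (.pair (.add Fn.snd.left (.intConst 1)) (.add Fn.snd.right Fn.snd.right))

/-- A pair `(l, 2 ^ l)` where `2 ^ l` is at least the size of the input. -/
def levels : Fn .input (.prod .int .int) :=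
  .loop inputSize (.pair (.intConst 0) (.intConst 1)) levelStep

theorem eval_inputSize (n s a : ℕ) :
    inputSize.eval ((n : ℤ), ((s : ℤ), (a : ℤ))) = ((n + s + a + 8 : ℕ) : ℤ) := by
  change ((n : ℤ) + ((s : ℤ) + a)) + 8 = _
  push_cast
  ring

/-- Up to the stopping point `l` is the number of steps, and as many steps as the size of the input
suffice because `m < 2 ^ m`. The last doubling started below the size, whence the upper bound. The
size is rounded to a power of two so that `2 ^ k` can be an exact power of it. -/
theorem eval_levels (n s a : ℕ) : ∃ l : ℕ,
    levels.eval ((n : ℤ), ((s : ℤ), (a : ℤ))) = ((l : ℤ), ((2 ^ l : ℕ) : ℤ)) ∧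
      n + s + a + 8 ≤ 2 ^ l ∧ 2 ^ l < 2 * (n + s + a + 8) := by
  have hm := eval_inputSize n s a
  have h := eval_loop_invariant inputSize (.pair (.intConst 0) (.intConst 1)) levelStep
    ((n : ℤ), ((s : ℤ), (a : ℤ)))
    (fun j v => ∃ l : ℕ, v = ((l : ℤ), ((2 ^ l : ℕ) : ℤ)) ∧
      (l = j ∨ n + s + a + 8 ≤ 2 ^ l) ∧ 2 ^ l < 2 * (n + s + a + 8))
    ⟨0, rfl, Or.inl rfl, by omega⟩ (by
      rintro j v - ⟨l, rfl, h1, h2⟩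
      have e1 : levelStep.eval (((n : ℤ), ((s : ℤ), (a : ℤ))), ((l : ℤ), ((2 ^ l : ℕ) : ℤ))) =
          if n + s + a + 8 ≤ 2 ^ l then ((l : ℤ), ((2 ^ l : ℕ) : ℤ)) else
            (((l + 1 : ℕ) : ℤ), ((2 ^ (l + 1) : ℕ) : ℤ)) := by
        rw [levelStep, eval_ite_of_iff (eval_le_iff _ _ _), eval_comp]
        refine if_congr ?_ rfl ?_
        · change inputSize.eval ((n : ℤ), ((s : ℤ), (a : ℤ))) ≤ ((2 ^ l : ℕ) : ℤ) ↔ _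
          rw [hm]
          exact Nat.cast_le
        · change ((l : ℤ) + 1, ((2 ^ l : ℕ) : ℤ) + ((2 ^ l : ℕ) : ℤ)) = _
          rw [pow_succ]
          push_cast
          rw [mul_two]
      rw [e1]
      split_ifs with h3
      · exact ⟨l, rfl, Or.inr h3, h2⟩
      · refine ⟨l + 1, rfl, Or.inl (by omega), ?_⟩
        rw [pow_succ]
        omega)
  rw [hm, Int.toNat_natCast] at h
  obtain ⟨l, h1, h2, h3⟩ := h
  refine ⟨l, h1, ?_, h3⟩
  rcases h2 with rfl | h2
  · exact Nat.lt_two_pow_self.le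
  · exact h2

theorem time_levels_le (n s a : ℕ) :
    levels.time ((n : ℤ), ((s : ℤ), (a : ℤ))) ≤ 100 * (n + s + a + 8) := by
  have h1 : ∀ v, inputSize.time v = 11 := fun v => rfl
  have h := time_loop_le_of_forall inputSize (.pair (.intConst 0) (.intConst 1)) levelStep
    ((n : ℤ), ((s : ℤ), (a : ℤ))) 50 (fun v => by
      have h2 := time_ite_le (.le (.comp inputSize .fst) Fn.snd.right) .snd
        (.pair (.add Fn.snd.left (.intConst 1)) (.add Fn.snd.right Fn.snd.right))
        (((n : ℤ), ((s : ℤ), (a : ℤ))), v)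
      simp only [time_le, time_comp, time_left, time_right, time_fst, time_snd, time_pair,
        time_add, time_intConst, h1] at h2
      rw [levelStep]
      omega)
  rw [eval_inputSize, Int.toNat_natCast, h1] at h
  simp only [time_pair, time_intConst] at h
  rw [levels]
  omega

/-- The parameters of the algorithm and the number of rounds, determined from the number
`Q = 2 ^ l`. -/
def powers (b : ℕ) : Fn (.prod .input (.prod .int .int)) (.prod .params .int) :=
  .pair (.pair (.pair Fn.fst.left (pow Fn.snd.right (10 * b + 18)))
    (.pair (.mul (.intConst ((2 * b + 3 : ℕ) : ℤ)) Fn.snd.left) (pow Fn.snd.right (5 * b + 9))))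
    (pow Fn.snd.right (10 * b + 17))

/-- For `q = 2 ^ l` the parameters are `K = q ^ (10b+18)`, `2 ^ k = q ^ (2b+3)`, `M = q ^ (5b+9)`
and `N = q ^ (10b+17)` rounds; in particular `K = M ^ 2`. The exponents are justified in
`half_le_isClose`. -/
theorem eval_powers (b n s a l q : ℕ) :
    (powers b).eval (((n : ℤ), ((s : ℤ), (a : ℤ))), ((l : ℤ), (q : ℤ))) =
      (encodeParams n (q ^ (10 * b + 18)) ((2 * b + 3) * l) (q ^ (5 * b + 9)),
        ((q ^ (10 * b + 17) : ℕ) : ℤ)) := by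
  have h : ∀ j, (pow (Fn.snd.right : Fn (.prod .input (.prod .int .int)) .int) j).eval
      (((n : ℤ), ((s : ℤ), (a : ℤ))), ((l : ℤ), (q : ℤ))) = ((q ^ j : ℕ) : ℤ) := fun j =>
    (eval_pow _ _ _).trans (Nat.cast_pow q j).symm
  refine Prod.ext (Prod.ext (Prod.ext rfl (h _)) (Prod.ext ?_ (h _))) (h _)
  exact (Nat.cast_mul (2 * b + 3) l).symm

theorem time_powers_le (b n s a l q : ℕ) (hq : 1 ≤ q) (hl : l ≤ q) :
    (powers b).time (((n : ℤ), ((s : ℤ), (a : ℤ))), ((l : ℤ), (q : ℤ))) ≤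
      1000 * (b + 1) * q ^ (10 * b + 18) := by
  have h : ∀ j ≤ 10 * b + 18,
      (pow (Fn.snd.right : Fn (.prod .input (.prod .int .int)) .int) j).time
      (((n : ℤ), ((s : ℤ), (a : ℤ))), ((l : ℤ), (q : ℤ))) ≤
        (b + 1) * (200 * q ^ (10 * b + 18)) := by
    intro j hj
    refine (time_pow_le _ j _ q hq rfl).trans ?_
    have h1 : (Fn.snd.right : Fn (.prod .input (.prod .int .int)) .int).time
      (((n : ℤ), ((s : ℤ), (a : ℤ))), ((l : ℤ), (q : ℤ))) = 3 := rfl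
    rw [h1]
    have h2 : q ^ j ≤ q ^ (10 * b + 18) := Nat.pow_le_pow_right hq hj
    have h3 : q ≤ q ^ (10 * b + 18) := Nat.le_self_pow (by omega) q
    have h4 : 1 ≤ q ^ (10 * b + 18) := Nat.one_le_pow _ _ hq
    have h5 : j * (1 + q ^ j + q + 3) ≤ (10 * b + 18) * (6 * q ^ (10 * b + 18)) := by
      gcongr; omega
    nlinarith
  have h1 := h (10 * b + 18) le_rfl
  have h2 := h (10 * b + 17) (by omega)
  have h3 := h (5 * b + 9) (by omega)
  have h4 := arithTime_le ((2 * b + 3 : ℕ) : ℤ) (l : ℤ)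
  rw [Int.natAbs_natCast, Int.natAbs_natCast] at h4
  have h11 : (Fn.mul (.intConst ((2 * b + 3 : ℕ) : ℤ)) Fn.snd.left :
      Fn (.prod .input (.prod .int .int)) .int).time
      (((n : ℤ), ((s : ℤ), (a : ℤ))), ((l : ℤ), (q : ℤ))) =
        arithTime ((2 * b + 3 : ℕ) : ℤ) (l : ℤ) + 1 + 3 := rfl
  rw [powers]
  iterate 4 rw [time_pair]
  rw [h11, time_left, time_fst]
  clear h11 h
  generalize (pow _ (10 * b + 18)).time _ = t1 at *
  generalize (pow _ (10 * b + 17)).time _ = t2 at *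
  generalize (pow _ (5 * b + 9)).time _ = t3 at *
  have h5 : q ≤ q ^ (10 * b + 18) := Nat.le_self_pow (by omega) q
  have h6 : (b + 1) * q ≤ (b + 1) * q ^ (10 * b + 18) := by gcongr
  have h7 : (b + 1) * 1 ≤ (b + 1) * q := by gcongr
  have h8 : 1 * q ≤ (b + 1) * q := by gcongr; omega
  have h9 : (b + 1) * (200 * q ^ (10 * b + 18)) = 200 * ((b + 1) * q ^ (10 * b + 18)) := by ring
  have h10 : 1000 * (b + 1) * q ^ (10 * b + 18) = 1000 * ((b + 1) * q ^ (10 * b + 18)) := by ring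
  rw [h9] at h1 h2 h3
  rw [h10]
  omega

/-- The parameters of the algorithm and the number of rounds. -/
def paramsFn (b : ℕ) : Fn .input (.prod .params .int) := .comp (powers b) (.pair .id levels)

theorem eval_paramsFn (b n s a : ℕ) : ∃ l : ℕ,
    (paramsFn b).eval ((n : ℤ), ((s : ℤ), (a : ℤ))) =
      (encodeParams n ((2 ^ l) ^ (10 * b + 18)) ((2 * b + 3) * l) ((2 ^ l) ^ (5 * b + 9)),
        (((2 ^ l) ^ (10 * b + 17) : ℕ) : ℤ)) ∧
      (paramsFn b).time ((n : ℤ), ((s : ℤ), (a : ℤ))) ≤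
        2000 * (b + 1) * (2 ^ l) ^ (10 * b + 18) ∧
      n + s + a + 8 ≤ 2 ^ l ∧ 2 ^ l < 2 * (n + s + a + 8) := by
  obtain ⟨l, h1, h2, h3⟩ := eval_levels n s a
  have hq : 1 ≤ 2 ^ l := Nat.one_le_two_pow
  have h4 := time_powers_le b n s a l (2 ^ l) hq Nat.lt_two_pow_self.le
  have h5 := time_levels_le n s a
  have h6 : (Fn.pair .id levels).eval ((n : ℤ), ((s : ℤ), (a : ℤ))) =
      (((n : ℤ), ((s : ℤ), (a : ℤ))), ((l : ℤ), ((2 ^ l : ℕ) : ℤ))) := Prod.ext rfl h1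
  refine ⟨l, ?_, ?_, h2, h3⟩
  · rw [paramsFn, eval_comp, h6]
    exact eval_powers b n s a l (2 ^ l)
  · rw [paramsFn, time_comp, h6, time_pair, time_id]
    have h7 : 2 ^ l ≤ (2 ^ l) ^ (10 * b + 18) := Nat.le_self_pow (by omega) _
    have h8 : 1 * (2 ^ l) ^ (10 * b + 18) ≤ (b + 1) * (2 ^ l) ^ (10 * b + 18) := by
      gcongr; omega
    generalize (2 ^ l) ^ (10 * b + 18) = w at *
    have h9 : 1000 * (b + 1) * w = 1000 * ((b + 1) * w) := by ring
    have h10 : 2000 * (b + 1) * w = 2000 * ((b + 1) * w) := by ring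
    rw [h9] at h4
    rw [h10]
    omega

/-- Input `(((n, K), h), x)`: the value at `x` of the hypothesis that `h` describes. -/
def evaluator : Fn (.prod (.prod (.prod .int .int) .hyp) .pt) .int :=
  sign (.le (.intConst 0) (.comp .snd predictTotal))

theorem eval_evaluator {n : ℕ} (K : ℕ) (h : List (ℤ × List ℤ)) (x : Cube n) :
    evaluator.eval ((((n : ℤ), (K : ℤ)), h), encodePoint x) =
      if 0 ≤ total (n := n) K h x then 1 else -1 := by
  have h1 : (predictTotal.eval ((((n : ℤ), (K : ℤ)), h), encodePoint x)).2 = total K h x :=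
    congrArg Prod.snd (eval_predictTotal K h x)
  refine (eval_ite_of_iff (eval_le_iff _ _ _)).trans ?_
  change (if (0 : ℤ) ≤ (predictTotal.eval ((((n : ℤ), (K : ℤ)), h), encodePoint x)).2
    then (1 : ℤ) else -1) = _
  rw [h1]

theorem time_evaluator_le {n : ℕ} (K : ℕ) (h : List (ℤ × List ℤ)) (x : Cube n) :
    evaluator.time ((((n : ℤ), (K : ℤ)), h), encodePoint x) ≤
      (h.length + 1) * (500 * (n + 1) ^ 2) := by
  have h1 := time_predictTotal_le n ((((n : ℤ), (K : ℤ)), h), encodePoint x) rfl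
  have h2 := time_sign_le (.le (.intConst 0) (.comp .snd predictTotal))
    ((((n : ℤ), (K : ℤ)), h), encodePoint x)
  rw [time_le, time_comp, time_intConst, time_snd] at h2
  have h3 : 1 ≤ (n + 1) ^ 2 := Nat.one_le_pow _ _ (by omega)
  change _ ≤ (h.length + 1) * (400 * (n + 1) ^ 2) at h1
  have h4 : (h.length + 1) * (400 * (n + 1) ^ 2) + 100 ≤
      (h.length + 1) * (500 * (n + 1) ^ 2) := by
    nlinarith
  rw [evaluator]
  omega

end Fn

/-- The rounds of the algorithm: the input consists of the parameters and the number of rounds. -/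
def roundsAlg : Alg (.prod .params .int) (.prod (.prod .int .int) .hyp) :=
  .bind (.loop .snd .nil (.comp roundAlg (.det (.pair Fn.fst.left .snd))))
    (.det (.pair Fn.fst.left.left .snd))

/-- The learning algorithm. -/
def learner (b : ℕ) : Alg .input (.prod (.prod .int .int) .hyp) :=
  .comp roundsAlg (.det (Fn.paramsFn b))

section

variable {n : ℕ} {f : Cube n → ℤˣ} {D : PMF (Cube n)}

theorem length_of_mem_support_roundDist {K k M : ℕ} {h h' : List (ℤ × List ℤ)}
    (hh : h' ∈ (roundDist f D K k M h).support) : h'.length = h.length + 1 := by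
  simp only [roundDist, PMF.mem_support_bind_iff, PMF.mem_support_map_iff] at hh
  obtain ⟨t, -, y, -, rfl⟩ := hh
  rfl

theorem runs_roundsAlg (K k M N : ℕ) :
    Alg.Runs f D roundsAlg (encodeParams n K k M, (N : ℤ))
      ((iterateBind (roundDist f D K k M) [] N).map fun h => ((((n : ℤ), (K : ℤ)), h) :
        (Ty.prod (.prod .int .int) .hyp).Val))
      (N * (20 + ((N + 1) * (9000 * 4 ^ k * (n + 1) ^ 3) + 2 * K + M)) + 20) ∧
    ∀ h ∈ (iterateBind (roundDist f D K k M) [] N).support, h.length = N := by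
  have h1 := Alg.runs_loop (f := f) (D := D) (α := .prod .params .int) (γ := .hyp) .snd .nil
    (.comp roundAlg (.det (.pair Fn.fst.left .snd))) (encodeParams n K k M, (N : ℤ))
    (fun h => h) (roundDist f D K k M) [] (fun j h => h.length = j) N
    (1 + 5 + ((N + 1) * (9000 * 4 ^ k * (n + 1) ^ 3) + 2 * K + M)) 2
    (Int.toNat_natCast N) rfl rfl le_rfl
    (fun j h hj hh => by
      refine ⟨?_, fun h' hh' => by rw [length_of_mem_support_roundDist hh', hh]⟩
      have h2 := Alg.Runs.comp_pure (Alg.runs_det (f := f) (D := D)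
        (.pair Fn.fst.left .snd : Fn (.prod (.prod .params .int) .hyp) (.prod .params .hyp))
        ((encodeParams n K k M, (N : ℤ)), h) (v := (encodeParams n K k M, h)) (T := 5) rfl le_rfl)
        (runs_roundAlg K k M h)
      rw [show (fun h : List (ℤ × List ℤ) => h) = _root_.id from rfl, PMF.map_id]
      refine h2.mono ?_
      have h3 : (h.length + 1) * (9000 * 4 ^ k * (n + 1) ^ 3) ≤
        (N + 1) * (9000 * 4 ^ k * (n + 1) ^ 3) := by gcongr; omega
      omega)
  refine ⟨?_, h1.2⟩
  have h2 := Alg.Runs.bind (f := f) (D := D) h1.1 (fun h _ => Alg.runs_det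
    (.pair Fn.fst.left.left .snd : Fn (.prod (.prod .params .int) .hyp)
      (.prod (.prod .int .int) .hyp))
    ((encodeParams n K k M, (N : ℤ)), h) (v := (((n : ℤ), (K : ℤ)), h)) (T := 7) rfl le_rfl)
  refine Alg.Runs.mono h2 ?_
  have h3 : ∀ T : ℕ, N * (1 + (1 + 5 + T)) ≤ N * (20 + T) := fun T =>
    Nat.mul_le_mul_left N (by omega)
  have h4 := h3 ((N + 1) * (9000 * 4 ^ k * (n + 1) ^ 3) + 2 * K + M)
  omega

/-- The dominant cost is `N ^ 2 * 4 ^ k * (n + 1) ^ 3`: there are `N` rounds, each evaluating lists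
of up to `N` terms. This accounts for the exponent `2(10b+17) + (4b+6) + 3 = 24b+43`. -/
theorem runs_learner (b n s a : ℕ) (f : Cube n → ℤˣ) (D : PMF (Cube n)) : ∃ l : ℕ,
    n + s + a + 8 ≤ 2 ^ l ∧ 2 ^ l < 2 * (n + s + a + 8) ∧
    Alg.Runs f D (learner b) ((n : ℤ), ((s : ℤ), (a : ℤ)))
      ((iterateBind (roundDist f D ((2 ^ l) ^ (10 * b + 18)) ((2 * b + 3) * l)
        ((2 ^ l) ^ (5 * b + 9))) [] ((2 ^ l) ^ (10 * b + 17))).map fun h =>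
          ((((n : ℤ), (((2 ^ l) ^ (10 * b + 18) : ℕ) : ℤ)), h) :
            (Ty.prod (.prod .int .int) .hyp).Val))
      (40000 * (b + 1) * (2 ^ l) ^ (24 * b + 43)) ∧
    ∀ h ∈ (iterateBind (roundDist f D ((2 ^ l) ^ (10 * b + 18)) ((2 * b + 3) * l)
        ((2 ^ l) ^ (5 * b + 9))) [] ((2 ^ l) ^ (10 * b + 17))).support,
      h.length = (2 ^ l) ^ (10 * b + 17) := by
  obtain ⟨l, h1, h2, h3, h4⟩ := Fn.eval_paramsFn b n s a
  obtain ⟨h5, h6⟩ := runs_roundsAlg (f := f) (D := D) ((2 ^ l) ^ (10 * b + 18))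
    ((2 * b + 3) * l) ((2 ^ l) ^ (5 * b + 9)) ((2 ^ l) ^ (10 * b + 17))
  refine ⟨l, h3, h4, ?_, h6⟩
  refine ((Alg.runs_det (Fn.paramsFn b) _ h1 h2).comp_pure h5).mono ?_
  have e1 : 4 ^ ((2 * b + 3) * l) = (2 ^ l) ^ (4 * b + 6) := by
    rw [← pow_mul, show (4 : ℕ) = 2 ^ 2 by norm_num, ← pow_mul]
    congr 1
    ring
  rw [e1]
  generalize 2 ^ l = q at *
  have hq : 1 ≤ q := by omega
  have hp : ∀ i j, i ≤ j → q ^ i ≤ q ^ j := fun i j h => Nat.pow_le_pow_right hq h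
  have f1 : (n + 1) ^ 3 ≤ q ^ 3 := Nat.pow_le_pow_left (by omega) 3
  have f2 := hp (10 * b + 18) (14 * b + 26) (by omega)
  have f3 := hp (5 * b + 9) (14 * b + 26) (by omega)
  have f4 := hp 0 (10 * b + 17) (by omega)
  have f5 := hp 0 (14 * b + 26) (by omega)
  rw [pow_zero] at f4 f5
  have f6 : (q ^ (10 * b + 17) + 1) * (9000 * q ^ (4 * b + 6) * (n + 1) ^ 3) ≤
      18000 * q ^ (14 * b + 26) := by
    calc _ ≤ (2 * q ^ (10 * b + 17)) * (9000 * q ^ (4 * b + 6) * q ^ 3) := by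
          gcongr; omega
      _ = _ := by ring
  have f7 : q ^ (10 * b + 17) * (20 + ((q ^ (10 * b + 17) + 1) *
      (9000 * q ^ (4 * b + 6) * (n + 1) ^ 3) + 2 * q ^ (10 * b + 18) + q ^ (5 * b + 9))) ≤
      18023 * q ^ (24 * b + 43) := by
    calc _ ≤ q ^ (10 * b + 17) * (18023 * q ^ (14 * b + 26)) := by gcongr; omega
      _ = _ := by ring
  have f8 := hp (10 * b + 18) (24 * b + 43) (by omega)
  have f9 := hp 0 (24 * b + 43) (by omega)
  rw [pow_zero] at f9
  have f10 : 2000 * (b + 1) * q ^ (10 * b + 18) ≤ 2000 * (b + 1) * q ^ (24 * b + 43) := by gcongr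
  generalize q ^ (24 * b + 43) = w at *
  have f11 : 1 * w ≤ (b + 1) * w := by gcongr; omega
  have f12 : 2000 * (b + 1) * w = 2000 * ((b + 1) * w) := by ring
  have f13 : 40000 * (b + 1) * w = 40000 * ((b + 1) * w) := by ring
  rw [f12] at f10
  rw [f13]
  omega

end

/-! ## Expectations -/

/-- The expectation of a function with values in `[0, ∞]`. -/
noncomputable def lmean {α : Type*} (p : PMF α) (g : α → ℝ≥0∞) : ℝ≥0∞ := ∑' a, p a * g a

/-- The expectation of a real function on a finite type. -/
noncomputable def mean {α : Type*} [Fintype α] (p : PMF α) (F : α → ℝ) : ℝ :=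
  ∑ a, (p a).toReal * F a

section lmean

variable {α β : Type*}

/-- The states of the algorithm are lists and form an infinite type; with values in `[0, ∞]` sums
are exchanged without summability conditions. -/
theorem lmean_bind (p : PMF α) (q : α → PMF β) (g : β → ℝ≥0∞) :
    lmean (p.bind q) g = lmean p fun a => lmean (q a) g := by
  simp only [lmean, PMF.bind_apply, ← ENNReal.tsum_mul_right, ← ENNReal.tsum_mul_left]
  rw [ENNReal.tsum_comm]
  simp only [mul_assoc]

theorem lmean_pure (a : α) (g : α → ℝ≥0∞) : lmean (PMF.pure a) g = g a := by
  rw [lmean, tsum_eq_single a]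
  · simp
  · intro b hb
    simp [PMF.pure_apply, hb]

theorem lmean_map (p : PMF α) (φ : α → β) (g : β → ℝ≥0∞) :
    lmean (p.map φ) g = lmean p fun a => g (φ a) := by
  rw [← PMF.bind_pure_comp, lmean_bind]
  simp only [Function.comp_apply, lmean_pure]

theorem lmean_const (p : PMF α) (c : ℝ≥0∞) : (lmean p fun _ => c) = c := by
  rw [lmean, ENNReal.tsum_mul_right, p.tsum_coe, one_mul]

theorem lmean_add (p : PMF α) (g g' : α → ℝ≥0∞) :
    (lmean p fun a => g a + g' a) = lmean p g + lmean p g' := by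
  simp only [lmean, mul_add, ENNReal.tsum_add]

theorem lmean_const_mul (p : PMF α) (c : ℝ≥0∞) (g : α → ℝ≥0∞) :
    (lmean p fun a => c * g a) = c * lmean p g := by
  simp only [lmean, mul_left_comm, ENNReal.tsum_mul_left]

theorem lmean_mul_const (p : PMF α) (g : α → ℝ≥0∞) (c : ℝ≥0∞) :
    (lmean p fun a => g a * c) = lmean p g * c := by
  simp only [mul_comm _ c, lmean_const_mul]

theorem lmean_mono_of_support {p : PMF α} {g g' : α → ℝ≥0∞} (h : ∀ a ∈ p.support, g a ≤ g' a) :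
    lmean p g ≤ lmean p g' := by
  refine ENNReal.tsum_le_tsum fun a => ?_
  by_cases ha : p a = 0
  · rw [ha, zero_mul, zero_mul]
  · exact mul_le_mul_right (h a ((PMF.mem_support_iff _ _).2 ha)) _

theorem lmean_mono {p : PMF α} {g g' : α → ℝ≥0∞} (h : ∀ a, g a ≤ g' a) :
    lmean p g ≤ lmean p g' :=
  lmean_mono_of_support fun a _ => h a

theorem toOuterMeasure_eq_lmean (p : PMF α) (s : Set α) :
    p.toOuterMeasure s = lmean p (s.indicator 1) := by
  rw [PMF.toOuterMeasure_apply, lmean]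
  refine tsum_congr fun a => ?_
  by_cases ha : a ∈ s <;> simp [ha]

/-- Markov's inequality. -/
theorem mul_toOuterMeasure_le_lmean (p : PMF α) (g : α → ℝ≥0∞) (c : ℝ≥0∞) (s : Set α)
    (hs : ∀ a ∈ s, c ≤ g a) : c * p.toOuterMeasure s ≤ lmean p g := by
  rw [toOuterMeasure_eq_lmean, ← lmean_const_mul]
  refine lmean_mono fun a => ?_
  by_cases ha : a ∈ s
  · simpa [ha] using hs a ha
  · simp [ha]

theorem toOuterMeasure_add_compl (p : PMF α) (s : Set α) :
    p.toOuterMeasure s + p.toOuterMeasure sᶜ = 1 := by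
  rw [toOuterMeasure_eq_lmean, toOuterMeasure_eq_lmean, ← lmean_add]
  rw [← lmean_const p 1]
  congr 1
  funext a
  by_cases ha : a ∈ s <;> simp [ha]

/-- Drift bounds add up along a Markov chain. -/
theorem lmean_iterateBind_le {ν : α → PMF α} {V : α → ℝ≥0∞} {δ : ℝ≥0∞}
    (h : ∀ s, lmean (ν s) V ≤ V s + δ) (s : α) (N : ℕ) :
    lmean (iterateBind ν s N) V ≤ V s + N * δ := by
  induction N with
  | zero => simp [iterateBind, lmean_pure]
  | succ N ih =>
    rw [iterateBind, lmean_bind]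
    refine (lmean_mono h).trans ?_
    rw [lmean_add, lmean_const]
    refine (add_le_add_left ih δ).trans (le_of_eq ?_)
    push_cast
    ring

end lmean

section mean

variable {α β : Type*} [Fintype α] [Fintype β]

theorem sum_toReal (p : PMF α) : ∑ a, (p a).toReal = 1 := by
  rw [← ENNReal.toReal_sum (fun a _ => p.apply_ne_top a), ← tsum_fintype (L := .unconditional α),
    p.tsum_coe, ENNReal.toReal_one]

theorem mean_const (p : PMF α) (c : ℝ) : (mean p fun _ => c) = c := by
  rw [mean, ← Finset.sum_mul, sum_toReal, one_mul]

theorem mean_add (p : PMF α) (F G : α → ℝ) : (mean p fun a => F a + G a) = mean p F + mean p G := by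
  simp only [mean, mul_add, Finset.sum_add_distrib]

theorem mean_sub (p : PMF α) (F G : α → ℝ) : (mean p fun a => F a - G a) = mean p F - mean p G := by
  simp only [mean, mul_sub, Finset.sum_sub_distrib]

theorem mean_const_mul (p : PMF α) (c : ℝ) (F : α → ℝ) :
    (mean p fun a => c * F a) = c * mean p F := by
  simp only [mean, mul_left_comm _ c, Finset.mul_sum]

theorem mean_mul_const (p : PMF α) (F : α → ℝ) (c : ℝ) :
    (mean p fun a => F a * c) = mean p F * c := by
  simp only [mul_comm _ c, mean_const_mul]

theorem mean_sum {ι : Type*} (s : Finset ι) (p : PMF α) (F : ι → α → ℝ) :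
    (mean p fun a => ∑ i ∈ s, F i a) = ∑ i ∈ s, mean p (F i) := by
  simp only [mean, Finset.mul_sum]
  exact Finset.sum_comm

theorem mean_list_sum {ι : Type*} (l : List ι) (p : PMF α) (F : ι → α → ℝ) :
    (mean p fun a => (l.map fun i => F i a).sum) = (l.map fun i => mean p (F i)).sum := by
  induction l with
  | nil => simpa using mean_const p 0
  | cons i l ih => simp only [List.map_cons, List.sum_cons, mean_add, ih]

theorem mean_mono (p : PMF α) {F G : α → ℝ} (h : ∀ a, F a ≤ G a) : mean p F ≤ mean p G :=
  Finset.sum_le_sum fun a _ => mul_le_mul_of_nonneg_left (h a) ENNReal.toReal_nonneg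

theorem mean_nonneg (p : PMF α) {F : α → ℝ} (h : ∀ a, 0 ≤ F a) : 0 ≤ mean p F :=
  Finset.sum_nonneg fun a _ => mul_nonneg ENNReal.toReal_nonneg (h a)

theorem abs_mean_le (p : PMF α) (F : α → ℝ) : |mean p F| ≤ mean p fun a => |F a| := by
  refine (Finset.abs_sum_le_sum_abs _ _).trans (le_of_eq (Finset.sum_congr rfl fun a _ => ?_))
  rw [abs_mul, abs_of_nonneg ENNReal.toReal_nonneg]

theorem mean_le_of_forall (p : PMF α) {F : α → ℝ} {c : ℝ} (h : ∀ a, F a ≤ c) : mean p F ≤ c := by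
  have := mean_mono p h
  rwa [mean_const] at this

theorem mean_comm (p : PMF α) (q : PMF β) (F : α → β → ℝ) :
    (mean p fun a => mean q fun b => F a b) = mean q fun b => mean p fun a => F a b := by
  simp only [mean, Finset.mul_sum]
  rw [Finset.sum_comm]
  simp only [mul_left_comm]

/-- The variance is nonnegative. -/
theorem sq_mean_le (p : PMF α) (F : α → ℝ) : mean p F ^ 2 ≤ mean p fun a => F a ^ 2 := by
  have h : 0 ≤ mean p fun a => (F a - mean p F) ^ 2 := mean_nonneg p fun a => sq_nonneg _
  have h2 : (mean p fun a => (F a - mean p F) ^ 2) =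
      (mean p fun a => F a ^ 2) - 2 * mean p F * mean p F + mean p F ^ 2 := by
    rw [← mean_const_mul, ← mean_const p (mean p F ^ 2), ← mean_sub, ← mean_add]
    congr 1
    funext a
    ring
  nlinarith

theorem lmean_ofReal (p : PMF α) {F : α → ℝ} (h : ∀ a, 0 ≤ F a) :
    (lmean p fun a => ENNReal.ofReal (F a)) = ENNReal.ofReal (mean p F) := by
  rw [lmean, tsum_fintype, mean, ENNReal.ofReal_sum_of_nonneg
    fun a _ => mul_nonneg ENNReal.toReal_nonneg (h a)]
  refine Finset.sum_congr rfl fun a _ => ?_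
  rw [ENNReal.ofReal_mul ENNReal.toReal_nonneg, ENNReal.ofReal_toReal (p.apply_ne_top a)]

theorem mean_uniform_equiv [Nonempty α] (e : α ≃ α) (F : α → ℝ) :
    (mean (PMF.uniformOfFintype α) fun a => F (e a)) = mean (PMF.uniformOfFintype α) F := by
  simp only [mean, PMF.uniformOfFintype_apply]
  exact e.sum_comp fun a => ((Fintype.card α : ℝ≥0∞)⁻¹).toReal * F a

theorem mean_uniform_mul_right [Nonempty α] [Group α] (q : α) (F : α → ℝ) :
    (mean (PMF.uniformOfFintype α) fun a => F (a * q)) = mean (PMF.uniformOfFintype α) F :=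
  mean_uniform_equiv (Equiv.mulRight q) F

theorem mean_uniform_mul_left [Nonempty α] [Group α] (q : α) (F : α → ℝ) :
    (mean (PMF.uniformOfFintype α) fun a => F (q * a)) = mean (PMF.uniformOfFintype α) F :=
  mean_uniform_equiv (Equiv.mulLeft q) F

end mean

/-! ## Pairwise independence -/

section doubling

theorem sum_map_double {G : Type*} [Mul G] (F : G → ℝ) (L : List G) (q : G) :
    ((double L q).map F).sum = (L.map F).sum + (L.map fun p => F (p * q)).sum := by
  have : ∀ (L acc : List G), ((L.foldl (fun acc p => p * q :: acc) acc).map F).sum =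
      (acc.map F).sum + (L.map fun p => F (p * q)).sum := by
    intro L
    induction L with
    | nil => intro acc; simp
    | cons p L ih =>
      intro acc
      rw [List.foldl_cons, ih, List.map_cons, List.map_cons, List.sum_cons, List.sum_cons]
      ring
  exact this L L

theorem map_double {G H : Type*} [Mul G] [Mul H] (φ : G → H) (L : List G) (q : G) (q' : H)
    (h : ∀ p, φ (p * q) = φ p * q') : (double L q).map φ = double (L.map φ) q' := by
  have : ∀ (L acc : List G), (L.foldl (fun acc p => p * q :: acc) acc).map φ =
      (L.map φ).foldl (fun acc p => p * q' :: acc) (acc.map φ) := by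
    intro L
    induction L with
    | nil => intro acc; rfl
    | cons p L ih =>
      intro acc
      rw [List.foldl_cons, ih, List.map_cons, List.map_cons, List.foldl_cons, h]
  exact this L L

variable {G : Type} [Fintype G] [Nonempty G] [Group G]

/-- The expectation of a function of a list after a random doubling. -/
noncomputable def meanDouble (g : List G → ℝ) (L : List G) : ℝ :=
  mean (PMF.uniformOfFintype G) fun q => g (double L q)

/-- The expectation of a function of a list that arises by `k` random doublings from a random
element. -/
noncomputable def doublingMean (k : ℕ) (g : List G → ℝ) : ℝ :=
  mean (PMF.uniformOfFintype G) fun p => meanDouble^[k] g [p]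

theorem meanDouble_iterate_mono {g g' : List G → ℝ} (k : ℕ) (L : List G)
    (h : ∀ L' : List G, L'.length = 2 ^ k * L.length → g L' ≤ g' L') :
    meanDouble^[k] g L ≤ meanDouble^[k] g' L := by
  induction k generalizing L with
  | zero => exact h L (by simp)
  | succ k ih =>
    rw [Function.iterate_succ_apply', Function.iterate_succ_apply']
    refine mean_mono _ fun q => ih _ fun L' hL' => h L' ?_
    rw [hL', length_double, pow_succ]
    ring

theorem meanDouble_iterate_mean {α : Type*} [Fintype α] (p : PMF α) (g : α → List G → ℝ) (k : ℕ)
    (L : List G) : meanDouble^[k] (fun L => mean p fun a => g a L) L =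
      mean p fun a => meanDouble^[k] (g a) L := by
  induction k generalizing L with
  | zero => rfl
  | succ k ih =>
    simp only [Function.iterate_succ_apply', meanDouble, ih]
    exact mean_comm _ _ _

theorem meanDouble_iterate_add (g g' : List G → ℝ) (k : ℕ) (L : List G) :
    meanDouble^[k] (fun L => g L + g' L) L = meanDouble^[k] g L + meanDouble^[k] g' L := by
  induction k generalizing L with
  | zero => rfl
  | succ k ih => simp only [Function.iterate_succ_apply', meanDouble, ih, mean_add]

theorem meanDouble_iterate_one_sub_sum {ι : Type*} (s : Finset ι) (g : ι → List G → ℝ) (c : ℝ)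
    (k : ℕ) (L : List G) : meanDouble^[k] (fun L => 1 - ∑ i ∈ s, g i L * c) L =
      1 - ∑ i ∈ s, meanDouble^[k] (g i) L * c := by
  induction k generalizing L with
  | zero => rfl
  | succ k ih =>
    simp only [Function.iterate_succ_apply', meanDouble, ih, mean_sub, mean_sum, mean_const,
      mean_mul_const]

theorem doublingMean_mono {g g' : List G → ℝ} (k : ℕ)
    (h : ∀ L : List G, L.length = 2 ^ k → g L ≤ g' L) : doublingMean k g ≤ doublingMean k g' :=
  mean_mono _ fun p => meanDouble_iterate_mono k [p] fun L' hL' => h L' (by simpa using hL')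

theorem doublingMean_one_sub_sum {ι : Type*} (s : Finset ι) (g : ι → List G → ℝ) (c : ℝ)
    (k : ℕ) : doublingMean k (fun L => 1 - ∑ i ∈ s, g i L * c) =
      1 - ∑ i ∈ s, doublingMean k (g i) * c := by
  simp only [doublingMean, meanDouble_iterate_one_sub_sum, mean_sub, mean_sum, mean_const,
    mean_mul_const]

theorem mean_shift_eq_zero {F : G → ℝ} (hF : mean (PMF.uniformOfFintype G) F = 0) (p : G) :
    (mean (PMF.uniformOfFintype G) fun q => F (p * q)) = 0 := by
  rw [mean_uniform_mul_left p F, hF]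

/-- The second moment of a sum over pairwise independent elements. -/
theorem doublingMean_sq (k : ℕ) (F : G → ℝ) (hF : mean (PMF.uniformOfFintype G) F = 0) :
    doublingMean k (fun L => (L.map F).sum ^ 2) =
      2 ^ k * mean (PMF.uniformOfFintype G) fun p => F p ^ 2 := by
  induction k generalizing F with
  | zero => simp [doublingMean]
  | succ k ih =>
    -- The last doubling is averaged first. The cross term vanishes because, for fixed `p`, the
    -- translate `p * q` is uniform and `F` has mean zero.
    have h1 : meanDouble (fun L => (L.map F).sum ^ 2) = fun L : List G => (L.map F).sum ^ 2 +
        mean (PMF.uniformOfFintype G) fun q => (L.map fun p => F (p * q)).sum ^ 2 := by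
      funext L
      have h2 : (mean (PMF.uniformOfFintype G) fun q => (L.map fun p => F (p * q)).sum) = 0 := by
        rw [mean_list_sum]
        simp only [mean_shift_eq_zero hF]
        simp
      have h3 : ∀ q, ((double L q).map F).sum ^ 2 = (L.map F).sum ^ 2 +
          2 * (L.map F).sum * (L.map fun p => F (p * q)).sum +
            (L.map fun p => F (p * q)).sum ^ 2 := by
        intro q
        rw [sum_map_double]
        ring
      simp only [meanDouble, h3, mean_add, mean_const, mean_const_mul, h2, mul_zero, add_zero]
    -- The translate of `F` by `q` has again mean zero and the same second moment; this is why the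
    -- induction is over all `F`.
    have h4 : ∀ q, doublingMean k (fun L => (L.map fun p => F (p * q)).sum ^ 2) =
        2 ^ k * mean (PMF.uniformOfFintype G) fun p => F p ^ 2 := by
      intro q
      rw [ih (fun p => F (p * q)) (by rw [mean_uniform_mul_right q F, hF]),
        mean_uniform_mul_right q fun p => F p ^ 2]
    have h5 : doublingMean (k + 1) (fun L => (L.map F).sum ^ 2) =
        doublingMean k (fun L => (L.map F).sum ^ 2) +
          mean (PMF.uniformOfFintype G) fun q =>
            doublingMean k (fun L => (L.map fun p => F (p * q)).sum ^ 2) := by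
      simp only [doublingMean, Function.iterate_succ_apply, h1, meanDouble_iterate_add,
        meanDouble_iterate_mean, mean_add]
      rw [mean_comm]
    rw [h5, ih F hF]
    simp only [h4, mean_const]
    ring

end doubling

theorem meanDouble_iterate_nonneg {G : Type} [Fintype G] [Nonempty G] [Group G] {g : List G → ℝ}
    (hg : ∀ L, 0 ≤ g L) (k : ℕ) (L : List G) : 0 ≤ meanDouble^[k] g L := by
  induction k generalizing L with
  | zero => exact hg L
  | succ k ih =>
    rw [Function.iterate_succ_apply']
    exact mean_nonneg _ fun q => ih _

/-- Passage from the law on lists to iterated averages over the finite group, where the second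
moment was computed. -/
theorem lmean_pairwisePoints (n k : ℕ) (g : List (Labelled n) → ℝ) (hg : ∀ L, 0 ≤ g L) :
    (lmean (pairwisePoints n k) fun L => ENNReal.ofReal (g L)) =
      ENNReal.ofReal (doublingMean k g) := by
  have key : ∀ (k : ℕ) (g : List (Labelled n) → ℝ), (∀ L, 0 ≤ g L) → ∀ L,
      (lmean (iterateBind (fun L => (PMF.uniformOfFintype (Labelled n)).map (double L)) L k)
        fun L => ENNReal.ofReal (g L)) = ENNReal.ofReal (meanDouble^[k] g L) := by
    intro k
    induction k with
    | zero => intro g _ L; rw [iterateBind, lmean_pure]; rfl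
    | succ k ih =>
      intro g hg L
      rw [iterateBind, lmean_bind, Function.iterate_succ_apply,
        ← ih (meanDouble g) (fun L => mean_nonneg _ fun q => hg _)]
      congr 1
      funext L
      rw [lmean_map, lmean_ofReal _ fun q => hg _]
      rfl
  rw [pairwisePoints, lmean_bind]
  simp only [key k g hg]
  exact lmean_ofReal _ fun p => meanDouble_iterate_nonneg hg k _

/-- A random sign equals the prescribed one with probability one half, and the other sign
contributes nonnegatively. -/
theorem half_mul_mean_le {α : Type} [Fintype α] [Nonempty α] (F : α × ℤˣ → ℝ) (hF : ∀ p, 0 ≤ F p)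
    (s : α → ℤˣ) : 1 / 2 * (mean (PMF.uniformOfFintype α) fun a => F (a, s a)) ≤
      mean (PMF.uniformOfFintype (α × ℤˣ)) F := by
  simp only [mean, PMF.uniformOfFintype_apply, Fintype.card_prod, Fintype.card_units_int]
  rw [Fintype.sum_prod_type, Finset.mul_sum]
  refine Finset.sum_le_sum fun a _ => ?_
  rw [← Finset.mul_sum]
  have h1 : F (a, s a) ≤ ∑ b, F (a, b) :=
    Finset.single_le_sum (f := fun b => F (a, b)) (fun b _ => hF _) (Finset.mem_univ (s a))
  rw [ENNReal.toReal_inv, ENNReal.toReal_inv]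
  simp only [Nat.cast_mul, Nat.cast_ofNat, ENNReal.toReal_mul, ENNReal.toReal_natCast,
    ENNReal.toReal_ofNat]
  rw [mul_inv, ← mul_assoc, mul_comm (1 / 2 : ℝ), one_div]
  gcongr

/-! ### Finding a large Walsh coefficient with guessed labels -/

section GoldreichLevin

variable {n : ℕ}

/-- The labelling of points by a multiple of a character. -/
def decorate (χ : Cube n →* ℤˣ) (σ : ℤˣ) (v : Cube n) : Labelled n := (v, σ * χ v)

/-- Labels given by a multiple of a character are preserved by translation with `(q, χ q)`. So the
labels of all `2 ^ k` points are right as soon as the `k + 1` tossed ones are; the factor `σ` enters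
only through the first point. -/
theorem decorate_mul (χ : Cube n →* ℤˣ) (σ : ℤˣ) (v q : Cube n) :
    decorate χ σ (v * q) = decorate χ σ v * (q, χ q) := by
  simp [decorate, mul_assoc]

/-- In each doubling the random label of `q` is `χ q` with probability one half.
`doublingMean_decorate_le` adds the factor for the initial point. -/
theorem meanDouble_iterate_decorate_le (χ : Cube n →* ℤˣ) (σ : ℤˣ) (Ψ : List (Labelled n) → ℝ)
    (hΨ : ∀ L, 0 ≤ Ψ L) (k : ℕ) (L : List (Cube n)) :
    (1 / 2) ^ k * meanDouble^[k] (fun L => Ψ (L.map (decorate χ σ))) L ≤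
      meanDouble^[k] Ψ (L.map (decorate χ σ)) := by
  induction k generalizing L with
  | zero => simp
  | succ k ih =>
    rw [Function.iterate_succ_apply', Function.iterate_succ_apply']
    refine le_trans ?_ (half_mul_mean_le _ (fun q => meanDouble_iterate_nonneg hΨ k _) χ)
    rw [pow_succ', mul_assoc, meanDouble, ← mean_const_mul]
    refine mul_le_mul_of_nonneg_left (mean_mono _ fun q => ?_) (by norm_num)
    have h := ih (double L q)
    rwa [map_double _ L q _ fun p => decorate_mul χ σ p q] at h

theorem doublingMean_decorate_le (χ : Cube n →* ℤˣ) (σ : ℤˣ) (Ψ : List (Labelled n) → ℝ)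
    (hΨ : ∀ L, 0 ≤ Ψ L) (k : ℕ) :
    (1 / 2) ^ (k + 1) * doublingMean k (fun L => Ψ (L.map (decorate χ σ))) ≤
      doublingMean k Ψ := by
  refine le_trans ?_ (half_mul_mean_le _ (fun q => meanDouble_iterate_nonneg hΨ k _)
    fun v => σ * χ v)
  rw [pow_succ', mul_assoc, doublingMean, ← mean_const_mul]
  exact mul_le_mul_of_nonneg_left (mean_mono _ fun p =>
    meanDouble_iterate_decorate_le χ σ Ψ hΨ k [p]) (by norm_num)

/-- The character of the cube that belongs to a set of variables. -/
def walsh (R : Finset (Fin n)) : Cube n →* ℤˣ where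
  toFun v := ∏ i ∈ R, v i
  map_one' := by simp
  map_mul' v w := by simp [Finset.prod_mul_distrib]

theorem walsh_signAt (R : Finset (Fin n)) (i : Fin n) :
    walsh R (signAt i) = if i ∈ R then -1 else 1 := by
  simp [walsh, signAt, Pi.mulSingle_apply]

theorem signAt_mul_self (i : Fin n) : signAt i * signAt i = 1 := by
  rw [signAt, ← Pi.mulSingle_mul]
  simp

/-- The coefficient of a function on the cube at the character that belongs to `R`. -/
noncomputable def coefficient (g : Cube n → ℝ) (R : Finset (Fin n)) : ℝ :=
  mean (PMF.uniformOfFintype (Cube n)) fun v => g v * ((walsh R v : ℤˣ) : ℤ)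

theorem abs_units_cast (u : ℤˣ) : |((u : ℤ) : ℝ)| = 1 := by
  rcases Int.units_eq_one_or u with rfl | rfl <;> simp

/-- The labelled points in `L` vote correctly for membership of each variable in `R`. -/
def VotesFor (g : Cube n → ℝ) (R : Finset (Fin n)) (L : List (Labelled n)) : Prop :=
  ∀ i, i ∈ R ↔ (L.map fun p => ((p.2 : ℤ) : ℝ) * g (p.1 * signAt i)).sum < 0

open Classical in
/-- The Goldreich-Levin theorem. -/
theorem le_doublingMean_votesFor (g : Cube n → ℝ) (B : ℝ) (hB : ∀ v, |g v| ≤ B)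
    (R : Finset (Fin n)) (hR : coefficient g R ≠ 0) (k : ℕ) :
    (1 / 2) ^ (k + 1) * (1 - n * B ^ 2 / (2 ^ k * coefficient g R ^ 2)) ≤
      doublingMean k fun L => if VotesFor g R L then (1 : ℝ) else 0 := by
  set C := coefficient g R with hC
  -- The sign of the coefficient is guessed too, as part of the label of the first point.
  obtain ⟨σ, hσ⟩ : ∃ σ : ℤˣ, ((σ : ℤ) : ℝ) * C = |C| := by
    rcases abs_choice C with h | h
    · exact ⟨1, by simp [h]⟩
    · exact ⟨-1, by simp [h]⟩
  have hC0 : 0 < |C| := abs_pos.2 hR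
  set F : Fin n → Cube n → ℝ := fun i v => ((σ * walsh R v : ℤˣ) : ℤ) * g (v * signAt i) with hF
  set m : Fin n → ℝ := fun i => |C| * ((walsh R (signAt i) : ℤˣ) : ℤ) with hm
  -- Moving the shift by `signAt i` from `g` to the character gives the factor `walsh R (signAt i)`,
  -- which is `-1` exactly for `i ∈ R`. So a correctly labelled summand of the vote on `i` has mean
  -- `-|C|` or `|C|` accordingly.
  have hmean : ∀ i, mean (PMF.uniformOfFintype (Cube n)) (F i) = m i := by
    intro i
    rw [← mean_uniform_mul_right (signAt i)]
    have : ∀ v, F i (v * signAt i) = ((σ : ℤ) : ℝ) * ((walsh R (signAt i) : ℤˣ) : ℤ) *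
        (g v * ((walsh R v : ℤˣ) : ℤ)) := by
      intro v
      simp only [hF]
      rw [mul_assoc v, signAt_mul_self, mul_one, map_mul]
      push_cast
      ring
    simp only [this, mean_const_mul]
    rw [show (mean (PMF.uniformOfFintype (Cube n)) fun v => g v * ((walsh R v : ℤˣ) : ℤ)) = C from rfl]
    simp only [hm, ← hσ]
    ring
  have hzero : ∀ i, (mean (PMF.uniformOfFintype (Cube n)) fun v => F i v - m i) = 0 := by
    intro i
    rw [mean_sub, mean_const, hmean, sub_self]
  have hsq : ∀ i, (mean (PMF.uniformOfFintype (Cube n)) fun v => (F i v - m i) ^ 2) ≤ B ^ 2 := by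
    intro i
    have h1 : (mean (PMF.uniformOfFintype (Cube n)) fun v => (F i v - m i) ^ 2) =
        (mean (PMF.uniformOfFintype (Cube n)) fun v => F i v ^ 2) - m i ^ 2 := by
      have : ∀ v, (F i v - m i) ^ 2 = F i v ^ 2 - 2 * m i * F i v + m i ^ 2 := fun v => by ring
      simp only [this, mean_add, mean_sub, mean_const_mul, mean_const]
      rw [hmean]
      ring
    have h2 : (mean (PMF.uniformOfFintype (Cube n)) fun v => F i v ^ 2) ≤ B ^ 2 := by
      refine mean_le_of_forall _ fun v => ?_
      rw [← sq_abs]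
      simp only [hF]
      rw [abs_mul, abs_units_cast, one_mul]
      exact pow_le_pow_left₀ (abs_nonneg _) (hB _) 2
    nlinarith [sq_nonneg (m i)]
  -- Chebyshev with a union bound: if the vote on `i` has the wrong sign, then the sum is off its
  -- mean by at least `2 ^ k * |C|`, so one of the subtracted summands is at least `1`.
  have hvote : ∀ L : List (Cube n), L.length = 2 ^ k →
      1 - ∑ i, (L.map fun v => F i v - m i).sum ^ 2 * ((2 ^ k * |C|) ^ 2)⁻¹ ≤
        if VotesFor g R (L.map (decorate (walsh R) σ)) then (1 : ℝ) else 0 := by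
    intro L hL
    have hnn : ∀ i, 0 ≤ (L.map fun v => F i v - m i).sum ^ 2 * ((2 ^ k * |C|) ^ 2)⁻¹ :=
      fun i => by positivity
    split_ifs with h
    · have := Finset.sum_nonneg fun i (_ : i ∈ Finset.univ) => hnn i
      linarith
    · rw [VotesFor, not_forall] at h
      obtain ⟨i, hi⟩ := h
      have h1 := Finset.single_le_sum (fun i _ => hnn i) (Finset.mem_univ i)
      have h2 : (L.map fun v => F i v - m i).sum = (L.map (F i)).sum - 2 ^ k * m i := by
        have : ∀ L : List (Cube n), (L.map fun v => F i v - m i).sum =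
            (L.map (F i)).sum - L.length * m i := by
          intro L
          induction L with
          | nil => simp
          | cons v L ih =>
            simp only [List.map_cons, List.sum_cons, ih, List.length_cons]
            push_cast
            ring
        rw [this, hL]
        push_cast
        rfl
      have h3 : (((L.map (decorate (walsh R) σ)).map fun p =>
          ((p.2 : ℤ) : ℝ) * g (p.1 * signAt i)).sum) = (L.map (F i)).sum := by
        rw [List.map_map]
        rfl
      rw [h3] at hi
      have hp : (0 : ℝ) < 2 ^ k * |C| := by positivity
      have h4 : (2 ^ k * |C|) ^ 2 ≤ (L.map fun v => F i v - m i).sum ^ 2 := by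
        rw [h2]
        simp only [hm, walsh_signAt]
        by_cases hiR : i ∈ R
        · have : 0 ≤ (L.map (F i)).sum := by
            by_contra h5
            exact hi ⟨fun _ => not_le.1 h5, fun _ => hiR⟩
          simp only [hiR, if_true]
          push_cast
          nlinarith
        · have : (L.map (F i)).sum < 0 := by
            by_contra h5
            exact hi ⟨fun h => absurd h hiR, fun h => absurd h h5⟩
          simp only [hiR, if_false]
          push_cast
          nlinarith
      have h5 : 1 ≤ (L.map fun v => F i v - m i).sum ^ 2 * ((2 ^ k * |C|) ^ 2)⁻¹ := by
        rw [← div_eq_mul_inv, one_le_div (by positivity)]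
        exact h4
      linarith
  -- Only the event that all labels have been guessed correctly is retained.
  refine le_trans ?_ (doublingMean_decorate_le (walsh R) σ _ (fun L => by positivity) k)
  refine mul_le_mul_of_nonneg_left ?_ (by positivity)
  refine le_trans ?_ (doublingMean_mono k hvote)
  rw [doublingMean_one_sub_sum]
  refine sub_le_sub_left ?_ 1
  calc ∑ i, doublingMean k (fun L => (L.map fun v => F i v - m i).sum ^ 2) * ((2 ^ k * |C|) ^ 2)⁻¹
      ≤ ∑ _i : Fin n, (2 ^ k * B ^ 2) * ((2 ^ k * |C|) ^ 2)⁻¹ := by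
        refine Finset.sum_le_sum fun i _ => ?_
        rw [doublingMean_sq k _ (hzero i)]
        have := hsq i
        gcongr
    _ = _ := by
        rw [Finset.sum_const, Finset.card_univ, Fintype.card_fin, nsmul_eq_mul, mul_pow, sq_abs]
        have : C ≠ 0 := hR
        field_simp

end GoldreichLevin

/-! ## Terms and product distributions -/

section product

variable {n : ℕ} (μ : Fin n → Set.Ioo (-1 : ℝ) 1)

/-- The probability that the `i`-th coordinate equals `b`. -/
noncomputable def coordProb (i : Fin n) (b : ℤˣ) : ℝ := (bitWeight (μ i) b).toReal

theorem coordProb_eq (i : Fin n) (b : ℤˣ) :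
    coordProb μ i b = (1 + (μ i : ℝ) * ((b : ℤ) : ℝ)) / 2 := by
  rw [coordProb, bitWeight, ENNReal.toReal_ofReal]
  have h1 := (μ i).2.1
  have h2 := (μ i).2.2
  rcases Int.units_eq_one_or b with rfl | rfl <;> push_cast <;> linarith

theorem coordProb_nonneg (i : Fin n) (b : ℤˣ) : 0 ≤ coordProb μ i b := ENNReal.toReal_nonneg

theorem sum_coordProb (i : Fin n) : ∑ b, coordProb μ i b = 1 := by
  rw [show (Finset.univ : Finset ℤˣ) = {1, -1} by decide, Finset.sum_pair (by decide),
    coordProb_eq, coordProb_eq]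
  push_cast
  ring

theorem coordProb_le_one (i : Fin n) (b : ℤˣ) : coordProb μ i b ≤ 1 := by
  rw [← sum_coordProb μ i]
  exact Finset.single_le_sum (fun b _ => coordProb_nonneg μ i b) (Finset.mem_univ b)

/-- The only consequence of `c`-boundedness that is used. -/
theorem coordProb_le {c : ℝ} (hμ : IsBoundedBy c μ) (i : Fin n) (b : ℤˣ) :
    coordProb μ i b ≤ 1 - c / 2 := by
  rw [coordProb_eq]
  have h1 := (hμ i).1
  have h2 := (hμ i).2
  rcases Int.units_eq_one_or b with rfl | rfl <;> push_cast <;> linarith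

theorem productDist_toReal (x : Cube n) :
    (productDist μ x).toReal = ∏ i, coordProb μ i (x i) := by
  rw [productDist, PMF.ofFintype_apply, ENNReal.toReal_prod]
  rfl

theorem mean_productDist_prod_univ (G : Fin n → ℤˣ → ℝ) :
    (mean (productDist μ) fun z => ∏ i, G i (z i)) = ∏ i, ∑ b, coordProb μ i b * G i b := by
  rw [Finset.prod_univ_sum, Fintype.piFinset_univ, mean]
  simp only [productDist_toReal, Finset.prod_mul_distrib]

theorem mean_productDist_prod (R : Finset (Fin n)) (G : Fin n → ℤˣ → ℝ) :
    (mean (productDist μ) fun z => ∏ i ∈ R, G i (z i)) =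
      ∏ i ∈ R, ∑ b, coordProb μ i b * G i b := by
  have h := mean_productDist_prod_univ μ fun i b => if i ∈ R then G i b else 1
  simp only [Finset.prod_ite_mem, Finset.univ_inter] at h
  rw [h, ← Finset.univ_inter R, ← Finset.prod_ite_mem, Finset.univ_inter]
  refine Finset.prod_congr rfl fun i _ => ?_
  split_ifs
  · rfl
  · simp only [mul_one, sum_coordProb]

theorem mix_mix (x z r : Cube n) : mix (mix x z r) (mix z x r) r = x := by
  funext i
  simp only [mix]
  split_ifs <;> rfl

/-- Exchange of the coordinates of two points where `r` is not `1`. -/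
def exchange (r : Cube n) : Cube n × Cube n ≃ Cube n × Cube n where
  toFun p := (mix p.1 p.2 r, mix p.2 p.1 r)
  invFun p := (mix p.1 p.2 r, mix p.2 p.1 r)
  left_inv _ := Prod.ext (mix_mix _ _ _) (mix_mix _ _ _)
  right_inv _ := Prod.ext (mix_mix _ _ _) (mix_mix _ _ _)

/-- `x` and `z` are independent with the same product distribution, so exchanging some of their
coordinates preserves the joint law. -/
theorem mean_mean_exchange (r : Cube n) (H : Cube n → Cube n → ℝ) :
    (mean (productDist μ) fun x => mean (productDist μ) fun z => H (mix x z r) (mix z x r)) =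
      mean (productDist μ) fun x => mean (productDist μ) fun z => H x z := by
  have h : ∀ H : Cube n → Cube n → ℝ,
      (mean (productDist μ) fun x => mean (productDist μ) fun z => H x z) =
      ∑ p : Cube n × Cube n,
        (productDist μ p.1).toReal * (productDist μ p.2).toReal * H p.1 p.2 := by
    intro H
    simp only [mean, Fintype.sum_prod_type, Finset.mul_sum, mul_assoc]
  rw [h, h, ← (exchange r).sum_comp]
  refine Finset.sum_congr rfl fun p _ => ?_
  simp only [exchange, Equiv.coe_fn_mk, mix_mix]
  congr 1
  simp only [productDist_toReal, ← Finset.prod_mul_distrib]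
  refine Finset.prod_congr rfl fun i _ => ?_
  simp only [mix]
  split_ifs
  · rfl
  · exact mul_comm _ _

end product

/-! ### Covariances with conjunctions when the means are unknown -/

section terms

variable {n : ℕ}

/-- The indicator of equality. -/
noncomputable def ind (a b : ℤˣ) : ℝ := if a = b then 1 else 0

/-- The term with the variables in `R` and the signs opposite to those in `z`. -/
def code (R : Finset (Fin n)) (z : Cube n) : List ℤ :=
  List.ofFn fun i => if i ∈ R then 0 - (z i : ℤ) else 0

theorem codeHolds_code_iff (R : Finset (Fin n)) (z x : Cube n) :
    CodeHolds (code R z) x ↔ ∀ i ∈ R, x i = -z i := by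
  refine forall_congr' fun i => ?_
  have h : (code R z).getD i 1 = if i ∈ R then 0 - (z i : ℤ) else 0 := by
    simp [code]
  rw [h]
  by_cases hi : i ∈ R
  · simp only [hi, if_true, true_imp_iff]
    rcases Int.units_eq_one_or (z i) with hz | hz <;> rcases Int.units_eq_one_or (x i) with hx | hx <;>
      rw [hz, hx] <;> decide
  · simp [hi]

/-- The product of the differences of the indicators of literals at two points. -/
noncomputable def contrast (R : Finset (Fin n)) (a x z : Cube n) : ℝ :=
  ∏ i ∈ R, (ind (x i) (a i) - ind (z i) (a i))

/-- A factor vanishes if `x i = z i`; otherwise exactly one of the two indicators is `1`, and the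
sign depends on `z` and `a` only. -/
theorem contrast_eq (R : Finset (Fin n)) (a x z : Cube n) :
    contrast R a x z = (∏ i ∈ R, if z i = a i then (-1 : ℝ) else 1) *
      if CodeHolds (code R z) x then 1 else 0 := by
  have h1 : (if CodeHolds (code R z) x then (1 : ℝ) else 0) =
      ∏ i ∈ R, if x i = -z i then (1 : ℝ) else 0 := by
    rw [Finset.prod_ite_zero]
    simp [codeHolds_code_iff]
  rw [h1, ← Finset.prod_mul_distrib, contrast]
  refine Finset.prod_congr rfl fun i _ => ?_
  unfold ind
  rcases Int.units_eq_one_or (z i) with hz | hz <;>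
    rcases Int.units_eq_one_or (x i) with hx | hx <;>
    rcases Int.units_eq_one_or (a i) with ha | ha <;> rw [hz, hx, ha] <;> simp

theorem abs_prod_sign (R : Finset (Fin n)) (a z : Cube n) :
    |∏ i ∈ R, if z i = a i then (-1 : ℝ) else 1| = 1 := by
  rw [Finset.abs_prod]
  refine Finset.prod_eq_one fun i _ => ?_
  split_ifs <;> simp

theorem abs_contrast_le (R : Finset (Fin n)) (a x z : Cube n) : |contrast R a x z| ≤ 1 := by
  rw [contrast_eq, abs_mul, abs_prod_sign]
  split_ifs <;> simp

/-- Each exchanged coordinate in `R` reverses the sign of its factor. -/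
theorem contrast_mix (R : Finset (Fin n)) (a x z r : Cube n) :
    contrast R a (mix x z r) (mix z x r) = ((walsh R r : ℤˣ) : ℤ) * contrast R a x z := by
  have h1 : (((walsh R r : ℤˣ) : ℤ) : ℝ) = ∏ i ∈ R, ((r i : ℤ) : ℝ) := by
    simp [walsh, Units.coe_prod]
  rw [h1, contrast, contrast, ← Finset.prod_mul_distrib]
  refine Finset.prod_congr rfl fun i _ => ?_
  unfold mix
  rcases Int.units_eq_one_or (r i) with hr | hr <;> simp [hr]

/-- The correlation of `u` with the term `t`. -/
noncomputable def correlation (D : PMF (Cube n)) (u : Cube n → ℝ) (t : List ℤ) : ℝ :=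
  mean D fun x => u x * if CodeHolds t x then 1 else 0

variable (μ : Fin n → Set.Ioo (-1 : ℝ) 1)

theorem sum_coordProb_mul_ind (i : Fin n) (b : ℤˣ) :
    ∑ b', coordProb μ i b' * ind b' b = coordProb μ i b := by
  simp only [ind, mul_ite, mul_one, mul_zero, Finset.sum_ite_eq', Finset.mem_univ, if_true]

/-- The second point `z` stands in for the probabilities of the literals, which the learner does not
know. -/
theorem mean_contrast (R : Finset (Fin n)) (a x : Cube n) :
    (mean (productDist μ) fun z => contrast R a x z) =
      ∏ i ∈ R, (ind (x i) (a i) - coordProb μ i (a i)) := by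
  have h := mean_productDist_prod μ R fun i b => ind (x i) (a i) - ind b (a i)
  rw [show (fun z => contrast R a x z) =
    fun z : Cube n => ∏ i ∈ R, (ind (x i) (a i) - ind (z i) (a i)) from rfl, h]
  refine Finset.prod_congr rfl fun i _ => ?_
  simp only [mul_sub, Finset.sum_sub_distrib, ← Finset.sum_mul, sum_coordProb, one_mul,
    sum_coordProb_mul_ind]

/-- The covariance of `u` with the variables in `R` of a term with signs `a`. -/
noncomputable def covariance (u : Cube n → ℝ) (R : Finset (Fin n)) (a : Cube n) : ℝ :=
  mean (productDist μ) fun x => mean (productDist μ) fun z => u x * contrast R a x z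

theorem covariance_eq (u : Cube n → ℝ) (R : Finset (Fin n)) (a : Cube n) :
    covariance μ u R a =
      mean (productDist μ) fun x => u x * ∏ i ∈ R, (ind (x i) (a i) - coordProb μ i (a i)) := by
  simp only [covariance, mean_const_mul, mean_contrast]

/-- For fixed `z` the contrast is, up to a sign not depending on `x`, the indicator of a term.
Neither `a` nor the means are needed to write that term down. -/
theorem abs_covariance_le_correlation (u : Cube n → ℝ) (R : Finset (Fin n)) (a : Cube n) :
    |covariance μ u R a| ≤
      mean (productDist μ) fun z => |correlation (productDist μ) u (code R z)| := by
  rw [covariance, mean_comm]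
  refine (abs_mean_le _ _).trans (mean_mono _ fun z => le_of_eq ?_)
  have : ∀ x, u x * contrast R a x z = (∏ i ∈ R, if z i = a i then (-1 : ℝ) else 1) *
      (u x * if CodeHolds (code R z) x then 1 else 0) := by
    intro x
    rw [contrast_eq]
    ring
  simp only [this, mean_const_mul]
  rw [abs_mul, abs_prod_sign, one_mul, correlation]

theorem abs_covariance_le_coefficient (u : Cube n → ℝ) (R : Finset (Fin n)) (a : Cube n) :
    |covariance μ u R a| ≤ mean (productDist μ) fun x => mean (productDist μ) fun z =>
      |coefficient (fun r => u (mix x z r)) R| := by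
  have h1 : covariance μ u R a = mean (productDist μ) fun x => mean (productDist μ) fun z =>
      coefficient (fun r => u (mix x z r)) R * contrast R a x z := by
    -- The covariance may be computed after any exchange `r`. Averaging over uniform `r` produces
    -- the Walsh coefficient.
    have h2 : ∀ r : Cube n, covariance μ u R a =
        mean (productDist μ) fun x => mean (productDist μ) fun z =>
          u (mix x z r) * ((walsh R r : ℤˣ) : ℤ) * contrast R a x z := by
      intro r
      rw [covariance, ← mean_mean_exchange μ r]
      simp only [contrast_mix, mul_assoc]
    rw [← mean_const (PMF.uniformOfFintype (Cube n)) (covariance μ u R a)]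
    conv_lhs =>
      arg 2
      intro r
      rw [h2 r]
    rw [mean_comm]
    congr 1
    funext x
    rw [mean_comm]
    congr 1
    funext z
    rw [mean_mul_const]
    rfl
  rw [h1]
  refine (abs_mean_le _ _).trans (mean_mono _ fun x => ?_)
  refine (abs_mean_le _ _).trans (mean_mono _ fun z => ?_)
  rw [abs_mul]
  exact mul_le_of_le_one_right (abs_nonneg _) (abs_contrast_le R a x z)

/-- A correlation with a conjunction entails a covariance with one of its parts. -/
theorem exists_le_abs_covariance (u : Cube n → ℝ) (V : Finset (Fin n)) (a : Cube n) (γ : ℝ)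
    (h : γ ≤ |mean (productDist μ) fun x => u x * ∏ i ∈ V, ind (x i) (a i)|) :
    ∃ R, γ ≤ 2 ^ V.card * |covariance μ u R a| := by
  by_contra hcon
  push Not at hcon
  -- Each indicator is its centred version plus its mean. The expansion has `2 ^ V.card` summands,
  -- and the products of means are at most `1`.
  have h1 : (mean (productDist μ) fun x => u x * ∏ i ∈ V, ind (x i) (a i)) =
      ∑ R ∈ V.powerset, covariance μ u R a * ∏ i ∈ V \ R, coordProb μ i (a i) := by
    have h2 : ∀ x, u x * ∏ i ∈ V, ind (x i) (a i) = ∑ R ∈ V.powerset,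
        (u x * ∏ i ∈ R, (ind (x i) (a i) - coordProb μ i (a i))) *
          ∏ i ∈ V \ R, coordProb μ i (a i) := by
      intro x
      have h3 := Finset.prod_add (fun i => ind (x i) (a i) - coordProb μ i (a i))
        (fun i => coordProb μ i (a i)) V
      simp only [sub_add_cancel] at h3
      rw [h3, Finset.mul_sum]
      simp only [mul_assoc]
    simp only [h2, mean_sum, mean_mul_const, covariance_eq]
  have h4 : ∑ R ∈ V.powerset, 2 ^ V.card * |covariance μ u R a| < ∑ R ∈ V.powerset, γ :=
    Finset.sum_lt_sum_of_nonempty ⟨∅, Finset.empty_mem_powerset V⟩ fun R _ => hcon R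
  rw [Finset.sum_const, Finset.card_powerset, ← Finset.mul_sum, nsmul_eq_mul] at h4
  push_cast at h4
  have h5 := lt_of_mul_lt_mul_left h4 (by positivity)
  refine absurd (h.trans ?_) (not_le.2 h5)
  rw [h1]
  refine (Finset.abs_sum_le_sum_abs _ _).trans (Finset.sum_le_sum fun R _ => ?_)
  rw [abs_mul]
  refine mul_le_of_le_one_right (abs_nonneg _) ?_
  rw [Finset.abs_prod]
  refine Finset.prod_le_one (fun i _ => abs_nonneg _) fun i _ => ?_
  rw [abs_of_nonneg (coordProb_nonneg μ i _)]
  exact coordProb_le_one μ i _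

/-- A large correlation with a conjunction entails a large covariance with one of its parts. -/
theorem exists_large_covariance {c : ℝ} (hμ : IsBoundedBy c μ) (e : ℕ)
    (he : (1 - c / 2) ^ e ≤ 1 / 2) (hc : c ≤ 1) (u : Cube n → ℝ) (hu : ∀ x, |u x| ≤ 2)
    (V : Finset (Fin n)) (a : Cube n) (γ : ℝ) (hγ : 0 < γ)
    (h : γ ≤ |mean (productDist μ) fun x => u x * ∏ i ∈ V, ind (x i) (a i)|) :
    ∃ R, γ * (γ / 2) ^ e ≤ |covariance μ u R a| := by
  obtain ⟨R, hR⟩ := exists_le_abs_covariance μ u V a γ h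
  refine ⟨R, ?_⟩
  have hi : ∀ x : Cube n, 0 ≤ ∏ i ∈ V, ind (x i) (a i) := fun x =>
    Finset.prod_nonneg fun i _ => by unfold ind; split_ifs <;> norm_num
  -- The conjunction holds with probability at most `(1 - c / 2) ^ V.card`, so a correlation of size
  -- `γ` forces it to be short.
  have h1 : γ ≤ 2 * (1 - c / 2) ^ V.card := by
    refine h.trans ((abs_mean_le _ _).trans ?_)
    have h2 : (mean (productDist μ) fun x => |u x * ∏ i ∈ V, ind (x i) (a i)|) ≤
        mean (productDist μ) fun x => 2 * ∏ i ∈ V, ind (x i) (a i) := by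
      refine mean_mono _ fun x => ?_
      rw [abs_mul, abs_of_nonneg (hi x)]
      exact mul_le_mul_of_nonneg_right (hu x) (hi x)
    refine h2.trans ?_
    rw [mean_const_mul, mean_productDist_prod μ V fun i b => ind b (a i)]
    refine mul_le_mul_of_nonneg_left ?_ (by norm_num)
    refine (Finset.prod_le_prod (fun i _ => Finset.sum_nonneg fun b _ => mul_nonneg
      (coordProb_nonneg μ i b) (by unfold ind; split_ifs <;> norm_num)) fun i _ => ?_).trans
      (le_of_eq (Finset.prod_const _))
    rw [sum_coordProb_mul_ind]
    exact coordProb_le μ hμ i (a i)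
  -- The exponent `e` converts powers of `1 - c / 2` into powers of `1 / 2`; this makes the factor
  -- `2 ^ V.card` polynomial in `1 / γ`.
  have h3 : (γ / 2) ^ e ≤ (1 / 2) ^ V.card := by
    calc (γ / 2) ^ e ≤ ((1 - c / 2) ^ V.card) ^ e :=
          pow_le_pow_left₀ (by positivity) (by linarith) e
      _ = ((1 - c / 2) ^ e) ^ V.card := by rw [← pow_mul, ← pow_mul, mul_comm]
      _ ≤ (1 / 2) ^ V.card := pow_le_pow_left₀ (pow_nonneg (by linarith) _) he _
  calc γ * (γ / 2) ^ e ≤ (2 ^ V.card * |covariance μ u R a|) * (1 / 2) ^ V.card :=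
        mul_le_mul hR h3 (by positivity) (by positivity)
    _ = |covariance μ u R a| * (2 * (1 / 2)) ^ V.card := by rw [mul_pow]; ring
    _ = |covariance μ u R a| := by norm_num

end terms

/-! ## Finding a correlated term -/

section

variable {n : ℕ} (f : Cube n → ℤˣ) (K : ℕ)

/-- The difference of the target and the current prediction. -/
noncomputable def gap (h : List (ℤ × List ℤ)) (x : Cube n) : ℝ := (residual f K h x : ℝ) / K

theorem gap_nonneg (h : List (ℤ × List ℤ)) {x : Cube n} (hx : f x = 1) : 0 ≤ gap f K h x := by
  have h1 := (abs_le.1 (abs_predict_le K h x)).2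
  have h2 : 0 ≤ residual f K h x := by
    rw [residual, hx]
    push_cast
    linarith
  have h3 : (0 : ℝ) ≤ residual f K h x := by exact_mod_cast h2
  unfold gap
  positivity

theorem gap_nonpos (h : List (ℤ × List ℤ)) {x : Cube n} (hx : f x = -1) : gap f K h x ≤ 0 := by
  have h1 := (abs_le.1 (abs_predict_le K h x)).1
  have h2 : residual f K h x ≤ 0 := by
    rw [residual, hx]
    push_cast
    linarith
  have h3 : (residual f K h x : ℝ) ≤ 0 := by exact_mod_cast h2
  exact div_nonpos_of_nonpos_of_nonneg h3 (Nat.cast_nonneg K)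

theorem abs_residual_le (h : List (ℤ × List ℤ)) (x : Cube n) :
    |(residual f K h x : ℝ)| ≤ 2 * K := by
  have h1 := natAbs_residual_le f K h x
  rw [← Int.cast_abs, Int.abs_eq_natAbs]
  exact_mod_cast h1

theorem abs_gap_le (h : List (ℤ × List ℤ)) (x : Cube n) : |gap f K h x| ≤ 2 := by
  have h1 := abs_residual_le f K h x
  rw [gap, abs_div, Nat.abs_cast]
  exact div_le_of_le_mul₀ (Nat.cast_nonneg K) (by norm_num) h1

/-- The expected error of the current prediction. -/
noncomputable def loss (D : PMF (Cube n)) (h : List (ℤ × List ℤ)) : ℝ :=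
  mean D fun x => |gap f K h x|

-- The gap has the sign of `f`. Where `f` is true, some term holds and the sum over the terms is at
-- least the gap; where `f` is false, no term holds and the negative of the gap remains. So the
-- absolute gap is at most twice that sum minus the gap, and only correlations with terms are left
-- after averaging.
open Classical in
theorem loss_lt (D : PMF (Cube n)) (h : List (ℤ × List ℤ)) (φ : DNF n)
    (hφ : ∀ x, f x = DNF.value φ x) (γ : ℝ)
    (hγ : ∀ t ∈ (∅ : Term n) :: φ,
      |mean D fun x => gap f K h x * if Term.Holds t x then 1 else 0| < γ) :
    loss f K D h < (2 * φ.length + 1) * γ := by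
  have h1 : ∀ x, |gap f K h x| ≤
      2 * (φ.map fun t => gap f K h x * if Term.Holds t x then (1 : ℝ) else 0).sum -
        gap f K h x := by
    intro x
    have hx := hφ x
    rw [DNF.value] at hx
    split_ifs at hx with hex
    · have h2 := gap_nonneg f K h hx
      obtain ⟨t, ht, hh⟩ := hex
      have h3 : gap f K h x * (if Term.Holds t x then (1 : ℝ) else 0) ≤
          (φ.map fun t => gap f K h x * if Term.Holds t x then (1 : ℝ) else 0).sum :=
        List.single_le_sum (fun y hy => by
          obtain ⟨t, -, rfl⟩ := List.mem_map.1 hy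
          split_ifs <;> simp [h2]) _ (List.mem_map.2 ⟨t, ht, rfl⟩)
      rw [if_pos hh, mul_one] at h3
      rw [abs_of_nonneg h2]
      linarith
    · have h2 := gap_nonpos f K h hx
      have h3 : (φ.map fun t => gap f K h x * if Term.Holds t x then (1 : ℝ) else 0).sum = 0 := by
        refine List.sum_eq_zero fun y hy => ?_
        obtain ⟨t, ht, rfl⟩ := List.mem_map.1 hy
        rw [if_neg fun hh => hex ⟨t, ht, hh⟩, mul_zero]
      rw [abs_of_nonpos h2, h3]
      linarith
  have h2 := mean_mono D h1
  rw [mean_sub, mean_const_mul, mean_list_sum] at h2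
  have h3 : (φ.map fun t => mean D fun x =>
      gap f K h x * if Term.Holds t x then (1 : ℝ) else 0).sum ≤ φ.length * γ := by
    rw [← nsmul_eq_mul, ← List.length_map (as := φ) fun t => mean D fun x =>
      gap f K h x * if Term.Holds t x then (1 : ℝ) else 0]
    refine List.sum_le_card_nsmul _ _ fun y hy => ?_
    obtain ⟨t, ht, rfl⟩ := List.mem_map.1 hy
    exact (le_abs_self _).trans (hγ t (List.mem_cons_of_mem _ ht)).le
  -- The empty term always holds, so this controls the mean of the gap itself.
  have h4 := hγ ∅ List.mem_cons_self
  have h5 : ∀ x : Cube n, Term.Holds (∅ : Term n) x := fun x l hl =>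
    absurd hl (Finset.notMem_empty l)
  simp only [h5, if_true, mul_one] at h4
  have h6 := neg_abs_le (mean D fun x => gap f K h x)
  rw [loss]
  linarith

variable (μ : Fin n → Set.Ioo (-1 : ℝ) 1)

/-- If the error is large, then some covariance is large. -/
theorem exists_large_covariance_gap {c : ℝ} (hμ : IsBoundedBy c μ) (e : ℕ)
    (he : (1 - c / 2) ^ e ≤ 1 / 2) (hc : c ≤ 1) (h : List (ℤ × List ℤ)) (s : ℕ)
    (hf : IsDNFOfSize f s) (γ : ℝ) (hγ : 0 < γ)
    (hl : (2 * s + 1) * γ ≤ loss f K (productDist μ) h) :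
    ∃ R a, γ * (γ / 2) ^ e ≤ |covariance μ (gap f K h) R a| := by
  classical
  obtain ⟨φ, hs, hφ⟩ := hf
  obtain ⟨t, ht⟩ : ∃ t : Term n, γ ≤ |mean (productDist μ) fun x =>
      gap f K h x * if Term.Holds t x then 1 else 0| := by
    by_contra hcon
    push Not at hcon
    have h1 := loss_lt f K (productDist μ) h φ hφ γ fun t _ => hcon t
    have h2 : (φ.length : ℝ) ≤ s := by exact_mod_cast hs
    have h3 : (2 * (φ.length : ℝ) + 1) * γ ≤ (2 * s + 1) * γ := by gcongr
    linarith
  -- A contradictory term would have correlation zero. Any satisfying point `a` provides consistent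
  -- signs for the variables of `t`.
  obtain ⟨a, ha⟩ : ∃ a, Term.Holds t a := by
    by_contra hcon
    push Not at hcon
    simp only [hcon, if_false, mul_zero, mean_const, abs_zero] at ht
    linarith
  have h1 : ∀ x : Cube n, (if Term.Holds t x then (1 : ℝ) else 0) =
      ∏ i ∈ t.image Prod.fst, ind (x i) (a i) := by
    intro x
    simp only [ind]
    rw [Finset.prod_ite_zero, Finset.prod_const_one]
    have h2 : Term.Holds t x ↔ ∀ i ∈ t.image Prod.fst, x i = a i := by
      constructor
      · intro hx i hi
        obtain ⟨l, hl, rfl⟩ := Finset.mem_image.1 hi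
        rw [hx l hl, ha l hl]
      · intro hx l hl
        rw [hx l.1 (Finset.mem_image_of_mem _ hl), ha l hl]
    by_cases hx : Term.Holds t x
    · rw [if_pos hx, if_pos (h2.1 hx)]
    · rw [if_neg hx, if_neg fun h3 => hx (h2.2 h3)]
  simp only [h1] at ht
  obtain ⟨R, hR⟩ := exists_large_covariance μ hμ e he hc _ (abs_gap_le f K h) _ a γ hγ ht
  exact ⟨R, a, hR⟩

theorem candidate_eq_code (h : List (ℤ × List ℤ)) (x z : Cube n) (R : Finset (Fin n))
    (L : List (Labelled n))
    (hL : VotesFor (fun v => (residual f K h (mix x z v) : ℝ)) R L) (z' : Cube n) :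
    candidate f K h x z L z' = code R z' := by
  rw [candidate, code]
  congr 1
  funext i
  have h1 : ((vote f K h x z L i : ℤ) : ℝ) = (L.map fun p => ((p.2 : ℤ) : ℝ) *
      (residual f K h (mix x z (p.1 * signAt i)) : ℝ)).sum := by
    rw [vote, Int.cast_list_sum, List.map_map]
    congr 2
    funext p
    simp
  have h2 := hL i
  rw [← h1, Int.cast_lt_zero] at h2
  by_cases hi : i ∈ R
  · rw [if_pos hi, if_neg (not_le.2 (h2.1 hi))]
  · rw [if_neg hi, if_pos (not_lt.1 fun h3 => hi (h2.2 h3))]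

open Classical in
/-- The votes are correct with a probability that is at least proportional to the coefficient. -/
theorem le_doublingMean_votesFor_gap (hK : 0 < K) (h : List (ℤ × List ℤ)) (x z : Cube n)
    (R : Finset (Fin n)) (k : ℕ) (β : ℝ) (hβ : 0 < β) (hk : 32 * n ≤ 2 ^ k * β ^ 2) :
    (1 / 2) ^ (k + 1) * ((|coefficient (fun v => gap f K h (mix x z v)) R| - β / 2) / 4) ≤
      doublingMean k fun L =>
        if VotesFor (fun v => (residual f K h (mix x z v) : ℝ)) R L then (1 : ℝ) else 0 := by
  set C := coefficient (fun v => gap f K h (mix x z v)) R with hC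
  have hK' : (0 : ℝ) < K := by exact_mod_cast hK
  have h1 : coefficient (fun v => (residual f K h (mix x z v) : ℝ)) R = K * C := by
    rw [hC, coefficient, coefficient, ← mean_const_mul]
    congr 1
    funext v
    rw [gap]
    field_simp
  have hC2 : |C| ≤ 2 := by
    rw [hC, coefficient]
    refine (abs_mean_le _ _).trans (mean_le_of_forall _ fun v => ?_)
    rw [abs_mul, abs_units_cast, mul_one]
    exact abs_gap_le f K h _
  -- The bound is linear in `|C|` so that it can be averaged over `x` and `z`. Below `β / 2` it is
  -- trivial; above, the Chebyshev error is at most `1 / 2`, and `1 / 2 ≥ |C| / 4` as `|C| ≤ 2`.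
  rcases lt_or_ge |C| (β / 2) with hlt | hge
  · refine le_trans (mul_nonpos_of_nonneg_of_nonpos (by positivity) (by linarith)) ?_
    exact mean_nonneg _ fun p => meanDouble_iterate_nonneg (fun L => by positivity) k _
  · have hC0 : C ≠ 0 := fun h0 => by rw [h0, abs_zero] at hge; linarith
    refine le_trans ?_ (le_doublingMean_votesFor _ (2 * K)
      (fun v => abs_residual_le f K h (mix x z v)) R (by rw [h1]; positivity) k)
    refine mul_le_mul_of_nonneg_left ?_ (by positivity)
    have h2 : (β / 2) ^ 2 ≤ C ^ 2 := by
      rw [← sq_abs C]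
      exact pow_le_pow_left₀ (by positivity) hge 2
    have h3 : (n : ℝ) * (2 * K) ^ 2 / (2 ^ k * (K * C) ^ 2) ≤ 1 / 2 := by
      rw [div_le_iff₀ (by positivity)]
      have h4 : (2 : ℝ) ^ k * (β / 2) ^ 2 ≤ 2 ^ k * C ^ 2 := by gcongr
      have h5 : 8 * (n : ℝ) ≤ 2 ^ k * C ^ 2 := by linarith
      have h6 : 8 * (n : ℝ) * K ^ 2 ≤ 2 ^ k * C ^ 2 * K ^ 2 := by gcongr
      linarith
    rw [h1]
    linarith

/-- If some covariance is large, then a new term is correlated in the mean. -/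
theorem le_lmean_candidateDist (hK : 0 < K) (h : List (ℤ × List ℤ)) (R : Finset (Fin n))
    (a : Cube n) (k : ℕ) (β : ℝ) (hβ : 0 < β) (hk : 32 * n ≤ 2 ^ k * β ^ 2)
    (hcov : β ≤ |covariance μ (gap f K h) R a|) :
    ENNReal.ofReal ((1 / 2) ^ (k + 1) * (β / 8) * β ^ 2) ≤
      lmean (candidateDist f (productDist μ) K k h) fun t =>
        ENNReal.ofReal (correlation (productDist μ) (gap f K h) t ^ 2) := by
  classical
  set D := productDist μ with hD
  set P : Cube n → Cube n → ℝ := fun x z => doublingMean k fun L =>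
    if VotesFor (fun v => (residual f K h (mix x z v) : ℝ)) R L then (1 : ℝ) else 0 with hP
  have hP0 : ∀ x z, 0 ≤ P x z := fun x z =>
    mean_nonneg _ fun p => meanDouble_iterate_nonneg (fun L => by positivity) k _
  set B : ℝ := mean D fun z' => correlation D (gap f K h) (code R z') ^ 2 with hB
  -- First use of the covariance: if the right set `R` has been found, random signs give a term with
  -- large mean squared correlation.
  have hB1 : β ^ 2 ≤ B := by
    refine le_trans ?_ ((sq_mean_le D fun z => |correlation D (gap f K h) (code R z)|).trans
      (le_of_eq ?_))
    · exact pow_le_pow_left₀ hβ.le (hcov.trans (abs_covariance_le_correlation μ _ R a)) 2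
    · simp only [sq_abs, hB]
  -- Second use: the mean absolute coefficient is at least `β`, and `(β - β / 2) / 4 = β / 8`.
  have hP1 : (1 / 2) ^ (k + 1) * (β / 8) ≤ mean D fun x => mean D fun z => P x z := by
    have h1 := hcov.trans (abs_covariance_le_coefficient μ _ R a)
    refine le_trans ?_ (mean_mono D fun x => mean_mono D fun z =>
      le_doublingMean_votesFor_gap f K hK h x z R k β hβ hk)
    simp only [mean_const_mul, div_eq_mul_inv, mean_mul_const, mean_sub, mean_const]
    refine mul_le_mul_of_nonneg_left ?_ (by positivity)
    linarith
  -- The example `z'` is independent of `x`, `z` and `L`, so the two bounds multiply. Outside the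
  -- event of correct votes the squared correlation is just bounded below by zero.
  have key : ∀ x z, ENNReal.ofReal (P x z) * ENNReal.ofReal B ≤
      lmean (pairwisePoints n k) fun L => lmean D fun z' =>
        ENNReal.ofReal (correlation D (gap f K h) (candidate f K h x z L z') ^ 2) := by
    intro x z
    rw [hP, ← lmean_pairwisePoints n k _ fun L => by positivity, ← lmean_mul_const]
    refine lmean_mono fun L => ?_
    split_ifs with hL
    · rw [ENNReal.ofReal_one, one_mul, hB, ← lmean_ofReal D fun z' => sq_nonneg _]
      refine le_of_eq ?_
      congr 1
      funext z'
      rw [candidate_eq_code f K h x z R L hL]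
    · rw [ENNReal.ofReal_zero, zero_mul]
      exact zero_le
  simp only [candidateDist, lmean_bind, lmean_map]
  refine le_trans ?_ (lmean_mono fun x => lmean_mono fun z => key x z)
  simp only [lmean_mul_const, lmean_ofReal D (hP0 _)]
  rw [lmean_ofReal D fun x => mean_nonneg D fun z => hP0 x z,
    ← ENNReal.ofReal_mul (mean_nonneg D fun x => mean_nonneg D fun z => hP0 x z)]
  refine ENNReal.ofReal_le_ofReal ?_
  exact mul_le_mul hP1 hB1 (by positivity)
    (mean_nonneg D fun x => mean_nonneg D fun z => hP0 x z)

end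

/-! ## Progress of the algorithm -/

section

variable {n : ℕ} (f : Cube n → ℤˣ) (K M : ℕ) (D : PMF (Cube n))

/-- The expected squared error of the current prediction. -/
noncomputable def potential (h : List (ℤ × List ℤ)) : ℝ := mean D fun x => gap f K h x ^ 2

theorem potential_nonneg (h : List (ℤ × List ℤ)) : 0 ≤ potential f K D h :=
  mean_nonneg D fun _ => sq_nonneg _

theorem loss_nonneg (h : List (ℤ × List ℤ)) : 0 ≤ loss f K D h :=
  mean_nonneg D fun _ => abs_nonneg _

theorem loss_le (h : List (ℤ × List ℤ)) : loss f K D h ≤ 2 :=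
  mean_le_of_forall D fun x => abs_gap_le f K h x

theorem abs_correlation_le (h : List (ℤ × List ℤ)) (t : List ℤ) :
    |correlation D (gap f K h) t| ≤ 2 := by
  refine (abs_mean_le _ _).trans (mean_le_of_forall _ fun x => ?_)
  rw [abs_mul]
  have h1 := abs_gap_le f K h x
  split_ifs <;> simp [h1]

/-- Projection to an interval does not increase the distance to its points, here to an end point. -/
theorem sq_sub_clamp_le (K v : ℤ) (u : ℤˣ) (hK : 0 ≤ K) :
    (K * u - max (-K) (min v K)) ^ 2 ≤ (K * u - v) ^ 2 := by
  rcases Int.units_eq_one_or u with rfl | rfl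
  · push_cast
    rcases le_total v K with h1 | h1
    · rw [min_eq_left h1]
      rcases le_total (-K) v with h2 | h2
      · rw [max_eq_right h2]
      · rw [max_eq_left h2]; nlinarith
    · rw [min_eq_right h1, max_eq_right (by omega)]; nlinarith [sq_nonneg (K - v)]
  · push_cast
    rcases le_total v K with h1 | h1
    · rw [min_eq_left h1]
      rcases le_total (-K) v with h2 | h2
      · rw [max_eq_right h2]
      · rw [max_eq_left h2]; nlinarith [sq_nonneg (K + v)]
    · rw [min_eq_right h1, max_eq_right (by omega)]; nlinarith

theorem sq_gap_cons_le (hK : 0 < K) (h : List (ℤ × List ℤ)) (w : ℤ) (t : List ℤ) (x : Cube n) :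
    gap f K ((w, t) :: h) x ^ 2 ≤
      (gap f K h x - (w : ℝ) / K * if CodeHolds t x then 1 else 0) ^ 2 := by
  have h1 := sq_sub_clamp_le K (predict K h x + if CodeHolds t x then w else 0) (f x)
    (Int.natCast_nonneg K)
  have h2 : residual f K ((w, t) :: h) x = (K : ℤ) * f x -
      max (-(K : ℤ)) (min (predict K h x + if CodeHolds t x then w else 0) K) := rfl
  have h3 : (K : ℤ) * f x - (predict K h x + if CodeHolds t x then w else 0) =
      residual f K h x - w * if CodeHolds t x then 1 else 0 := by
    rw [residual]
    split_ifs <;> ring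
  rw [← h2, h3] at h1
  have h4 : (residual f K ((w, t) :: h) x : ℝ) ^ 2 ≤
      ((residual f K h x : ℝ) - w * if CodeHolds t x then 1 else 0) ^ 2 := by
    have := (Int.cast_le (R := ℝ)).2 h1
    push_cast at this
    exact this
  have hK' : (0 : ℝ) < K := by exact_mod_cast hK
  have h5 : gap f K h x - (w : ℝ) / K * (if CodeHolds t x then 1 else 0) =
      ((residual f K h x : ℝ) - w * if CodeHolds t x then 1 else 0) / K := by
    rw [gap]
    ring
  rw [h5, gap, div_pow, div_pow]
  gcongr

/-- Expansion of the square for the untruncated prediction; the indicator of the term is at most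
`1`. -/
theorem potential_cons_le (hK : 0 < K) (h : List (ℤ × List ℤ)) (w : ℤ) (t : List ℤ) :
    potential f K D ((w, t) :: h) ≤
      potential f K D h - 2 * ((w : ℝ) / K) * correlation D (gap f K h) t + ((w : ℝ) / K) ^ 2 := by
  have h1 : ∀ x, gap f K ((w, t) :: h) x ^ 2 ≤ gap f K h x ^ 2 -
      2 * ((w : ℝ) / K) * (gap f K h x * if CodeHolds t x then 1 else 0) + ((w : ℝ) / K) ^ 2 := by
    intro x
    refine (sq_gap_cons_le f K hK h w t x).trans ?_
    split_ifs <;> nlinarith [sq_nonneg ((w : ℝ) / K)]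
  refine (mean_mono D h1).trans (le_of_eq ?_)
  rw [mean_add, mean_sub, mean_const_mul, mean_const]
  rfl

/-- The integer quotient loses less than one unit, and a unit is `1 / K = (1 / M) ^ 2`. So the scale
`K = M ^ 2` makes the rounding error of the same order as the second order terms. -/
theorem abs_newWeight_sub_le (hM : 0 < M) (h : List (ℤ × List ℤ)) (t : List ℤ) (y : Cube n) :
    |(newWeight f (M ^ 2) M h t y : ℝ) / ((M ^ 2 : ℕ) : ℝ) -
      1 / M * (gap f (M ^ 2) h y * if CodeHolds t y then 1 else 0)| ≤ (1 / (M : ℝ)) ^ 2 := by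
  have hM' : (0 : ℝ) < M := by exact_mod_cast hM
  have hMz : (0 : ℤ) < M := by exact_mod_cast hM
  rw [newWeight]
  split_ifs with ht
  · set r := residual f (M ^ 2) h y with hr
    have h1 := Int.mul_ediv_add_emod r M
    have h2 := Int.emod_nonneg r hMz.ne'
    have h3 := Int.emod_lt_of_pos r hMz
    have h4 : ((M : ℤ) : ℝ) * ((r / M : ℤ) : ℝ) + ((r % M : ℤ) : ℝ) = r := by exact_mod_cast h1
    have h5 : (0 : ℝ) ≤ ((r % M : ℤ) : ℝ) := by exact_mod_cast h2
    have h6 : ((r % M : ℤ) : ℝ) ≤ M := by exact_mod_cast h3.le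
    have h7 : ((r / M : ℤ) : ℝ) / ((M ^ 2 : ℕ) : ℝ) - 1 / M * (gap f (M ^ 2) h y * 1) =
        -(((r % M : ℤ) : ℝ) / M * (1 / (M : ℝ)) ^ 2) := by
      rw [gap, ← hr, ← h4]
      push_cast
      field_simp
      ring
    rw [h7, abs_neg, abs_of_nonneg (by positivity)]
    refine mul_le_of_le_one_left (by positivity) ?_
    rw [div_le_one hM']
    exact h6
  · simp only [Int.cast_zero, zero_div, mul_zero, sub_zero, abs_zero]
    positivity

/-- A stochastic gradient step of size `η = 1 / M`: the weight has mean `η * c` up to `η ^ 2`. Of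
the `13`, the square of the weight contributes `9`, since the weight is at most `3 * η`, and the
bias contributes `4`, since `|c| ≤ 2`. -/
theorem mean_potential_extend_le (hM : 0 < M) (h : List (ℤ × List ℤ)) (t : List ℤ) :
    (mean D fun y => potential f (M ^ 2) D (extend f (M ^ 2) M h t y)) +
      2 * (1 / M) * correlation D (gap f (M ^ 2) h) t ^ 2 ≤
        potential f (M ^ 2) D h + 13 * (1 / (M : ℝ)) ^ 2 := by
  set c := correlation D (gap f (M ^ 2) h) t with hc
  set W : Cube n → ℝ := fun y => (newWeight f (M ^ 2) M h t y : ℝ) / ((M ^ 2 : ℕ) : ℝ) with hW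
  set η : ℝ := 1 / M with hη
  have hM1 : (1 : ℝ) ≤ M := by exact_mod_cast hM
  have hη0 : 0 < η := by positivity
  have hη1 : η ≤ 1 := by rw [hη]; exact div_le_one_of_le₀ hM1 (by positivity)
  have h1 : ∀ y, potential f (M ^ 2) D (extend f (M ^ 2) M h t y) ≤
      potential f (M ^ 2) D h - 2 * c * W y + W y ^ 2 := by
    intro y
    refine (potential_cons_le f (M ^ 2) D (by positivity) h _ t).trans (le_of_eq ?_)
    rw [← hc]
    simp only [hW]
    ring
  have h2 : ∀ y, |W y - η * (gap f (M ^ 2) h y * if CodeHolds t y then 1 else 0)| ≤ η ^ 2 :=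
    fun y => abs_newWeight_sub_le f M hM h t y
  have h3 : ∀ y, W y ^ 2 ≤ 9 * η ^ 2 := by
    intro y
    have h4 : |η * (gap f (M ^ 2) h y * if CodeHolds t y then 1 else 0)| ≤ 2 * η := by
      rw [abs_mul, abs_of_pos hη0, abs_mul]
      have h5 := abs_gap_le f (M ^ 2) h y
      split_ifs
      · rw [abs_one, mul_one]; nlinarith
      · rw [abs_zero, mul_zero, mul_zero]; positivity
    have h5 := h2 y
    have h6 : |W y| ≤ 3 * η := by
      rw [abs_le] at h4 h5 ⊢
      constructor <;> nlinarith
    rw [← sq_abs]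
    calc |W y| ^ 2 ≤ (3 * η) ^ 2 := pow_le_pow_left₀ (abs_nonneg _) h6 2
      _ = _ := by ring
  have h4 : |mean D W - η * c| ≤ η ^ 2 := by
    have h5 : mean D W - η * c =
        mean D fun y => W y - η * (gap f (M ^ 2) h y * if CodeHolds t y then 1 else 0) := by
      rw [mean_sub, mean_const_mul]
      rfl
    rw [h5]
    exact (abs_mean_le _ _).trans (mean_le_of_forall _ h2)
  have h5 := abs_correlation_le f (M ^ 2) D h t
  rw [← hc] at h5
  have h6 : (mean D fun y => potential f (M ^ 2) D (extend f (M ^ 2) M h t y)) ≤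
      potential f (M ^ 2) D h - 2 * c * mean D W + 9 * η ^ 2 := by
    refine (mean_mono D h1).trans ?_
    rw [mean_add, mean_sub, mean_const_mul, mean_const]
    have := mean_le_of_forall D h3
    linarith
  have h7 : |c * (mean D W - η * c)| ≤ 2 * η ^ 2 := by
    rw [abs_mul]
    exact mul_le_mul h5 h4 (abs_nonneg _) (by norm_num)
  have h8 := (abs_le.1 h7).1
  nlinarith

theorem lmean_roundDist_potential_le (hM : 0 < M) (k : ℕ) (h : List (ℤ × List ℤ)) :
    (lmean (roundDist f D (M ^ 2) k M h) fun h' => ENNReal.ofReal (potential f (M ^ 2) D h')) +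
      ENNReal.ofReal (2 * (1 / M)) * (lmean (candidateDist f D (M ^ 2) k h) fun t =>
        ENNReal.ofReal (correlation D (gap f (M ^ 2) h) t ^ 2)) ≤
      ENNReal.ofReal (potential f (M ^ 2) D h + 13 * (1 / (M : ℝ)) ^ 2) := by
  rw [roundDist, lmean_bind, ← lmean_const_mul, ← lmean_add]
  refine le_trans (lmean_mono fun t => ?_) (le_of_eq (lmean_const (candidateDist f D (M ^ 2) k h) _))
  rw [lmean_map, lmean_ofReal D fun y => potential_nonneg f (M ^ 2) D _,
    ← ENNReal.ofReal_mul (by positivity),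
    ← ENNReal.ofReal_add (mean_nonneg D fun y => potential_nonneg f (M ^ 2) D _) (by positivity)]
  exact ENNReal.ofReal_le_ofReal (mean_potential_extend_le f M D hM h t)

/-- The sum of the expected errors of the predictions so far. -/
noncomputable def lossSum : List (ℤ × List ℤ) → ℝ
  | [] => 0
  | _ :: h => lossSum h + loss f K D h

theorem lossSum_nonneg (h : List (ℤ × List ℤ)) : 0 ≤ lossSum f K D h := by
  induction h with
  | nil => exact le_rfl
  | cons p h ih => exact add_nonneg ih (loss_nonneg f K D h)

theorem lossSum_of_mem_support_roundDist {k : ℕ} {h h' : List (ℤ × List ℤ)}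
    (hh : h' ∈ (roundDist f D K k M h).support) :
    lossSum f K D h' = lossSum f K D h + loss f K D h := by
  simp only [roundDist, PMF.mem_support_bind_iff, PMF.mem_support_map_iff] at hh
  obtain ⟨t, -, y, -, rfl⟩ := hh
  rfl

/-- The drift of the potential plus `κ / M` times the accumulated errors: a round with a large error
pays for it by the expected decrease of the potential. -/
theorem lmean_roundDist_le (hM : 0 < M) (k : ℕ) (κ ε' : ℝ) (hκ : 0 < κ) (hε' : 0 ≤ ε')
    (h : List (ℤ × List ℤ))
    (hc : ε' ≤ loss f (M ^ 2) D h → ENNReal.ofReal κ ≤ lmean (candidateDist f D (M ^ 2) k h) fun t =>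
        ENNReal.ofReal (correlation D (gap f (M ^ 2) h) t ^ 2)) :
    (lmean (roundDist f D (M ^ 2) k M h) fun h' => ENNReal.ofReal (potential f (M ^ 2) D h') +
      ENNReal.ofReal (1 / M * κ * lossSum f (M ^ 2) D h')) ≤
      (ENNReal.ofReal (potential f (M ^ 2) D h) +
        ENNReal.ofReal (1 / M * κ * lossSum f (M ^ 2) D h)) +
      ENNReal.ofReal (13 * (1 / (M : ℝ)) ^ 2 + 1 / M * κ * ε') := by
  have hl := loss_nonneg f (M ^ 2) D h
  have hl2 := loss_le f (M ^ 2) D h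
  have hs := lossSum_nonneg f (M ^ 2) D h
  have hp := potential_nonneg f (M ^ 2) D h
  have h1 : (lmean (roundDist f D (M ^ 2) k M h) fun h' =>
      ENNReal.ofReal (1 / M * κ * lossSum f (M ^ 2) D h')) ≤
      ENNReal.ofReal (1 / M * κ * lossSum f (M ^ 2) D h) +
        ENNReal.ofReal (1 / M * κ * loss f (M ^ 2) D h) := by
    rw [← lmean_const (roundDist f D (M ^ 2) k M h) (_ + _)]
    refine lmean_mono_of_support fun h' hh => ?_
    rw [lossSum_of_mem_support_roundDist f (M ^ 2) M D hh, mul_add,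
      ENNReal.ofReal_add (by positivity) (by positivity)]
  have h2 := lmean_roundDist_potential_le f M D hM k h
  have h3 : (lmean (roundDist f D (M ^ 2) k M h) fun h' =>
      ENNReal.ofReal (potential f (M ^ 2) D h')) + ENNReal.ofReal (1 / M * κ * loss f (M ^ 2) D h) ≤
      ENNReal.ofReal (potential f (M ^ 2) D h) +
        ENNReal.ofReal (13 * (1 / (M : ℝ)) ^ 2 + 1 / M * κ * ε') := by
    rw [← ENNReal.ofReal_add hp (by positivity)]
    -- A small error is paid for by the summand with `ε'`. A large one, being at most `2`, is
    -- covered by `2 / M` times the mean squared correlation.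
    rcases lt_or_ge (loss f (M ^ 2) D h) ε' with hlt | hge
    · have h4 := le_trans le_self_add h2
      refine (add_le_add_left h4 _).trans ?_
      rw [← ENNReal.ofReal_add (by positivity) (by positivity)]
      refine ENNReal.ofReal_le_ofReal ?_
      have : 1 / M * κ * loss f (M ^ 2) D h ≤ 1 / M * κ * ε' := by gcongr
      linarith
    · have h4 : ENNReal.ofReal (1 / M * κ * loss f (M ^ 2) D h) ≤
          ENNReal.ofReal (2 * (1 / M)) * (lmean (candidateDist f D (M ^ 2) k h) fun t =>
            ENNReal.ofReal (correlation D (gap f (M ^ 2) h) t ^ 2)) := by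
        refine le_trans ?_ (mul_le_mul_right (hc hge) _)
        rw [← ENNReal.ofReal_mul (by positivity)]
        refine ENNReal.ofReal_le_ofReal ?_
        calc 1 / M * κ * loss f (M ^ 2) D h ≤ 1 / M * κ * 2 := by gcongr
          _ = _ := by ring
      refine ((add_le_add_right h4 _).trans h2).trans (ENNReal.ofReal_le_ofReal ?_)
      have : 0 ≤ 1 / M * κ * ε' := by positivity
      linarith
  rw [lmean_add]
  calc _ ≤ _ + (_ + _) := add_le_add_right h1 _
    _ = (_ + ENNReal.ofReal (1 / M * κ * loss f (M ^ 2) D h)) +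
        ENNReal.ofReal (1 / M * κ * lossSum f (M ^ 2) D h) := by ring
    _ ≤ _ := add_le_add_left h3 _
    _ = _ := by ring

theorem potential_nil (hK : 0 < K) : potential f K D [] = 1 := by
  have hK' : (K : ℝ) ≠ 0 := by exact_mod_cast hK.ne'
  rw [potential, ← mean_const D 1]
  congr 1
  funext x
  rw [gap, residual, predict]
  rcases Int.units_eq_one_or (f x) with h | h <;> rw [h] <;> simp [hK']

/-- With probability at least one half, the average error is small. -/
theorem half_le_lossSum_lt (hM : 0 < M) (k N : ℕ) (κ ε : ℝ) (hκ : 0 < κ) (hε : 0 < ε)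
    (hc : ∀ h, ε / 4 ≤ loss f (M ^ 2) D h →
      ENNReal.ofReal κ ≤ lmean (candidateDist f D (M ^ 2) k h) fun t =>
        ENNReal.ofReal (correlation D (gap f (M ^ 2) h) t ^ 2))
    (h1 : 13 * (1 / (M : ℝ)) ≤ κ * ε / 8) (h2 : 8 ≤ 1 / M * κ * (ε * N)) :
    1 / 2 ≤ (iterateBind (roundDist f D (M ^ 2) k M) [] N).toOuterMeasure
      {h | lossSum f (M ^ 2) D h < ε * N} := by
  set ν := iterateBind (roundDist f D (M ^ 2) k M) [] N with hν
  set S : Set (List (ℤ × List ℤ)) := {h | lossSum f (M ^ 2) D h < ε * N} with hS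
  have hM' : (0 : ℝ) < M := by exact_mod_cast hM
  have h3 := lmean_iterateBind_le (fun h => lmean_roundDist_le f M D hM k κ (ε / 4) hκ
    (by positivity) h (hc h)) [] N
  have h4 := mul_toOuterMeasure_le_lmean ν (fun h' => ENNReal.ofReal (potential f (M ^ 2) D h') +
      ENNReal.ofReal (1 / M * κ * lossSum f (M ^ 2) D h')) (ENNReal.ofReal (1 / M * κ * (ε * N)))
      Sᶜ (fun h hh => by
        have h5 : ε * N ≤ lossSum f (M ^ 2) D h := not_lt.1 hh
        refine le_trans (ENNReal.ofReal_le_ofReal ?_) le_add_self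
        gcongr)
  have h5 := h4.trans h3
  rw [potential_nil f (M ^ 2) D (by positivity), lossSum, mul_zero, ENNReal.ofReal_zero, add_zero,
    ← ENNReal.ofReal_natCast, ← ENNReal.ofReal_mul (by positivity),
    ← ENNReal.ofReal_add (by norm_num) (by positivity)] at h5
  -- With `X = κ * ε * N / M`, the initial potential `1` is at most `X / 8`, the second order terms
  -- contribute at most `X / 8`, and the small errors contribute `X / 4`.
  have h6 : (1 : ℝ) + N * (13 * (1 / (M : ℝ)) ^ 2 + 1 / M * κ * (ε / 4)) ≤
      1 / M * κ * (ε * N) * (1 / 2) := by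
    have h7 : N * (1 / (M : ℝ)) * (13 * (1 / (M : ℝ))) ≤ N * (1 / (M : ℝ)) * (κ * ε / 8) := by
      gcongr
    nlinarith
  have h7 := h5.trans (ENNReal.ofReal_le_ofReal h6)
  have hpos : (0 : ℝ) < 1 / M * κ * (ε * N) := by linarith
  rw [ENNReal.ofReal_mul hpos.le] at h7
  have h8 := (ENNReal.mul_le_mul_iff_right (ENNReal.ofReal_pos.2 hpos).ne'
    ENNReal.ofReal_ne_top).1 h7
  have h9 := toOuterMeasure_add_compl ν S
  have h10 : ENNReal.ofReal (1 / 2) = 1 / 2 := by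
    rw [ENNReal.ofReal_div_of_pos (by norm_num)]
    simp
  rw [h10] at h8
  by_contra hcon
  rw [not_le] at hcon
  have h11 := ENNReal.add_lt_add_of_lt_of_le (by
    exact ne_top_of_le_ne_top (by simp) h8) hcon h8
  rw [h9, ENNReal.add_halves] at h11
  exact lt_irrefl _ h11

/-! ## The hypothesis -/

/-- The difference is the sum of the gaps of all proper final segments, and the triangle inequality
applies. -/
theorem mean_abs_total_le (h : List (ℤ × List ℤ)) (hK : 0 < K) :
    (mean D fun x => |(h.length : ℝ) * ((f x : ℤ) : ℝ) - (total K h x : ℝ) / K|) ≤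
      lossSum f K D h := by
  have hK' : (K : ℝ) ≠ 0 := by exact_mod_cast hK.ne'
  induction h with
  | nil => simp [total, lossSum, mean_const]
  | cons p h ih =>
    rw [lossSum, loss]
    refine le_trans ?_ (add_le_add_left ih _)
    rw [← mean_add]
    refine mean_mono D fun x => ?_
    have h1 : (((p :: h).length : ℕ) : ℝ) * ((f x : ℤ) : ℝ) - (total K (p :: h) x : ℝ) / K =
        ((h.length : ℝ) * ((f x : ℤ) : ℝ) - (total K h x : ℝ) / K) + gap f K h x := by
      rw [gap, residual, total, List.length_cons]
      push_cast
      field_simp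
      ring
    rw [h1]
    exact abs_add_le _ _

/-- At a point where the sign of `total` is wrong, the quantity in `mean_abs_total_le` is at least
`h.length`. So the probability of an error is at most the average loss. -/
theorem isClose_of_lossSum_lt (h : List (ℤ × List ℤ)) (hK : 0 < K) (ε ε₀ : ℝ) (hε : ε₀ ≤ ε)
    (hN : 0 < h.length) (hl : lossSum f K D h < ε₀ * h.length) :
    IsClose D ε f fun x => if 0 ≤ total K h x then 1 else -1 := by
  classical
  set G : Set (Cube n) := {x | (if 0 ≤ total K h x then (1 : ℤ) else -1) = ((f x : ℤˣ) : ℤ)} with hG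
  have hN' : (0 : ℝ) < h.length := by exact_mod_cast hN
  have hK' : (0 : ℝ) < K := by exact_mod_cast hK
  have h1 : ∀ x, (h.length : ℝ) - h.length * (if x ∈ G then 1 else 0) ≤
      |(h.length : ℝ) * ((f x : ℤ) : ℝ) - (total K h x : ℝ) / K| := by
    intro x
    by_cases hx : x ∈ G
    · rw [if_pos hx, mul_one, sub_self]
      exact abs_nonneg _
    · rw [if_neg hx, mul_zero, sub_zero]
      rw [hG, Set.mem_ofPred_eq] at hx
      rcases Int.units_eq_one_or (f x) with hf | hf <;> rw [hf] at hx ⊢ <;> split_ifs at hx with ht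
      · simp at hx
      · have h2 : ((total K h x : ℤ) : ℝ) ≤ 0 := by exact_mod_cast (not_le.1 ht).le
        have h3 : ((total K h x : ℤ) : ℝ) / K ≤ 0 := div_nonpos_of_nonpos_of_nonneg h2 hK'.le
        refine le_trans ?_ (le_abs_self _)
        push_cast
        linarith
      · have h2 : (0 : ℝ) ≤ ((total K h x : ℤ) : ℝ) := by exact_mod_cast ht
        have h3 : 0 ≤ ((total K h x : ℤ) : ℝ) / K := by positivity
        refine le_trans ?_ (neg_le_abs _)
        push_cast
        linarith
      · simp at hx
  have h2 := (mean_mono D h1).trans (mean_abs_total_le f K D h hK)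
  rw [mean_sub, mean_const_mul, mean_const] at h2
  have h3 : 1 - ε ≤ mean D fun x => if x ∈ G then (1 : ℝ) else 0 := by
    have h4 : (h.length : ℝ) * (1 - ε₀) < h.length * mean D fun x => if x ∈ G then (1 : ℝ) else 0 := by
      linarith
    have h5 := lt_of_mul_lt_mul_left h4 hN'.le
    linarith
  have h4 : D.toOuterMeasure G = ENNReal.ofReal (mean D fun x => if x ∈ G then (1 : ℝ) else 0) := by
    rw [toOuterMeasure_eq_lmean, ← lmean_ofReal D fun x => by split_ifs <;> norm_num]
    congr 1
    funext x
    by_cases hx : x ∈ G <;> simp [hx]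
  rw [IsClose]
  refine (ENNReal.ofReal_le_ofReal h3).trans (le_of_eq h4.symm)

end

/-! ## The choice of the parameters -/

section

variable {n : ℕ} (f : Cube n → ℤˣ) (μ : Fin n → Set.Ioo (-1 : ℝ) 1)

/-- With the parameters of the algorithm, a large error entails that a new term is correlated in the
mean. -/
theorem le_lmean_candidateDist_of_loss {c : ℝ} (hμ : IsBoundedBy c μ) (e : ℕ)
    (he : (1 - c / 2) ^ e ≤ 1 / 2) (hc : c ≤ 1) (s a l K : ℕ) (ha : 0 < a) (hK : 0 < K)
    (hl : n + s + a + 8 ≤ 2 ^ l) (hf : IsDNFOfSize f s) (h : List (ℤ × List ℤ))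
    (hh : 1 / (a : ℝ) / 4 ≤ loss f K (productDist μ) h) :
    ENNReal.ofReal (1 / (16 * (2 ^ l) ^ (5 * (4 * e + 4) + 3))) ≤
      lmean (candidateDist f (productDist μ) K ((2 * (4 * e + 4) + 3) * l) h) fun t =>
        ENNReal.ofReal (correlation (productDist μ) (gap f K h) t ^ 2) := by
  have hl' : (n : ℝ) + s + a + 8 ≤ 2 ^ l := by exact_mod_cast hl
  obtain ⟨q, hq⟩ : ∃ q : ℝ, 2 ^ l = q := ⟨_, rfl⟩
  rw [hq] at hl' ⊢
  have ha' : (1 : ℝ) ≤ a := by exact_mod_cast ha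
  have hn0 : (0 : ℝ) ≤ n := Nat.cast_nonneg n
  have hs0 : (0 : ℝ) ≤ s := Nat.cast_nonneg s
  have hq8 : 8 ≤ q := by linarith
  have hq0 : 0 < q := by linarith
  have h64 : 64 ≤ q ^ 2 := by nlinarith
  -- Chosen so that `(2 * s + 1) * γ` is the assumed lower bound `1 / (4 * a)` of the error.
  set γ : ℝ := 1 / (4 * a * (2 * s + 1)) with hγ
  have hγ0 : 0 < γ := by positivity
  have hγq : 1 / q ^ 4 ≤ γ / 2 := by
    have h1 : γ / 2 = 1 / (8 * a * (2 * s + 1)) := by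
      rw [hγ]
      field_simp
      ring
    rw [h1]
    refine one_div_le_one_div_of_le (by positivity) ?_
    calc 8 * (a : ℝ) * (2 * s + 1) ≤ q * q * (q * q) := by
          gcongr
          · linarith
          · nlinarith
      _ = _ := by ring
  obtain ⟨R, b, hR⟩ := exists_large_covariance_gap f K μ hμ e he hc h s hf γ hγ0 (by
    refine le_trans (le_of_eq ?_) hh
    rw [hγ]
    field_simp)
  -- As `γ / 2 ≥ q ^ (-4)`, this is a lower bound for the covariance `γ * (γ / 2) ^ e`.
  set β : ℝ := 1 / q ^ (4 * e + 4) with hβ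
  have hβ0 : 0 < β := by positivity
  have hβR : β ≤ |covariance μ (gap f K h) R b| := by
    refine le_trans ?_ hR
    calc β = 1 / q ^ 4 * (1 / q ^ 4) ^ e := by
          rw [hβ, one_div_pow, ← pow_mul, one_div_mul_one_div, ← pow_add, add_comm]
      _ ≤ γ * (γ / 2) ^ e := by
          gcongr
          linarith
  have h2k : (2 : ℝ) ^ ((2 * (4 * e + 4) + 3) * l) = q ^ (2 * (4 * e + 4) + 3) := by
    rw [← hq, ← pow_mul, mul_comm]
  -- The number of points is such that `2 ^ k * β ^ 2 = q ^ 3`, which exceeds `32 * n`. The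
  -- resulting bound is `1 / (2 * q ^ (2b+3)) * (1 / (8 * q ^ b)) * (1 / q ^ (2b))` with `b = 4 * e
  -- + 4`.
  have h3 := le_lmean_candidateDist f K μ hK h R b ((2 * (4 * e + 4) + 3) * l) β hβ0 (by
    rw [h2k, hβ, pow_add, pow_mul', one_div_pow]
    rw [mul_comm (_ ^ 2), mul_assoc, mul_one_div_cancel (by positivity), mul_one]
    calc 32 * (n : ℝ) ≤ q ^ 2 * q := by
          gcongr <;> linarith
      _ = q ^ 3 := by ring) hβR
  refine le_trans (le_of_eq ?_) h3
  congr 1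
  rw [one_div_pow, pow_succ (2 : ℝ), h2k, hβ]
  generalize 4 * e + 4 = b
  rw [pow_add, pow_add, pow_mul', pow_mul']
  field_simp
  ring

theorem half_le_isClose {c : ℝ} (hμ : IsBoundedBy c μ) (e : ℕ)
    (he : (1 - c / 2) ^ e ≤ 1 / 2) (hc : c ≤ 1) (s a l : ℕ) (ha : 0 < a)
    (hl : n + s + a + 8 ≤ 2 ^ l) (hf : IsDNFOfSize f s) (ε : ℝ) (hε : 1 / (a : ℝ) ≤ ε)
    (b : ℕ) (hb : b = 4 * e + 4)
    (hlen : ∀ h ∈ (iterateBind (roundDist f (productDist μ) ((2 ^ l) ^ (10 * b + 18))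
      ((2 * b + 3) * l) ((2 ^ l) ^ (5 * b + 9))) [] ((2 ^ l) ^ (10 * b + 17))).support,
      h.length = (2 ^ l) ^ (10 * b + 17)) :
    1 / 2 ≤ (iterateBind (roundDist f (productDist μ) ((2 ^ l) ^ (10 * b + 18))
      ((2 * b + 3) * l) ((2 ^ l) ^ (5 * b + 9))) [] ((2 ^ l) ^ (10 * b + 17))).toOuterMeasure
      {h | IsClose (productDist μ) ε f fun x =>
        if 0 ≤ total (((2 ^ l) ^ (10 * b + 18) : ℕ) : ℤ) h x then 1 else -1} := by
  have hK : (2 ^ l) ^ (10 * b + 18) = ((2 ^ l) ^ (5 * b + 9)) ^ 2 := by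
    rw [← pow_mul (2 ^ l) (5 * b + 9) 2]
    congr 1
    ring
  have hq : (n : ℝ) + s + a + 8 ≤ 2 ^ l := by exact_mod_cast hl
  have ha' : (1 : ℝ) ≤ a := by exact_mod_cast ha
  have hn0 : (0 : ℝ) ≤ n := Nat.cast_nonneg n
  have hs0 : (0 : ℝ) ≤ s := Nat.cast_nonneg s
  have h1 := half_le_lossSum_lt f ((2 ^ l) ^ (5 * b + 9)) (productDist μ) (by positivity)
    ((2 * b + 3) * l) ((2 ^ l) ^ (10 * b + 17)) (1 / (16 * (2 ^ l) ^ (5 * b + 3))) (1 / a)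
    (by positivity) (by positivity)
    (fun h hh => by
      subst hb
      exact le_lmean_candidateDist_of_loss f μ hμ e he hc s a l _ ha (by positivity) hl hf h hh)
    (by
      push_cast
      generalize (2 : ℝ) ^ l = q at *
      have hq0 : 0 < q := by linarith
      have h2 : q ^ (5 * b + 9) = q ^ (5 * b + 3) * q ^ 6 := by rw [← pow_add]
      -- Here `1664 = 13 * 128`. The step size `1 / M` carries the factor `q ^ (-6)` beyond `κ` so
      -- that the second order terms stay below `κ * ε / 8`.
      have h3 : 1664 * (a : ℝ) ≤ q ^ 6 := by
        calc 1664 * (a : ℝ) ≤ 8 ^ 5 * a := by gcongr; norm_num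
          _ ≤ q ^ 5 * q := by gcongr <;> linarith
          _ = q ^ 6 := by ring
      rw [h2]
      generalize q ^ 6 = u at *
      have hu : 0 < u := by linarith
      have hw : 0 < q ^ (5 * b + 3) := by positivity
      generalize q ^ (5 * b + 3) = w at *
      rw [show 13 * (1 / (w * u)) = 13 / (w * u) by ring,
        show 1 / (16 * w) * (1 / (a : ℝ)) / 8 = 1 / (128 * (w * a)) by field_simp; norm_num,
        div_le_div_iff₀ (by positivity) (by positivity)]
      nlinarith)
    (by
      push_cast
      generalize (2 : ℝ) ^ l = q at *
      have hq0 : 0 < q := by linarith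
      have h2 : q ^ (10 * b + 17) = q ^ (5 * b + 9) * q ^ (5 * b + 3) * q ^ 5 := by
        rw [← pow_add, ← pow_add]
        congr 1
        ring
      -- Here `128 = 8 * 16`. The number of rounds exceeds `M * q ^ (5b+3)` by the factor `q ^ 5`,
      -- which makes the total progress at least `8`.
      have h3 : 128 * (a : ℝ) ≤ q ^ 5 := by
        calc 128 * (a : ℝ) ≤ 8 ^ 4 * a := by gcongr; norm_num
          _ ≤ q ^ 4 * q := by gcongr <;> linarith
          _ = q ^ 5 := by ring
      rw [h2, show 1 / q ^ (5 * b + 9) * (1 / (16 * q ^ (5 * b + 3))) *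
        (1 / (a : ℝ) * (q ^ (5 * b + 9) * q ^ (5 * b + 3) * q ^ 5)) = q ^ 5 / (16 * a) by
          field_simp, le_div_iff₀ (by positivity)]
      linarith)
  rw [← hK] at h1
  refine h1.trans (PMF.toOuterMeasure_mono _ ?_)
  rintro h ⟨h2, h3⟩
  have h4 := hlen h h3
  refine isClose_of_lossSum_lt f _ (productDist μ) h (by positivity) ε (1 / a) hε
    (by rw [h4]; positivity) ?_
  rw [h4]
  exact h2

end

end DNFLearn

theorem mainTheorem7 (c : ℝ) (hc0 : 0 < c) (hc1 : c ≤ 1) :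
    ∃ (H : DNFLearn.Ty)
      (A : DNFLearn.Alg (.prod .int (.prod .int .int)) H)
      (E : DNFLearn.Fn (.prod H (.list .int)) .int),
      DNFLearn.EfficientlyLearnsDNF A E (DNFLearn.boundedProductDists c) := by
  open DNFLearn in
  obtain ⟨e, he⟩ := exists_pow_lt_of_lt_one (show (0 : ℝ) < 1 / 2 by norm_num)
    (show 1 - c / 2 < 1 by linarith)
  -- `q ^ (-b)` is the size of the covariances. Through `e` this exponent depends on `c` only, and
  -- it is built into the program.
  obtain ⟨b, hb⟩ : ∃ b, b = 4 * e + 4 := ⟨_, rfl⟩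
  -- The base `2 * X + 16` comes from `2 ^ l < 2 * (n + s + a + 8)` for `a = ⌈1 / ε⌉₊`.
  refine ⟨_, learner b, Fn.evaluator,
    Polynomial.C (40000 * (b + 1)) * (2 * Polynomial.X + 16) ^ (24 * b + 43), ?_⟩
  rintro n s ε hε D ⟨μ, hμ, rfl⟩ f hf
  obtain ⟨l, hl1, hl2, ⟨hrun, htime⟩, hlen⟩ :=
    runs_learner b n s ⌈1 / ε⌉₊ f (productDist μ)
  have ha : 0 < ⌈1 / ε⌉₊ := Nat.ceil_pos.2 (by positivity)
  have haε : 1 / ((⌈1 / ε⌉₊ : ℕ) : ℝ) ≤ ε := by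
    rw [one_div_le (by exact_mod_cast ha) hε]
    exact Nat.le_ceil _
  have hp : Polynomial.eval (n + s + ⌈1 / ε⌉₊)
      (Polynomial.C (40000 * (b + 1)) * (2 * Polynomial.X + 16) ^ (24 * b + 43)) =
      40000 * (b + 1) * (2 * (n + s + ⌈1 / ε⌉₊) + 16) ^ (24 * b + 43) := by
    simp
  rw [hp]
  have hle : 40000 * (b + 1) * (2 ^ l) ^ (24 * b + 43) ≤
      40000 * (b + 1) * (2 * (n + s + ⌈1 / ε⌉₊) + 16) ^ (24 * b + 43) := by
    gcongr
    omega
  have hmem : ∀ r ∈ ((learner b).run f (productDist μ) (learnerInput n s ε)).support,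
      ∃ h ∈ (iterateBind (roundDist f (productDist μ) ((2 ^ l) ^ (10 * b + 18))
        ((2 * b + 3) * l) ((2 ^ l) ^ (5 * b + 9))) [] ((2 ^ l) ^ (10 * b + 17))).support,
        r.1 = (((n : ℤ), (((2 ^ l) ^ (10 * b + 18) : ℕ) : ℤ)), h) := by
    intro r hr
    have h1 : r.1 ∈ (((learner b).run f (productDist μ) (learnerInput n s ε)).map
        Prod.fst).support := (PMF.mem_support_map_iff _ _ _).2 ⟨r, hr, rfl⟩
    rw [learnerInput, hrun, PMF.mem_support_map_iff] at h1
    obtain ⟨h, hh, h2⟩ := h1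
    exact ⟨h, hh, h2.symm⟩
  refine ⟨fun r hr => ⟨(htime r hr).trans hle, fun x => ?_⟩, ?_⟩
  · obtain ⟨h, hh, h1⟩ := hmem r hr
    rw [h1]
    refine (Fn.time_evaluator_le _ h x).trans (le_trans ?_ hle)
    rw [hlen h hh]
    have hn : n + 1 ≤ 2 ^ l := by omega
    have hq : 1 ≤ 2 ^ l := Nat.one_le_two_pow
    generalize 2 ^ l = q at *
    have h2 : 1 ≤ q ^ (10 * b + 17) := Nat.one_le_pow _ _ hq
    calc (q ^ (10 * b + 17) + 1) * (500 * (n + 1) ^ 2) ≤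
          (2 * q ^ (10 * b + 17)) * (500 * q ^ 2) := by
          gcongr
          omega
      _ = 1000 * q ^ (10 * b + 19) := by ring
      _ ≤ 40000 * (b + 1) * q ^ (24 * b + 43) := by
          gcongr <;> omega
  · have h1 := half_le_isClose f μ hμ e he.le hc1 s ⌈1 / ε⌉₊ l ha hl1 hf ε haε b hb hlen
    have h2 : {r : _ × ℕ | IsClose (productDist μ) ε f fun x =>
        Fn.evaluator.eval (r.1, encodePoint x)} = Prod.fst ⁻¹' {v | IsClose (productDist μ) ε f
          fun x => Fn.evaluator.eval (v, encodePoint x)} := rfl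
    rw [h2, ← PMF.toOuterMeasure_map_apply, learnerInput, hrun, PMF.toOuterMeasure_map_apply]
    refine h1.trans (le_of_eq (congrArg _ ?_))
    ext h
    exact iff_of_eq (congrArg (IsClose (productDist μ) ε f)
      (funext fun x => (Fn.eval_evaluator _ h x).symm))
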